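/- **Theorem (Asymptotic Behavior).** Let $d \ge 4$ and $\alpha \ge 0$. Let $f_0 \ge 0$, $f_0 \in L^1(\mathbb{R}^{2d})$, and let $f$ be a global classical $C^1_0$ solution on $[0,\infty)\times\mathbb{R}^{2d}$, with $f(0)=f_0$, of the repulsive Vlasov–Poisson system $$\partial_t f + v\cdot\nabla_x f + E\cdot\nabla_v f = 0,\qquad \rho(t,x)=\int f(t,x,v)\,dv,\qquad E(t,x)=\nabla_x(\Delta_x)^{-1}\rho(t,x) = \frac{1}{d\,\omega_d}\int \frac{x-y}{|x-y|^d}\,\rho(t,y)\,dy,$$ where $\omega_d$ is the volume of the unit ball of $\mathbb{R}^d$. That is, $f$ is $C^1$ on $[0,\infty)\times\mathbb{R}^{2d}$, each $f(t)$ tends to zero at infinity, the integrals defining $\rho(t,x)$ and $E(t,x)$ converge absolutely, $E$ and $\nabla_x E$ exist, are continuous on $[0,\infty)\times\mathbb{R}^d$ and are bounded on $[0,T]\times\mathbb{R}^d$ for each $T$, and the equations hold pointwise. Assume that * $\iint |x-\alpha v|^n f_0(x,v)\,dv\,dx<\infty$ for some real $n>d(d-1)$; * $\|E(t)\|_\infty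 \lesssim (t+\alpha)^{-a}$ for some $a>\frac{d^2-d-4}{d^2-2d-2}$; * $\langle x-\alpha v\rangle^p f_0\in W^{1,\infty}(\mathbb{R}^{2d})$ for some real $p>d+1$, where $\langle u\rangle=\sqrt{1+|u|^2}$. Here $A(t)\lesssim B(t)$ means that there is a constant $C$, independent of $t$, such that $A(t)\le C B(t)$ for all $t\ge 0$ with $t+\alpha>0$. Put $j(t,x)=\int v f(t,x,v)\,dv$ and $F(t,v)=\int f(t,x,v)\,dx$. Then $F(t,v)$ is given by an absolutely convergent integral for all $t\ge0$ and $v$, as is $j(t,x)$ for all $x$ and all $t\ge 0$ with $t+\alpha>0$, and the following hold. (a) There is a continuous $F_\infty\in L^1(\mathbb{R}^d)\cap L^\infty(\mathbb{R}^d)$ such that $F(t,v)\to F_\infty(v)$ uniformly as $t\to\infty$, with $$\|F(t)-F_\infty\|_\infty\lesssim (t+\alpha)^{2-d}.$$ (b) With $E_\infty = \nabla_v(\Delta_v)^{-1}F_\infty$ (defined by the same, absolutely convergent, convolution integral), $$\sup_{x\in\mathbb{R}^d}\left|(t+\alpha)^{d-1}E(t,x)-E_\infty\left(\tfrac{x}{t+\alpha}\right)\right|\lesssim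 (t+\alpha)^{\frac{1-d}{d}},$$ $$\sup_{x\in\mathbb{R}^d}\left|(t+\alpha)^{d}\rho(t,x)-F_\infty\left(\tfrac{x}{t+\alpha}\right)\right|\lesssim (t+\alpha)^{-1},$$ and, for every $K$, with a constant that may depend on $K$, $$\sup_{|x|\le K(t+\alpha)}\left|(t+\alpha)^{d}j(t,x)-\tfrac{x}{t+\alpha}F_\infty\left(\tfrac{x}{t+\alpha}\right)\right|\lesssim (t+\alpha)^{-1}.$$ (c) There is a continuous $f_\infty\in L^1(\mathbb{R}^{2d})\cap L^\infty(\mathbb{R}^{2d})$ such that $f(t,x+v(t+\alpha),v)\to f_\infty(x,v)$ uniformly in $(x,v)$ as $t\to\infty$, with $$\sup_{(x,v)\in\mathbb{R}^{2d}}\left|f(t,x+v(t+\alpha),v)-f_\infty(x,v)\right|\lesssim (t+\alpha)^{3-d}.$$ -/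

import Mathlib

open MeasureTheory Filter Set Topology

noncomputable section

namespace VlasovPoisson

/-- The space `ℝ^d` with its Euclidean norm; used both for positions and for velocities. -/
abbrev Sp (d : ℕ) : Type := EuclideanSpace ℝ (Fin d)

/-- The Japanese bracket `⟨u⟩ = √(1 + |u|²)`. -/
def bracket {d : ℕ} (u : Sp d) : ℝ := Real.sqrt (1 + ‖u‖ ^ 2)

/-- The volume of the unit ball of `ℝ^d`. -/
def unitBallVolume (d : ℕ) : ℝ := (volume (Metric.ball (0 : Sp d) 1)).toReal

/-- The kernel `z ↦ z / (d ω_d |z|^d)`, the gradient of the fundamental solution of `Δ`. -/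
def kernel {d : ℕ} (z : Sp d) : Sp d :=
  (1 / ((d : ℝ) * unitBallVolume d * ‖z‖ ^ d)) • z

/-- `∇ Δ⁻¹ φ`, as the convolution of `φ` with the kernel. -/
def gradInvLaplacian {d : ℕ} (φ : Sp d → ℝ) (x : Sp d) : Sp d :=
  ∫ y, φ y • kernel (x - y)

/-- The charge density `ρ(x) = ∫ f(x,v) dv` of a phase-space density at a fixed time. -/
def density {d : ℕ} (f : Sp d → Sp d → ℝ) (x : Sp d) : ℝ := ∫ v, f x v

/-- The electric field `E = ∇ Δ⁻¹ ρ` induced by a phase-space density at a fixed time. -/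
def field {d : ℕ} (f : Sp d → Sp d → ℝ) : Sp d → Sp d := gradInvLaplacian (density f)

/-- The current density `j(x) = ∫ v f(x,v) dv`. -/
def current {d : ℕ} (f : Sp d → Sp d → ℝ) (x : Sp d) : Sp d := ∫ v, f x v • v

/-- The spatial average `F(v) = ∫ f(x,v) dx`. -/
def spatialAverage {d : ℕ} (f : Sp d → Sp d → ℝ) (v : Sp d) : ℝ := ∫ x, f x v

/-- A function on a phase space `V` belongs to `W^{1,∞}`: it is (essentially) bounded, and it has
an essentially bounded weak gradient, given here as a field `G` of linear forms. -/
def MemW1Infty {V : Type*} [NormedAddCommGroup V] [NormedSpace ℝ V] [MeasureSpace V]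
    (h : V → ℝ) : Prop :=
  MemLp h ⊤ volume ∧
    ∃ G : V → (V →L[ℝ] ℝ), MemLp G ⊤ volume ∧
      ∀ φ : V → ℝ, ContDiff ℝ (⊤ : ℕ∞) φ → HasCompactSupport φ →
        ∀ e : V, ∫ z, h z * fderiv ℝ φ z e = - ∫ z, G z e * φ z

/-- `f` is a global `C¹₀` (classical) solution of the repulsive Vlasov-Poisson system on
`[0,∞) × ℝ^d × ℝ^d` with initial datum `f₀`. Only the values `f t` with `0 ≤ t` matter. -/
structure IsClassicalSolution {d : ℕ} (f₀ : Sp d → Sp d → ℝ) (f : ℝ → Sp d → Sp d → ℝ) :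
    Prop where
  /-- `f` is continuously differentiable in all its variables, up to `t = 0`. -/
  contDiffOn : ContDiffOn ℝ 1 (fun z : ℝ × Sp d × Sp d => f z.1 z.2.1 z.2.2)
    (Ici (0 : ℝ) ×ˢ univ)
  /-- Each `f t` tends to zero at infinity in phase space. -/
  vanishes : ∀ t : ℝ, 0 ≤ t →
    Tendsto (fun z : Sp d × Sp d => f t z.1 z.2) (cocompact (Sp d × Sp d)) (𝓝 0)
  /-- The initial condition. -/
  initial : ∀ x v : Sp d, f 0 x v = f₀ x v
  /-- The charge density exists everywhere. -/
  density_exists : ∀ t : ℝ, 0 ≤ t → ∀ x : Sp d, Integrable (fun v => f t x v)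
  /-- The field exists everywhere. -/
  field_exists : ∀ t : ℝ, 0 ≤ t → ∀ x : Sp d,
    Integrable (fun y => density (f t) y • kernel (x - y))
  /-- The field is continuous in `(t,x)`, -/
  field_continuousOn : ContinuousOn (fun z : ℝ × Sp d => field (f z.1) z.2)
    (Ici (0 : ℝ) ×ˢ univ)
  /-- it is differentiable in `x`, -/
  field_differentiable : ∀ t : ℝ, 0 ≤ t → Differentiable ℝ (field (f t))
  /-- its `x`-derivative is continuous in `(t,x)`, -/
  field_fderiv_continuousOn :
    ContinuousOn (fun z : ℝ × Sp d => fderiv ℝ (field (f z.1)) z.2) (Ici (0 : ℝ) ×ˢ univ)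
  /-- and both are bounded on each bounded time interval. -/
  field_locally_bounded : ∀ T : ℝ, ∃ C : ℝ, ∀ t : ℝ, 0 ≤ t → t ≤ T → ∀ x : Sp d,
    ‖field (f t) x‖ ≤ C ∧ ‖fderiv ℝ (field (f t)) x‖ ≤ C
  /-- The Vlasov equation `∂ₜ f + v · ∇ₓ f + E · ∇ᵥ f = 0` (one-sided in time at `t = 0`). -/
  vlasov : ∀ t : ℝ, 0 ≤ t → ∀ x v : Sp d,
    derivWithin (fun s => f s x v) (Ici 0) t
      + fderiv ℝ (fun y => f t y v) x v
      + fderiv ℝ (fun w => f t x w) v (field (f t) x) = 0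

end VlasovPoisson

end

/-! Everything is done in the coordinates `(y, v) = (x - τ v, v)` with `τ = t + α`, in which free
transport is the identity. There the solution `g = sheared α f` is carried by the divergence-free
field `(-τ E, E)`, so `g` stays close to its datum as soon as `τ E` is integrable in time. The work
lies in reaching the decay `E = O(t^(1-d))` and `∇E = O(t^(-d))` from the weaker assumed rate.

Dispersion. The second moment of `y` plus `τ²` times the pair interaction energy has time derivative
`τ ∬ (2 Φ(z) - ∇(-Φ)(z) · z)`, where `z` is the difference of positions and `Φ` is proportional to
`|z|^(2-d)`. The integrand is `(2/(d-2) - 1)` times a positive quantity, hence nonpositive exactly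
because `d ≥ 4`. The singular interaction is regularized to justify this, and
`exists_secondMoment_le` bounds the second moment uniformly in time.

Decay of the field. Let `R` bound the displacement of `y` along characteristics up to time `t`.
Since the datum decays in `y`, the density is at most of order `(R/τ)^d`. Interpolating this with
the second moment gives `|E| ≲ τ^(1-d) R^(d-1-2/d)` (`norm_efield_le`). Conversely, decay `t^(-b)`
with `b < 2` gives `R ≲ t^(2-b)`. The resulting affine map of exponents has slope greater than `1`,
and its fixed point is the threshold in the hypothesis. Starting above it, finitely many iterations
bring the exponent above `2` (`exists_hasFieldDecay_gt_two`); then `R` is bounded and the field has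
the sharp rate.

Regularity. A potential estimate bounds `∇E` by `t^(-d) (1 + log D)`, where `D` is the Lipschitz
constant of the backward flow, while Grönwall bounds `log D` linearly by the size of `∇E`. From a
late enough time on, the feedback factor is at most `1/2`, so iteration closes the bound
(`exists_regularity`). Hence `g` and `∇g` are bounded by `(1 + |y|)^(-p)` uniformly in time
(`exists_sharpBounds`).

Limits. The estimate `∂ₜ g = O((1+t)^(2-d))` yields scattering. For the spatial average, integrating
by parts in `y` puts the derivative of the term `τ E · ∇_y g` on `E`, which gains one power of `t`.
Finally `τ^d ρ(x) = ∫ g(y, (x-y)/τ) dy` differs from the spatial average at `x/τ` by `O(1/τ)`, and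
the profiles of the current and of the field follow from this by direct estimates. -/

noncomputable section

namespace VlasovPoisson

open scoped NNReal ENNReal

/-! ### Global flows of bounded, locally Lipschitz, time-dependent vector fields -/

section Flow

variable {V : Type*} [NormedAddCommGroup V] [NormedSpace ℝ V]

/-- A time-dependent vector field that is jointly continuous and, locally uniformly in time,
bounded and globally Lipschitz in space. -/
structure IsFlowField (W : ℝ → V → V) : Prop where
  cont : Continuous fun p : ℝ × V => W p.1 p.2
  bdd : ∀ T : ℝ, ∃ C : ℝ, 0 ≤ C ∧ ∀ t, |t| ≤ T → ∀ z, ‖W t z‖ ≤ C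
  lip : ∀ T : ℝ, ∃ K : ℝ≥0, ∀ t, |t| ≤ T → LipschitzWith K (W t)

namespace IsFlowField

variable {W : ℝ → V → V}

theorem eqOn_of_hasDerivAt (hW : IsFlowField W) {γ₁ γ₂ : ℝ → V} {T s : ℝ} (hs : |s| < T)
    (h₁ : ∀ t, |t| < T → HasDerivAt γ₁ (W t (γ₁ t)) t)
    (h₂ : ∀ t, |t| < T → HasDerivAt γ₂ (W t (γ₂ t)) t) (h : γ₁ s = γ₂ s) {t : ℝ} (ht : |t| < T) :
    γ₁ t = γ₂ t := by
  obtain ⟨K, hK⟩ := hW.lip T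
  refine ODE_solution_unique_of_mem_Ioo (v := W) (s := fun _ => univ) (K := K) (a := -T) (b := T)
    (fun r hr => (hK r (abs_lt.2 hr).le).lipschitzOnWith) (abs_lt.1 hs)
    (fun r hr => ⟨h₁ r (abs_lt.2 hr), trivial⟩) (fun r hr => ⟨h₂ r (abs_lt.2 hr), trivial⟩) h
    (abs_lt.1 ht)

theorem exists_solution_Ioo [CompleteSpace V] (hW : IsFlowField W) {s T : ℝ} (hs : |s| < T)
    (z : V) : ∃ γ : ℝ → V, γ s = z ∧ ∀ t, |t| < T → HasDerivAt γ (W t (γ t)) t := by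
  obtain ⟨K, hK⟩ := hW.lip T
  obtain ⟨C, hC, hCb⟩ := hW.bdd T
  have hT : 0 ≤ T := (abs_nonneg s).trans hs.le
  -- The field is bounded by `C` on the whole space, so a ball of radius `2 T C` cannot be left
  -- during the interval, and one application of Picard-Lindelöf covers all of it.
  have hp : IsPicardLindelof W (tmin := -T) (tmax := T) ⟨s, (abs_lt.1 hs).1.le, (abs_lt.1 hs).2.le⟩
      z (C.toNNReal * (2 * T).toNNReal) 0 C.toNNReal K := by
    refine ⟨fun t ht => (hK t (abs_le.2 ht)).lipschitzOnWith, fun x _ => ?_, fun t ht x _ => ?_, ?_⟩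
    · exact (hW.cont.comp (continuous_id.prodMk continuous_const)).continuousOn
    · rw [Real.coe_toNNReal _ hC]; exact hCb t (abs_le.2 ht) x
    · simp only [NNReal.coe_mul, Real.coe_toNNReal _ hC, NNReal.coe_zero, sub_zero,
        Real.coe_toNNReal _ (by linarith : (0 : ℝ) ≤ 2 * T)]
      refine mul_le_mul_of_nonneg_left (max_le ?_ ?_) hC <;>
        linarith [(abs_lt.1 hs).1, (abs_lt.1 hs).2]
  obtain ⟨γ, h0, hγ⟩ := hp.exists_eq_forall_mem_Icc_hasDerivWithinAt (x := z) (by simp)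
  refine ⟨γ, h0, fun t ht => (hγ t (abs_le.1 ht.le)).hasDerivAt ?_⟩
  exact Icc_mem_nhds (abs_lt.1 ht).1 (abs_lt.1 ht).2

theorem exists_solution [CompleteSpace V] (hW : IsFlowField W) (s : ℝ) (z : V) :
    ∃ γ : ℝ → V, γ s = z ∧ ∀ t, HasDerivAt γ (W t (γ t)) t := by
  have hs : ∀ n : ℕ, |s| < |s| + 1 + n := fun n => by linarith [n.cast_nonneg (α := ℝ)]
  choose γ hγs hγ using fun n : ℕ => hW.exists_solution_Ioo (hs n) z
  have key : ∀ (n m : ℕ) (t : ℝ), |t| < |s| + 1 + n → |t| < |s| + 1 + m → γ n t = γ m t := by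
    intro n m t hn hm
    wlog h : n ≤ m generalizing n m
    · exact (this m n hm hn (le_of_not_ge h)).symm
    have h' : (n : ℝ) ≤ m := by exact_mod_cast h
    exact hW.eqOn_of_hasDerivAt (hs n) (hγ n) (fun r hr => hγ m r (by linarith))
      ((hγs n).trans (hγs m).symm) hn
  have hlt : ∀ t : ℝ, |t| < |s| + 1 + (⌈|t|⌉₊ : ℝ) := fun t => by
    linarith [Nat.le_ceil |t|, abs_nonneg s]
  -- The solutions on growing intervals agree by uniqueness; at time `t` the one of index `⌈|t|⌉` is
  -- read off, since its interval is a neighbourhood of `t`.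
  refine ⟨fun t => γ ⌈|t|⌉₊ t, hγs _, fun t => ?_⟩
  refine (hγ ⌈|t|⌉₊ t (hlt t)).congr_of_eventuallyEq ?_
  have : ∀ᶠ r in 𝓝 t, |r| < |s| + 1 + (⌈|t|⌉₊ : ℝ) :=
    (continuous_abs.tendsto t).eventually (gt_mem_nhds (hlt t))
  filter_upwards [this] with r hr
  exact key _ _ r (hlt r) hr

end IsFlowField

/-- The position at time `t` of the integral curve of `W` that passes through `z` at time `s`. -/
def flow (W : ℝ → V → V) (s t : ℝ) (z : V) : V :=
  open Classical in
  if h : ∃ γ : ℝ → V, γ s = z ∧ ∀ t, HasDerivAt γ (W t (γ t)) t then h.choose t else z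

namespace IsFlowField

variable {W : ℝ → V → V} [CompleteSpace V]

theorem flow_self (hW : IsFlowField W) (s : ℝ) (z : V) : flow W s s z = z := by
  have h := hW.exists_solution s z
  simp only [flow, dif_pos h]
  exact h.choose_spec.1

theorem hasDerivAt_flow (hW : IsFlowField W) (s : ℝ) (z : V) (t : ℝ) :
    HasDerivAt (fun t => flow W s t z) (W t (flow W s t z)) t := by
  have h := hW.exists_solution s z
  simp only [flow, dif_pos h]
  exact h.choose_spec.2 t

theorem eq_of_hasDerivAt (hW : IsFlowField W) {γ₁ γ₂ : ℝ → V} {s : ℝ}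
    (h₁ : ∀ t, HasDerivAt γ₁ (W t (γ₁ t)) t)
    (h₂ : ∀ t, HasDerivAt γ₂ (W t (γ₂ t)) t) (h : γ₁ s = γ₂ s) (t : ℝ) :
    γ₁ t = γ₂ t :=
  hW.eqOn_of_hasDerivAt (T := max |s| |t| + 1) (by linarith [le_max_left |s| |t|])
    (fun r _ => h₁ r) (fun r _ => h₂ r) h (by linarith [le_max_right |s| |t|])

theorem flow_flow (hW : IsFlowField W) (r s t : ℝ) (z : V) :
    flow W s t (flow W r s z) = flow W r t z :=
  hW.eq_of_hasDerivAt (s := s) (hW.hasDerivAt_flow s _) (hW.hasDerivAt_flow r z)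
    (hW.flow_self s _) t

theorem flow_flow_cancel (hW : IsFlowField W) (s t : ℝ) (z : V) :
    flow W t s (flow W s t z) = z := by rw [hW.flow_flow, hW.flow_self]

theorem continuous_flow_time (hW : IsFlowField W) (s : ℝ) (z : V) :
    Continuous fun t => flow W s t z :=
  continuous_iff_continuousAt.2 fun t => (hW.hasDerivAt_flow s z t).continuousAt

/-- The time reversal of a vector field. -/
theorem reverse (hW : IsFlowField W) : IsFlowField fun t z => -W (-t) z := by
  refine ⟨?_, fun T => ?_, fun T => ?_⟩
  · exact (hW.cont.comp ((continuous_fst.neg).prodMk continuous_snd)).neg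
  · obtain ⟨C, hC, h⟩ := hW.bdd T
    exact ⟨C, hC, fun t ht z => by rw [norm_neg]; exact h _ (by rwa [abs_neg]) z⟩
  · obtain ⟨K, h⟩ := hW.lip T
    exact ⟨K, fun t ht => (h _ (by rwa [abs_neg])).neg⟩

theorem dist_flow_le_of_le (hW : IsFlowField W) {T : ℝ} {K : ℝ≥0}
    (hK : ∀ t, |t| ≤ T → LipschitzWith K (W t)) {s t : ℝ} (hst : s ≤ t) (hs : |s| ≤ T)
    (ht : |t| ≤ T) (z z' : V) :
    dist (flow W s t z) (flow W s t z') ≤ dist z z' * Real.exp (K * (t - s)) := by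
  have := dist_le_of_trajectories_ODE_of_mem (v := W) (s := fun _ => univ) (K := K) (a := s)
    (b := t) (f := fun t => flow W s t z) (g := fun t => flow W s t z') (δ := dist z z')
    (fun r hr => (hK r (abs_le.2
      ⟨(abs_le.1 hs).1.trans hr.1, hr.2.le.trans (abs_le.1 ht).2⟩)).lipschitzOnWith)
    (hW.continuous_flow_time s z).continuousOn
    (fun r _ => (hW.hasDerivAt_flow s z r).hasDerivWithinAt) (fun _ _ => trivial)
    (hW.continuous_flow_time s z').continuousOn
    (fun r _ => (hW.hasDerivAt_flow s z' r).hasDerivWithinAt) (fun _ _ => trivial)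
    (by simp only [hW.flow_self]; exact le_rfl)
  exact this t (right_mem_Icc.2 hst)

/-- Turns the forward Grönwall estimate into one for the backward flow. -/
theorem flow_reverse (hW : IsFlowField W) (s t : ℝ) (z : V) :
    flow (fun t z => -W (-t) z) (-s) (-t) z = flow W s t z := by
  have := hW.reverse.eq_of_hasDerivAt (s := -s) (hW.reverse.hasDerivAt_flow (-s) z)
    (γ₂ := fun t => flow W s (-t) z) (fun r => ?_) (by
      simp only [hW.reverse.flow_self, neg_neg, hW.flow_self]) (-t)
  · simpa using this
  · have h := (hW.hasDerivAt_flow s z (-r)).scomp r (hasDerivAt_neg r)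
    simpa [Function.comp_def] using h

theorem dist_flow_le (hW : IsFlowField W) {T : ℝ} {K : ℝ≥0}
    (hK : ∀ t, |t| ≤ T → LipschitzWith K (W t)) {s t : ℝ} (hs : |s| ≤ T)
    (ht : |t| ≤ T) (z z' : V) :
    dist (flow W s t z) (flow W s t z') ≤ dist z z' * Real.exp (K * |t - s|) := by
  rcases le_total s t with h | h
  · rw [abs_of_nonneg (sub_nonneg.2 h)]
    exact hW.dist_flow_le_of_le hK h hs ht z z'
  · rw [← hW.flow_reverse s t z, ← hW.flow_reverse s t z', abs_of_nonpos (sub_nonpos.2 h)]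
    have := hW.reverse.dist_flow_le_of_le (T := T) (K := K)
      (fun r hr => (hK _ (by rwa [abs_neg])).neg) (neg_le_neg h) (by rwa [abs_neg])
      (by rwa [abs_neg]) z z'
    refine this.trans (le_of_eq ?_)
    congr 3; ring

theorem exists_lipschitzWith_flow (hW : IsFlowField W) (T : ℝ) :
    ∃ K : ℝ≥0, ∀ s t, |s| ≤ T → |t| ≤ T → LipschitzWith K (flow W s t) := by
  obtain ⟨K, hK⟩ := hW.lip T
  refine ⟨(Real.exp (K * (2 * T))).toNNReal, fun s t hs ht => LipschitzWith.of_dist_le_mul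
    fun z z' => ?_⟩
  rw [Real.coe_toNNReal _ (Real.exp_pos _).le, mul_comm]
  refine (hW.dist_flow_le hK hs ht z z').trans ?_
  have : |t - s| ≤ 2 * T := (abs_sub t s).trans (by linarith)
  gcongr

theorem continuous_flow (hW : IsFlowField W) (s t : ℝ) : Continuous (flow W s t) := by
  obtain ⟨K, hK⟩ := hW.exists_lipschitzWith_flow (max |s| |t|)
  exact (hK s t (le_max_left _ _) (le_max_right _ _)).continuous

theorem norm_flow_sub_le (hW : IsFlowField W) {T C : ℝ} (hC : ∀ t, |t| ≤ T → ∀ z, ‖W t z‖ ≤ C)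
    {s t : ℝ} (hs : |s| ≤ T) (ht : |t| ≤ T) (z : V) : ‖flow W s t z - z‖ ≤ C * |t - s| := by
  have := (convex_Icc (-T) T).norm_image_sub_le_of_norm_hasDerivWithin_le
    (f := fun t => flow W s t z) (f' := fun t => W t (flow W s t z)) (C := C)
    (fun r _ => (hW.hasDerivAt_flow s z r).hasDerivWithinAt)
    (fun r hr => hC r (abs_le.2 hr) _) (abs_le.1 hs) (abs_le.1 ht)
  simpa only [hW.flow_self, Real.norm_eq_abs] using this

end IsFlowField

end Flow

end VlasovPoisson
end

noncomputable section

namespace VlasovPoisson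

open scoped NNReal ENNReal

/-! ### Measure preservation -/

section FlowMeasure

variable {V : Type*} [NormedAddCommGroup V] [NormedSpace ℝ V] [FiniteDimensional ℝ V]
  [MeasurableSpace V] [BorelSpace V] {μ : Measure V} [μ.IsAddHaarMeasure]
  {W : ℝ → V → V}

namespace IsFlowField

/-- Liouville's theorem without Jacobians; the field is only Lipschitz in space. The Euler step `z +
h W` preserves the measure by assumption, so it can be inserted in the integral at time `r + h` for
free. The difference quotient then compares the Euler step with the true flow, and these differ by
`o(h)`. -/
theorem hasDerivAt_integral_comp_flow (hW : IsFlowField W)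
    (hμ : ∀ t h : ℝ, MeasurePreserving (fun z => z + h • W t z) μ μ)
    {φ : V → ℝ} {K' : ℝ≥0} (hφ : LipschitzWith K' φ) (hs : HasCompactSupport φ) (r t : ℝ) :
    HasDerivAt (fun r => ∫ z, φ (flow W r t z) ∂μ) 0 r := by
  have : CompleteSpace V := FiniteDimensional.complete ℝ V
  have : ProperSpace V := FiniteDimensional.proper ℝ V
  set T := max |r| |t| + 1 with hT
  obtain ⟨K, hK⟩ := hW.exists_lipschitzWith_flow T
  obtain ⟨C, hC0, hC⟩ := hW.bdd T
  obtain ⟨ρ, hρ⟩ := hs.isCompact.isBounded.subset_closedBall (0 : V)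
  have hrT : |r| ≤ T := by linarith [le_max_left |r| |t|]
  have htT : |t| ≤ T := by linarith [le_max_right |r| |t|]
  have hrh : ∀ h : ℝ, |h| ≤ 1 → |r + h| ≤ T := fun h hh => by
    linarith [abs_add_le r h, le_max_left |r| |t|]
  -- The flow moves points by at most `2 T C`, so all the transported test functions vanish outside
  -- one common ball.
  have hψ0 : ∀ h : ℝ, |h| ≤ 1 → ∀ w : V, ρ + C * (2 * T) < ‖w‖ → φ (flow W (r + h) t w) = 0 := by
    intro h hh w hw
    by_contra hne
    have h1 : ‖flow W (r + h) t w‖ ≤ ρ := by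
      simpa using hρ (subset_tsupport φ (by simpa using hne))
    have h2 := hW.norm_flow_sub_le hC (hrh h hh) htT w
    have h3 : |t - (r + h)| ≤ 2 * T := (abs_sub _ _).trans (by linarith [hrh h hh])
    have h4 : ‖w‖ ≤ ‖flow W (r + h) t w‖ + ‖flow W (r + h) t w - w‖ := by
      have := norm_sub_le (flow W (r + h) t w) (flow W (r + h) t w - w)
      simpa using this
    nlinarith [mul_le_mul_of_nonneg_left h3 hC0]
  have hψL : ∀ h : ℝ, |h| ≤ 1 → ∀ w w' : V,
      |φ (flow W (r + h) t w) - φ (flow W (r + h) t w')| ≤ K' * K * ‖w - w'‖ := by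
    intro h hh w w'
    have := (hφ.comp (hK (r + h) t (hrh h hh) htT)).dist_le_mul w w'
    simpa [Real.dist_eq, dist_eq_norm] using this
  have hcs : ∀ h : ℝ, |h| ≤ 1 → Integrable (fun w => φ (flow W (r + h) t w)) μ := by
    intro h hh
    refine (hφ.continuous.comp (hW.continuous_flow _ _)).integrable_of_hasCompactSupport ?_
    refine HasCompactSupport.intro (isCompact_closedBall (0 : V) (ρ + C * (2 * T))) ?_
    intro w hw
    exact hψ0 h hh w (by simpa using hw)
  have hflowC : ∀ h : ℝ, |h| ≤ 1 → ∀ z, ‖flow W r (r + h) z - z‖ ≤ C * |h| := by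
    intro h hh z
    simpa using hW.norm_flow_sub_le hC hrT (hrh h hh) z
  -- the difference quotient, after the change of variables by the Euler step
  have hdiff : ∀ h : ℝ, |h| ≤ 1 →
      (∫ z, φ (flow W (r + h) t z) ∂μ) - ∫ z, φ (flow W r t z) ∂μ
        = ∫ z, (φ (flow W (r + h) t (z + h • W r z))
            - φ (flow W (r + h) t (flow W r (r + h) z))) ∂μ := by
    intro h hh
    have hmp := hμ r h
    have e1 : ∫ z, φ (flow W (r + h) t z) ∂μ = ∫ z, φ (flow W (r + h) t (z + h • W r z)) ∂μ := by
      rw [← hmp.map_eq, integral_map hmp.aemeasurable, hmp.map_eq]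
      exact (hφ.continuous.comp (hW.continuous_flow _ _)).aestronglyMeasurable
    rw [e1, ← integral_sub]
    · simp only [hW.flow_flow]
    · exact (hmp.integrable_comp
        (hφ.continuous.comp (hW.continuous_flow _ _)).aestronglyMeasurable).2 (hcs h hh)
    · simpa using hcs 0 (by simp)
  rw [hasDerivAt_iff_tendsto_slope_zero]
  have hnear : ∀ᶠ h : ℝ in 𝓝[≠] 0, |h| ≤ 1 := by
    refine nhdsWithin_le_nhds ?_
    filter_upwards [Metric.closedBall_mem_nhds (0 : ℝ) one_pos] with h hh
    simpa using hh
  set q : ℝ → V → ℝ := fun h z => h⁻¹ * (φ (flow W (r + h) t (z + h • W r z))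
            - φ (flow W (r + h) t (flow W r (r + h) z))) with hq
  have hqle : ∀ h : ℝ, |h| ≤ 1 → ∀ z,
      |q h z| ≤ K' * K * ‖h⁻¹ • (flow W r (r + h) z - z - h • W r z)‖ := by
    intro h hh z
    simp only [hq]
    rw [abs_mul, norm_smul, Real.norm_eq_abs]
    have h1 := hψL h hh (z + h • W r z) (flow W r (r + h) z)
    have h2 : ‖z + h • W r z - flow W r (r + h) z‖ = ‖flow W r (r + h) z - z - h • W r z‖ := by
      rw [← norm_neg]; congr 1; abel
    rw [h2] at h1
    calc _ ≤ |h⁻¹| * _ := mul_le_mul_of_nonneg_left h1 (abs_nonneg _)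
      _ = _ := by ring
  -- Dominated convergence: pointwise the quotient tends to zero since `W` is the derivative of the
  -- flow, and it is bounded by a constant on a fixed ball and vanishes off it.
  have hlim : Tendsto (fun h : ℝ => ∫ z, q h z ∂μ) (𝓝[≠] 0) (𝓝 (∫ _, (0 : ℝ) ∂μ)) := by
    refine tendsto_integral_filter_of_dominated_convergence
      ((Metric.closedBall (0 : V) (ρ + C * (2 * T) + C)).indicator fun _ => K' * K * (2 * C))
      (Eventually.of_forall fun h => ?_) ?_ ?_ (Eventually.of_forall fun z => ?_)
    · have c1 : Continuous fun z : V => z + h • W r z :=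
        continuous_id.add ((hW.cont.comp (continuous_const.prodMk continuous_id)).const_smul h)
      have c2 := hφ.continuous.comp (hW.continuous_flow (r + h) t)
      exact (((c2.comp c1).sub (c2.comp (hW.continuous_flow r (r + h)))).const_mul
        h⁻¹).aestronglyMeasurable
    · filter_upwards [hnear, self_mem_nhdsWithin] with h hh hne
      refine Eventually.of_forall fun z => ?_
      have hWz : ‖h • W r z‖ ≤ C * |h| := by
        rw [norm_smul, Real.norm_eq_abs, mul_comm]
        exact mul_le_mul_of_nonneg_right (hC r hrT z) (abs_nonneg _)
      by_cases hz : z ∈ Metric.closedBall (0 : V) (ρ + C * (2 * T) + C)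
      · rw [indicator_of_mem hz]
        refine (hqle h hh z).trans (mul_le_mul_of_nonneg_left ?_ (by positivity))
        rw [norm_smul, norm_inv, Real.norm_eq_abs]
        have hpos : 0 < |h| := abs_pos.2 hne
        rw [inv_mul_le_iff₀ hpos]
        have := norm_sub_le (flow W r (r + h) z - z) (h • W r z)
        linarith [hflowC h hh z]
      · rw [indicator_of_notMem hz]
        have hz' : ρ + C * (2 * T) + C < ‖z‖ := by simpa using hz
        have hCh : C * |h| ≤ C := by nlinarith
        have a1 : ρ + C * (2 * T) < ‖z + h • W r z‖ := by
          have := norm_sub_le (z + h • W r z) (h • W r z)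
          simp only [add_sub_cancel_right] at this
          linarith
        have a2 : ρ + C * (2 * T) < ‖flow W r (r + h) z‖ := by
          have := norm_sub_le (flow W r (r + h) z) (flow W r (r + h) z - z)
          simp only [sub_sub_cancel] at this
          linarith [hflowC h hh z]
        simp [hq, hψ0 h hh _ a1, hψ0 h hh _ a2]
    · refine (integrable_indicator_iff measurableSet_closedBall).2 ?_
      exact integrableOn_const (isCompact_closedBall _ _).measure_lt_top.ne
    · have hd := (hasDerivAt_iff_tendsto_slope_zero.1 (hW.hasDerivAt_flow r z r))
      rw [hW.flow_self] at hd
      have hd' : Tendsto (fun h : ℝ => K' * K * ‖h⁻¹ • (flow W r (r + h) z - z - h • W r z)‖)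
          (𝓝[≠] 0) (𝓝 0) := by
        have h0 := ((hd.sub_const (W r z)).norm).const_mul ((K' : ℝ) * K)
        simp only [sub_self, norm_zero, mul_zero] at h0
        refine h0.congr' ?_
        filter_upwards [self_mem_nhdsWithin] with h hne
        rw [smul_sub h⁻¹ _ (h • W r z), inv_smul_smul₀ hne]
      refine squeeze_zero_norm' ?_ hd'
      filter_upwards [hnear] with h hh
      exact hqle h hh z
  rw [integral_zero] at hlim
  refine hlim.congr' ?_
  filter_upwards [hnear] with h hh
  rw [hdiff h hh, smul_eq_mul, ← integral_const_mul]

theorem integral_comp_flow (hW : IsFlowField W)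
    (hμ : ∀ t h : ℝ, MeasurePreserving (fun z => z + h • W t z) μ μ)
    {φ : V → ℝ} {K' : ℝ≥0} (hφ : LipschitzWith K' φ) (hs : HasCompactSupport φ) (s t : ℝ) :
    ∫ z, φ (flow W s t z) ∂μ = ∫ z, φ z ∂μ := by
  have : CompleteSpace V := FiniteDimensional.complete ℝ V
  have h := fun r => hW.hasDerivAt_integral_comp_flow hμ hφ hs r t
  have := is_const_of_deriv_eq_zero (fun r => (h r).differentiableAt) (fun r => (h r).deriv) s t
  simpa only [hW.flow_self] using this

/-- Invariance of integrals of Lipschitz test functions passes to compact sets by squeezing the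
indicator between thickened indicators and letting the thickness shrink. -/
theorem measure_preimage_flow_le (hW : IsFlowField W)
    (hμ : ∀ t h : ℝ, MeasurePreserving (fun z => z + h • W t z) μ μ) (s t : ℝ) {A : Set V}
    (hA : IsCompact A) : μ (flow W s t ⁻¹' A) ≤ μ A := by
  have : CompleteSpace V := FiniteDimensional.complete ℝ V
  have : ProperSpace V := FiniteDimensional.proper ℝ V
  have key : ∀ δ : ℝ, 0 < δ → μ (flow W s t ⁻¹' A) ≤ μ (Metric.cthickening δ A) := by
    intro δ hδ
    set φ : V → ℝ := fun z => (thickenedIndicator hδ A z : ℝ) with hφ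
    have hL : LipschitzWith δ.toNNReal⁻¹ φ := lipschitzWith_thickenedIndicator hδ A
    have hAc : IsCompact (Metric.cthickening δ A) := hA.cthickening
    have hs0 : ∀ x, x ∉ Metric.cthickening δ A → φ x = 0 := fun x hx => by
      have : x ∉ Metric.thickening δ A := fun h => hx (Metric.thickening_subset_cthickening _ _ h)
      simp only [hφ]; rw [thickenedIndicator_zero hδ A this]; rfl
    have hs : HasCompactSupport φ := HasCompactSupport.intro hAc hs0
    have hnn : ∀ x, 0 ≤ φ x := fun x => NNReal.coe_nonneg _
    have h1 : ∀ x ∈ A, φ x = 1 := fun x hx => by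
      simp only [hφ]; rw [thickenedIndicator_one hδ A hx]; rfl
    have hle : ∀ x, φ x ≤ 1 := fun x => by
      simpa [hφ] using thickenedIndicator_le_one hδ A x
    have hcont : Continuous φ := hL.continuous
    have hint := hcont.integrable_of_hasCompactSupport hs (μ := μ)
    have e := hW.integral_comp_flow hμ hL hs s t
    have hpre : IsCompact (flow W t s '' Metric.cthickening δ A) :=
      hAc.image (hW.continuous_flow _ _)
    have hint' : Integrable (fun z => φ (flow W s t z)) μ := by
      refine (hcont.comp (hW.continuous_flow s t)).integrable_of_hasCompactSupport ?_
      refine HasCompactSupport.intro hpre fun z hz => hs0 _ fun h => hz ?_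
      exact ⟨_, h, hW.flow_flow_cancel s t z⟩
    have e' : ∫⁻ z, ENNReal.ofReal (φ (flow W s t z)) ∂μ = ∫⁻ z, ENNReal.ofReal (φ z) ∂μ := by
      rw [← ofReal_integral_eq_lintegral_ofReal hint' (Eventually.of_forall fun _ => hnn _),
        ← ofReal_integral_eq_lintegral_ofReal hint (Eventually.of_forall fun _ => hnn _), e]
    have hAm : MeasurableSet (flow W s t ⁻¹' A) :=
      hA.measurableSet.preimage (hW.continuous_flow s t).measurable
    calc μ (flow W s t ⁻¹' A) = ∫⁻ z, (flow W s t ⁻¹' A).indicator 1 z ∂μ := by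
          rw [lintegral_indicator_one hAm]
      _ ≤ ∫⁻ z, ENNReal.ofReal (φ (flow W s t z)) ∂μ := by
          refine lintegral_mono fun z => ?_
          by_cases hz : z ∈ flow W s t ⁻¹' A
          · simp [indicator_of_mem hz, h1 _ hz]
          · simp [indicator_of_notMem hz]
      _ = ∫⁻ z, ENNReal.ofReal (φ z) ∂μ := e'
      _ ≤ ∫⁻ z, (Metric.cthickening δ A).indicator 1 z ∂μ := by
          refine lintegral_mono fun z => ?_
          by_cases hz : z ∈ Metric.cthickening δ A
          · simpa [indicator_of_mem hz] using hle z
          · simp [indicator_of_notMem hz, hs0 z hz]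
      _ = μ (Metric.cthickening δ A) := lintegral_indicator_one hAc.measurableSet
  have hlim := tendsto_measure_cthickening_of_isCompact (μ := μ) hA
  refine ge_of_tendsto (hlim.mono_left (nhdsWithin_le_nhds (s := Ioi 0))) ?_
  filter_upwards [self_mem_nhdsWithin] with δ hδ using key δ hδ

/-- Inner regularity extends the inequality from compact to measurable sets. Applying it also to the
inverse flow, which is again a flow map, gives equality. -/
theorem measurePreserving_flow (hW : IsFlowField W)
    (hμ : ∀ t h : ℝ, MeasurePreserving (fun z => z + h • W t z) μ μ) (s t : ℝ) :
    MeasurePreserving (flow W s t) μ μ := by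
  have : CompleteSpace V := FiniteDimensional.complete ℝ V
  have : ProperSpace V := FiniteDimensional.proper ℝ V
  have key : ∀ (s t : ℝ) (A : Set V), MeasurableSet A → μ (flow W s t ⁻¹' A) ≤ μ A := by
    intro s t A hA
    rw [(hA.preimage (hW.continuous_flow s t).measurable).measure_eq_iSup_isCompact]
    refine iSup₂_le fun B hB => iSup_le fun hBc => ?_
    have hc := hBc.image (hW.continuous_flow s t)
    calc μ B ≤ μ (flow W s t ⁻¹' (flow W s t '' B)) := measure_mono (subset_preimage_image _ _)
      _ ≤ μ (flow W s t '' B) := hW.measure_preimage_flow_le hμ s t hc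
      _ ≤ μ A := measure_mono (image_subset_iff.2 hB)
  refine ⟨(hW.continuous_flow s t).measurable, ?_⟩
  ext A hA
  rw [Measure.map_apply (hW.continuous_flow s t).measurable hA]
  refine le_antisymm (key s t A hA) ?_
  have := key t s _ (hA.preimage (hW.continuous_flow s t).measurable)
  refine le_trans (le_of_eq ?_) this
  congr 1
  ext z
  simp [hW.flow_flow_cancel]

end IsFlowField

end FlowMeasure

end VlasovPoisson
end

noncomputable section

namespace VlasovPoisson

open scoped NNReal ENNReal

/-! ### Phase space in the coordinates `(x - (t + α) v, v)` -/

variable {d : ℕ}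

/-- The phase-space vector field of the electric field `E`, in the coordinates
`(x - (t + α) v, v)`. -/
def phaseField (α : ℝ) (E : ℝ → Sp d → Sp d) (t : ℝ) (z : Sp d × Sp d) : Sp d × Sp d :=
  (-((t + α) • E t (z.1 + (t + α) • z.2)), E t (z.1 + (t + α) • z.2))

theorem lipschitzWith_add_smul (τ : ℝ) :
    LipschitzWith (1 + ‖τ‖₊) fun z : Sp d × Sp d => z.1 + τ • z.2 := by
  have h := (LipschitzWith.prod_fst (α := Sp d) (β := Sp d)).add
    ((lipschitzWith_smul τ).comp (LipschitzWith.prod_snd (α := Sp d) (β := Sp d)))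
  simpa using h

theorem IsFlowField.phaseField {E : ℝ → Sp d → Sp d} (hE : IsFlowField E) (α : ℝ) :
    IsFlowField (phaseField α E) := by
  have hτ : ∀ {T t : ℝ}, |t| ≤ T → |t + α| ≤ T + |α| := fun ht =>
    (abs_add_le _ _).trans (by linarith)
  refine ⟨?_, fun T => ?_, fun T => ?_⟩
  · have h1 : Continuous fun p : ℝ × (Sp d × Sp d) => E p.1 (p.2.1 + (p.1 + α) • p.2.2) :=
      hE.cont.comp (continuous_fst.prodMk (by fun_prop))
    exact (((by fun_prop : Continuous fun p : ℝ × (Sp d × Sp d) => p.1 + α).smul h1).neg).prodMk h1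
  · obtain ⟨C, hC, h⟩ := hE.bdd T
    refine ⟨(1 + abs (T + |α|)) * C, by positivity, fun t ht z => ?_⟩
    have h1 := h t ht (z.1 + (t + α) • z.2)
    have h2 : |t + α| ≤ abs (T + |α|) := (hτ ht).trans (le_abs_self _)
    refine max_le ?_ ?_
    · show ‖-((t + α) • E t (z.1 + (t + α) • z.2))‖ ≤ _
      rw [norm_neg, norm_smul, Real.norm_eq_abs]
      nlinarith [abs_nonneg (t + α), norm_nonneg (E t (z.1 + (t + α) • z.2)),
        mul_le_mul h2 h1 (norm_nonneg _) (abs_nonneg _)]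
    · show ‖E t (z.1 + (t + α) • z.2)‖ ≤ _
      nlinarith [abs_nonneg (T + |α|), norm_nonneg (E t (z.1 + (t + α) • z.2))]
  · obtain ⟨K, h⟩ := hE.lip T
    set M : ℝ≥0 := (T + |α|).toNNReal with hM
    have hle : ∀ t, |t| ≤ T → ‖t + α‖₊ ≤ M := fun t ht => by
      have h2 := hτ ht
      rw [← NNReal.coe_le_coe, coe_nnnorm, Real.norm_eq_abs,
        Real.coe_toNNReal _ ((abs_nonneg _).trans h2)]
      exact h2
    refine ⟨max (M * (K * (1 + M))) (K * (1 + M)), fun t ht => ?_⟩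
    have h1 : LipschitzWith (K * (1 + M)) fun z : Sp d × Sp d => E t (z.1 + (t + α) • z.2) :=
      ((h t ht).comp (lipschitzWith_add_smul (t + α))).weaken (by gcongr; exact hle t ht)
    have h2 : LipschitzWith (M * (K * (1 + M)))
        fun z : Sp d × Sp d => -((t + α) • E t (z.1 + (t + α) • z.2)) :=
      (((lipschitzWith_smul (t + α)).comp h1).weaken (by gcongr; exact hle t ht)).neg
    exact h2.prodMk h1

theorem measurePreserving_shear_fst (τ : ℝ) :
    MeasurePreserving (fun z : Sp d × Sp d => (z.1 + τ • z.2, z.2)) volume volume := by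
  have h := ((MeasurePreserving.id (volume : Measure (Sp d))).skew_product (μc := volume)
    (μd := (volume : Measure (Sp d))) (g := fun v x => x + τ • v)
    (by unfold Function.uncurry; fun_prop)
    (Eventually.of_forall fun v => map_add_right_eq_self volume (τ • v)))
  have hs : MeasurePreserving (Prod.swap : Sp d × Sp d → Sp d × Sp d)
    (volume.prod volume) (volume.prod volume) := Measure.measurePreserving_swap
  exact hs.comp (h.comp hs)

theorem measurePreserving_shear_snd {G : Sp d → Sp d} (hG : Measurable G) :
    MeasurePreserving (fun z : Sp d × Sp d => (z.1, z.2 + G z.1)) volume volume :=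
  (MeasurePreserving.id (volume : Measure (Sp d))).skew_product (μc := volume)
    (μd := (volume : Measure (Sp d))) (g := fun x v => v + G x)
    (by unfold Function.uncurry; fun_prop)
    (Eventually.of_forall fun x => map_add_right_eq_self volume (G x))

/-- An Euler step of the phase-space field is the velocity kick `v ↦ v + h E(x)` conjugated by the
shear between `x - τ v` and `x`. All three factors are shears, so no smallness of `h` is needed. -/
theorem IsFlowField.measurePreserving_euler {E : ℝ → Sp d → Sp d} (hE : IsFlowField E) (α t h : ℝ) :
    MeasurePreserving (fun z => z + h • VlasovPoisson.phaseField α E t z) volume volume := by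
  have hc : Continuous (E t) := hE.cont.comp (continuous_const.prodMk continuous_id)
  have h1 := (measurePreserving_shear_fst (-(t + α))).comp
    ((measurePreserving_shear_snd (hc.const_smul h).measurable).comp
      (measurePreserving_shear_fst (d := d) (t + α)))
  convert h1 using 1
  ext z : 1
  refine Prod.ext ?_ rfl
  simp only [VlasovPoisson.phaseField, Function.comp, Prod.fst_add, Prod.smul_fst, smul_add,
    neg_smul, smul_neg]
  rw [smul_comm h (t + α)]
  abel

theorem IsFlowField.measurePreserving_phaseFlow {E : ℝ → Sp d → Sp d} (hE : IsFlowField E)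
    (α s t : ℝ) :
    MeasurePreserving (flow (VlasovPoisson.phaseField α E) s t) volume volume :=
  (hE.phaseField α).measurePreserving_flow
    (μ := ((volume : Measure (Sp d)).prod (volume : Measure (Sp d))))
    (hE.measurePreserving_euler α) s t

/-! ### The solution along the flow -/

/-- The electric field of `f`, frozen at its initial value for negative times. -/
def efield (f : ℝ → Sp d → Sp d → ℝ) (t : ℝ) (x : Sp d) : Sp d := field (f (max t 0)) x

theorem efield_of_nonneg (f : ℝ → Sp d → Sp d → ℝ) {t : ℝ} (ht : 0 ≤ t) (x : Sp d) :
    efield f t x = field (f t) x := by rw [efield, max_eq_left ht]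

/-- The solution in the coordinates `(x - (t + α) v, v)`. -/
def sheared (α : ℝ) (f : ℝ → Sp d → Sp d → ℝ) (t : ℝ) (z : Sp d × Sp d) : ℝ :=
  f t (z.1 + (t + α) • z.2) z.2

namespace IsClassicalSolution

variable {f₀ : Sp d → Sp d → ℝ} {f : ℝ → Sp d → Sp d → ℝ}

theorem isFlowField_efield (hf : IsClassicalSolution f₀ f) : IsFlowField (efield f) := by
  have hmax : ∀ {t T : ℝ}, |t| ≤ T → max t 0 ≤ T := fun {t T} ht =>
    max_le ((le_abs_self t).trans ht) ((abs_nonneg t).trans ht)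
  refine ⟨?_, fun T => ?_, fun T => ?_⟩
  · have h : Continuous fun p : ℝ × Sp d => ((max p.1 0, p.2) : ℝ × Sp d) := by fun_prop
    exact hf.field_continuousOn.comp_continuous h
      (fun p => ⟨show (0 : ℝ) ≤ max p.1 0 from le_max_right _ _, trivial⟩)
  · obtain ⟨C, hC⟩ := hf.field_locally_bounded T
    refine ⟨|C|, abs_nonneg _, fun t ht z => ?_⟩
    exact ((hC _ (le_max_right _ _) (hmax ht) z).1).trans (le_abs_self C)
  · obtain ⟨C, hC⟩ := hf.field_locally_bounded T
    refine ⟨C.toNNReal, fun t ht => ?_⟩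
    refine lipschitzWith_of_nnnorm_fderiv_le (𝕜 := ℝ)
      (hf.field_differentiable _ (le_max_right _ _)) fun x => ?_
    rw [← NNReal.coe_le_coe, coe_nnnorm]
    exact ((hC _ (le_max_right _ _) (hmax ht) x).2).trans (Real.le_coe_toNNReal C)

theorem hasFDerivAt (hf : IsClassicalSolution f₀ f) {t : ℝ} (ht : 0 < t) (x v : Sp d) :
    HasFDerivAt (fun z : ℝ × Sp d × Sp d => f z.1 z.2.1 z.2.2)
      (fderiv ℝ (fun z : ℝ × Sp d × Sp d => f z.1 z.2.1 z.2.2) (t, x, v)) (t, x, v) := by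
  have h : ContDiffAt ℝ 1 (fun z : ℝ × Sp d × Sp d => f z.1 z.2.1 z.2.2) (t, x, v) :=
    hf.contDiffOn.contDiffAt (prod_mem_nhds (Ici_mem_nhds ht) univ_mem)
  exact (h.differentiableAt one_ne_zero).hasFDerivAt

/-- Reads the Vlasov equation as the vanishing of the joint derivative of `f` in the direction `(1,
v, E)`, the form suited to the chain rule along curves. For `t > 0` the one-sided time derivative is
two-sided. -/
theorem vlasov_fderiv (hf : IsClassicalSolution f₀ f) {t : ℝ} (ht : 0 < t) (x v : Sp d) :
    fderiv ℝ (fun z : ℝ × Sp d × Sp d => f z.1 z.2.1 z.2.2) (t, x, v)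
      (1, v, efield f t x) = 0 := by
  set F := fun z : ℝ × Sp d × Sp d => f z.1 z.2.1 z.2.2
  have hF := hf.hasFDerivAt ht x v
  have h1 : derivWithin (fun s => f s x v) (Ici 0) t = fderiv ℝ F (t, x, v) (1, 0, 0) := by
    have : HasDerivAt (fun s => f s x v) (fderiv ℝ F (t, x, v) (1, 0, 0)) t :=
      hF.comp_hasDerivAt (f := fun s => (s, x, v)) t
        ((hasDerivAt_id t).prodMk (hasDerivAt_const t (x, v)))
    exact this.hasDerivWithinAt.derivWithin (uniqueDiffOn_Ici 0 t ht.le)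
  have h2 : ∀ w, fderiv ℝ (fun y => f t y v) x w = fderiv ℝ F (t, x, v) (0, w, 0) := by
    intro w
    have : HasFDerivAt (fun y => f t y v) ((fderiv ℝ F (t, x, v)).comp
        (((0 : Sp d →L[ℝ] ℝ)).prod ((ContinuousLinearMap.id ℝ (Sp d)).prod 0))) x :=
      hF.comp (f := fun y => (t, y, v)) x
        ((hasFDerivAt_const t x).prodMk ((hasFDerivAt_id x).prodMk (hasFDerivAt_const v x)))
    rw [this.fderiv]; rfl
  have h3 : ∀ w, fderiv ℝ (fun y => f t x y) v w = fderiv ℝ F (t, x, v) (0, 0, w) := by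
    intro w
    have : HasFDerivAt (fun y => f t x y) ((fderiv ℝ F (t, x, v)).comp
        (((0 : Sp d →L[ℝ] ℝ)).prod ((0 : Sp d →L[ℝ] Sp d).prod
          (ContinuousLinearMap.id ℝ (Sp d))))) v :=
      hF.comp (f := fun y => (t, x, y)) v
        ((hasFDerivAt_const t v).prodMk ((hasFDerivAt_const x v).prodMk (hasFDerivAt_id v)))
    rw [this.fderiv]; rfl
  have h := hf.vlasov t ht.le x v
  rw [h1, h2, h3, ← map_add, ← map_add, ← efield_of_nonneg f ht.le] at h
  simpa using h

theorem continuousOn_sheared (hf : IsClassicalSolution f₀ f) (α : ℝ) :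
    ContinuousOn (fun p : ℝ × (Sp d × Sp d) => sheared α f p.1 p.2) (Ici (0 : ℝ) ×ˢ univ) := by
  have h : Continuous fun p : ℝ × (Sp d × Sp d) =>
      ((p.1, p.2.1 + (p.1 + α) • p.2.2, p.2.2) : ℝ × Sp d × Sp d) := by fun_prop
  exact hf.contDiffOn.continuousOn.comp h.continuousOn (fun p hp => ⟨hp.1, trivial⟩)

theorem contDiff_slice (hf : IsClassicalSolution f₀ f) {t : ℝ} (ht : 0 ≤ t) :
    ContDiff ℝ 1 fun z : Sp d × Sp d => f t z.1 z.2 := by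
  have h : ContDiff ℝ 1 fun z : Sp d × Sp d => ((t, z.1, z.2) : ℝ × Sp d × Sp d) := by fun_prop
  exact hf.contDiffOn.comp_contDiff h (fun z => ⟨ht, trivial⟩)

theorem contDiff_sheared (hf : IsClassicalSolution f₀ f) (α : ℝ) {t : ℝ} (ht : 0 ≤ t) :
    ContDiff ℝ 1 (sheared α f t) := by
  have h : ContDiff ℝ 1 fun z : Sp d × Sp d => (z.1 + (t + α) • z.2, z.2) := by fun_prop
  exact (hf.contDiff_slice ht).comp h

/-- The Vlasov equation in the sheared coordinates. -/
theorem hasDerivAt_sheared (hf : IsClassicalSolution f₀ f) (α : ℝ) {t : ℝ} (ht : 0 < t)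
    (z : Sp d × Sp d) :
    HasDerivAt (fun s => sheared α f s z)
      (-(fderiv ℝ (sheared α f t) z (phaseField α (efield f) t z))) t := by
  set F := fun z : ℝ × Sp d × Sp d => f z.1 z.2.1 z.2.2
  set x := z.1 + (t + α) • z.2 with hx
  have hF := hf.hasFDerivAt ht x z.2
  have h1 : HasDerivAt (fun s => sheared α f s z) (fderiv ℝ F (t, x, z.2) (1, z.2, 0)) t := by
    refine hF.comp_hasDerivAt (f := fun s => (s, z.1 + (s + α) • z.2, z.2)) t ?_
    refine (hasDerivAt_id t).prodMk (HasDerivAt.prodMk ?_ (hasDerivAt_const _ _))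
    simpa using (((hasDerivAt_id t).add_const α).smul_const z.2).const_add z.1
  have h2 : HasFDerivAt (sheared α f t) ((fderiv ℝ F (t, x, z.2)).comp
      ((0 : Sp d × Sp d →L[ℝ] ℝ).prod (((ContinuousLinearMap.fst ℝ (Sp d) (Sp d)) +
        (t + α) • (ContinuousLinearMap.snd ℝ (Sp d) (Sp d))).prod
          (ContinuousLinearMap.snd ℝ (Sp d) (Sp d))))) z := by
    refine hF.comp (f := fun z : Sp d × Sp d => (t, z.1 + (t + α) • z.2, z.2)) z ?_
    exact (hasFDerivAt_const t z).prodMk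
      ((hasFDerivAt_fst.add (hasFDerivAt_snd.const_smul (t + α))).prodMk hasFDerivAt_snd)
  convert h1 using 1
  rw [h2.fderiv]
  have hv := hf.vlasov_fderiv ht x z.2
  have e1 : ((1, z.2, efield f t x) : ℝ × Sp d × Sp d)
      = (1, z.2, 0) + (0, 0, efield f t x) := by simp
  rw [e1, map_add] at hv
  have e2 : (fderiv ℝ F (t, x, z.2)) ((1 : ℝ), z.2, (0 : Sp d))
      = -(fderiv ℝ F (t, x, z.2)) (0, 0, efield f t x) := by linarith
  rw [e2]
  congr 1
  simp [phaseField, ← hx]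

/-- The method of characteristics. The derivative along a characteristic vanishes for positive
times, and continuity up to `t = 0` includes the initial time. -/
theorem sheared_flow (hf : IsClassicalSolution f₀ f) (α : ℝ) {s t : ℝ} (hs : 0 ≤ s) (ht : 0 ≤ t)
    (z : Sp d × Sp d) :
    sheared α f t (flow (phaseField α (efield f)) s t z) = sheared α f s z := by
  have hW := hf.isFlowField_efield.phaseField α
  set W := phaseField α (efield f)
  set γ := fun r => flow W s r z with hγ
  have hcont : ContinuousOn (fun r => sheared α f r (γ r)) (Ici 0) :=
    (hf.continuousOn_sheared α).comp
      (continuous_id.prodMk (hW.continuous_flow_time s z)).continuousOn (fun r hr => ⟨hr, trivial⟩)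
  have hder : ∀ r ∈ interior (Ici (0 : ℝ)), HasDerivAt (fun r => sheared α f r (γ r)) 0 r := by
    intro r hr
    rw [interior_Ici, mem_Ioi] at hr
    set F := fun z : ℝ × Sp d × Sp d => f z.1 z.2.1 z.2.2
    have hγ' := hW.hasDerivAt_flow s z r
    have h1 : HasDerivAt (fun r => (γ r).1) (W r (γ r)).1 r :=
      (hasFDerivAt_fst (p := γ r)).comp_hasDerivAt r hγ'
    have h2 : HasDerivAt (fun r => (γ r).2) (W r (γ r)).2 r :=
      (hasFDerivAt_snd (p := γ r)).comp_hasDerivAt r hγ'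
    -- The contributions `-τ E` and `τ E` cancel, so the physical position moves with velocity `v`.
    have h3 : HasDerivAt (fun r => (γ r).1 + (r + α) • (γ r).2) (γ r).2 r := by
      have := h1.add (((hasDerivAt_id r).add_const α).smul h2)
      refine this.congr_deriv ?_
      simp [W, phaseField]
    have := (hf.hasFDerivAt hr ((γ r).1 + (r + α) • (γ r).2) (γ r).2).comp_hasDerivAt
      (f := fun r => (r, (γ r).1 + (r + α) • (γ r).2, (γ r).2)) r
      ((hasDerivAt_id r).prodMk (h3.prodMk h2))
    rw [← hf.vlasov_fderiv hr ((γ r).1 + (r + α) • (γ r).2) (γ r).2]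
    exact this
  have hanti : AntitoneOn (fun r => sheared α f r (γ r)) (Ici 0) :=
    antitoneOn_of_deriv_nonpos (convex_Ici 0) hcont
      (fun r hr => (hder r hr).differentiableAt.differentiableWithinAt)
      (fun r hr => (hder r hr).deriv.le)
  have hmono : MonotoneOn (fun r => sheared α f r (γ r)) (Ici 0) :=
    monotoneOn_of_deriv_nonneg (convex_Ici 0) hcont
      (fun r hr => (hder r hr).differentiableAt.differentiableWithinAt)
      (fun r hr => (hder r hr).deriv.ge)
  have e : γ s = z := hW.flow_self s z
  have key : sheared α f t (γ t) = sheared α f s (γ s) := by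
    rcases le_total s t with h | h
    · exact le_antisymm (hanti hs ht h) (hmono hs ht h)
    · exact le_antisymm (hmono ht hs h) (hanti ht hs h)
  rw [e] at key
  exact key

end IsClassicalSolution

end VlasovPoisson
end

noncomputable section

namespace VlasovPoisson

open scoped NNReal ENNReal

/-! ### The kernel and radial integrals -/

section Kernel

variable {d : ℕ}

/-- The area `d ω_d` of the unit sphere. -/
def sphereArea (d : ℕ) : ℝ := d * unitBallVolume d

theorem unitBallVolume_pos (d : ℕ) : 0 < unitBallVolume d :=
  ENNReal.toReal_pos (Metric.measure_ball_pos volume _ one_pos).ne' measure_ball_lt_top.ne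

theorem sphereArea_pos (hd : 1 ≤ d) : 0 < sphereArea d :=
  mul_pos (by exact_mod_cast hd) (unitBallVolume_pos d)

/-- The radial profile `|z|^{1-d}` of the kernel, with value `0` at the origin when `2 ≤ d`. -/
def radialKernel (z : Sp d) : ℝ := (‖z‖ ^ (d - 1))⁻¹

theorem radialKernel_nonneg (z : Sp d) : 0 ≤ radialKernel z := by
  unfold radialKernel; positivity

theorem kernel_eq (z : Sp d) : kernel z = ((sphereArea d)⁻¹ * (‖z‖ ^ d)⁻¹) • z := by
  simp [kernel, sphereArea, mul_comm]

theorem kernel_neg (z : Sp d) : kernel (-z) = -kernel z := by simp [kernel]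

theorem norm_kernel (hd : 2 ≤ d) (z : Sp d) :
    ‖kernel z‖ = (sphereArea d)⁻¹ * radialKernel z := by
  have hκ := sphereArea_pos (d := d) (by omega)
  rw [kernel_eq, norm_smul, Real.norm_of_nonneg (by positivity), radialKernel, mul_assoc]
  congr 1
  rcases eq_or_ne z 0 with rfl | hz
  · simp [show d - 1 ≠ 0 by omega]
  · have : 0 < ‖z‖ := norm_pos_iff.2 hz
    obtain ⟨e, rfl⟩ : ∃ e, d = e + 1 := ⟨d - 1, by omega⟩
    simp only [Nat.add_sub_cancel]
    field_simp
    ring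

theorem measurable_radialKernel : Measurable (radialKernel : Sp d → ℝ) := by
  unfold radialKernel; fun_prop

theorem measurable_kernel : Measurable (kernel : Sp d → Sp d) := by
  unfold kernel; fun_prop

/-- The one-dimensional integrand `g` is prescribed separately, so that it has to match `y^(d-1)
f(y)` for positive `y` only. -/
theorem integral_radial (hd : 1 ≤ d) {f g : ℝ → ℝ} (hg : IntegrableOn g (Ioi 0))
    (h : ∀ y, 0 < y → y ^ (d - 1) * f y = g y) :
    Integrable (fun z : Sp d => f ‖z‖) ∧
      ∫ z : Sp d, f ‖z‖ = sphereArea d * ∫ y in Ioi (0 : ℝ), g y := by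
  have : Nontrivial (Sp d) := by
    have : Nonempty (Fin d) := ⟨⟨0, hd⟩⟩
    infer_instance
  constructor
  · rw [integrable_fun_norm_addHaar volume (f := f)]
    refine hg.congr_fun (fun y hy => ?_) measurableSet_Ioi
    simp [← h y hy]
  · rw [integral_fun_norm_addHaar volume f]
    simp only [finrank_euclideanSpace_fin, smul_eq_mul, nsmul_eq_mul, sphereArea, unitBallVolume,
      Measure.real]
    rw [← mul_assoc]
    congr 1
    refine setIntegral_congr_fun measurableSet_Ioi fun y hy => ?_
    exact h y hy

theorem integral_radialKernel_ball (hd : 1 ≤ d) {r : ℝ} (hr : 0 ≤ r) :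
    Integrable ((Metric.ball (0 : Sp d) r).indicator radialKernel) ∧
      ∫ z, (Metric.ball (0 : Sp d) r).indicator radialKernel z = sphereArea d * r := by
  have h := integral_radial hd (f := (Iio r).indicator fun y => (y ^ (d - 1))⁻¹)
    (g := (Iio r).indicator 1) ?_ ?_
  · have e : (fun z : Sp d => (Iio r).indicator (fun y => (y ^ (d - 1))⁻¹) ‖z‖)
        = (Metric.ball (0 : Sp d) r).indicator radialKernel := by
      ext z; simp [indicator, radialKernel]
    rw [e] at h
    refine ⟨h.1, ?_⟩
    have e2 := h.2
    rw [setIntegral_indicator measurableSet_Iio] at e2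
    refine e2.trans ?_
    rw [Ioi_inter_Iio]
    simp [hr]
  · rw [IntegrableOn, integrable_indicator_iff measurableSet_Iio, IntegrableOn,
      Measure.restrict_restrict measurableSet_Iio, Iio_inter_Ioi]
    exact integrableOn_const (by simp)
  · intro y hy
    by_cases h : y < r <;> simp [h, hy.ne']

theorem integral_rpow_compl_ball (hd : 1 ≤ d) {r s : ℝ} (hr : 0 < r) (hs : (d : ℝ) < s) :
    Integrable (fun z : Sp d => (Ici r).indicator (fun y : ℝ => y ^ (-s)) ‖z‖) ∧
      ∫ z : Sp d, (Ici r).indicator (fun y : ℝ => y ^ (-s)) ‖z‖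
        = sphereArea d * (r ^ (d - s) / (s - d)) := by
  have hlt : (d : ℝ) - 1 - s < -1 := by linarith
  have h := integral_radial hd (f := (Ici r).indicator fun y : ℝ => y ^ (-s))
    (g := (Ici r).indicator fun y : ℝ => y ^ ((d : ℝ) - 1 - s)) ?_ ?_
  · refine ⟨h.1, h.2.trans ?_⟩
    congr 1
    rw [setIntegral_indicator measurableSet_Ici, inter_eq_right.2 (show Ici r ⊆ Ioi 0 from fun y hy => hr.trans_le hy),
      integral_Ici_eq_integral_Ioi, integral_Ioi_rpow_of_lt hlt hr]
    rw [show (d : ℝ) - 1 - s + 1 = d - s by ring, neg_div, ← div_neg]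
    congr 1; ring
  · rw [IntegrableOn, integrable_indicator_iff measurableSet_Ici, IntegrableOn,
      Measure.restrict_restrict measurableSet_Ici, inter_eq_left.2 (show Ici r ⊆ Ioi 0 from fun y hy => hr.trans_le hy),
      ← IntegrableOn, integrableOn_Ici_iff_integrableOn_Ioi]
    exact integrableOn_Ioi_rpow_of_lt hlt hr
  · intro y hy
    by_cases h : r ≤ y
    · have e : y ^ (d - 1) = y ^ ((d : ℝ) - 1) := by
        rw [← Real.rpow_natCast, Nat.cast_sub hd, Nat.cast_one]
      simp only [indicator, mem_Ici, h, if_true]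
      rw [e, ← Real.rpow_add hy]; congr 1
    · simp [indicator, h]

/-- The source of the logarithm in the gradient estimate: in polar coordinates the integrand is at
most `1/a` below radius `a`, contributing `1`, and equals `1/y` between `a` and `b`. -/
theorem integral_max_pow_ball (hd : 1 ≤ d) {a b : ℝ} (ha : 0 < a) (hab : a ≤ b) :
    Integrable (fun z : Sp d => (Iio b).indicator (fun y : ℝ => (max y a ^ d)⁻¹) ‖z‖) ∧
      ∫ z : Sp d, (Iio b).indicator (fun y : ℝ => (max y a ^ d)⁻¹) ‖z‖
        ≤ sphereArea d * (1 + Real.log (b / a)) := by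
  have hg1 : IntegrableOn (fun y : ℝ => a⁻¹) (Ioo 0 a) := integrableOn_const (by simp)
  have hg2 : IntegrableOn (fun y : ℝ => y⁻¹) (Ioo a b) := by
    have : ContinuousOn (fun y : ℝ => y⁻¹) (Icc a b) :=
      continuousOn_inv₀.mono fun y hy => (ha.trans_le hy.1).ne'
    exact (this.integrableOn_Icc).mono_set Ioo_subset_Icc_self
  set g1 : ℝ → ℝ := (Ioo 0 a).indicator fun _ => a⁻¹
  set g2 : ℝ → ℝ := (Ioo a b).indicator fun y => y⁻¹
  have hI1 : Integrable g1 := (integrable_indicator_iff measurableSet_Ioo).2 hg1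
  have hI2 : Integrable g2 := (integrable_indicator_iff measurableSet_Ioo).2 hg2
  have h := integral_radial hd (f := fun y => (y ^ (d - 1))⁻¹ * (g1 y + g2 y))
    (g := fun y => g1 y + g2 y) (hI1.add hI2).integrableOn (fun y hy => by
      field_simp)
  have hint : ∫ y in Ioi (0 : ℝ), (g1 y + g2 y) = 1 + Real.log (b / a) := by
    rw [integral_add hI1.integrableOn hI2.integrableOn,
      setIntegral_indicator measurableSet_Ioo, setIntegral_indicator measurableSet_Ioo,
      inter_eq_right.2 (show Ioo 0 a ⊆ Ioi 0 from fun y hy => hy.1),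
      inter_eq_right.2 (show Ioo a b ⊆ Ioi 0 from fun y hy => ha.trans hy.1),
      ← integral_Ioc_eq_integral_Ioo, ← integral_Ioc_eq_integral_Ioo,
      ← intervalIntegral.integral_of_le hab, integral_inv_of_pos ha (ha.trans_le hab)]
    simp [ha.le, ha.ne']
  have hle : ∀ᵐ z : Sp d, (Iio b).indicator (fun y : ℝ => (max y a ^ d)⁻¹) ‖z‖
      ≤ (‖z‖ ^ (d - 1))⁻¹ * (g1 ‖z‖ + g2 ‖z‖) := by
    have hnull : ∀ᵐ z : Sp d, ‖z‖ ≠ a ∧ z ≠ 0 := by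
      have : Nonempty (Fin d) := ⟨⟨0, hd⟩⟩
      have h1 : (volume : Measure (Sp d)) (Metric.sphere 0 a) = 0 :=
        Measure.addHaar_sphere_of_ne_zero _ _ ha.ne'
      have h2 : (volume : Measure (Sp d)) {0} = 0 := measure_singleton 0
      filter_upwards [compl_mem_ae_iff.2 h1, compl_mem_ae_iff.2 h2] with z hz1 hz2
      exact ⟨by simpa using hz1, by simpa using hz2⟩
    filter_upwards [hnull] with z hz
    have hz0 : 0 < ‖z‖ := norm_pos_iff.2 hz.2
    have e : ∀ y : ℝ, y ^ d = y ^ (d - 1) * y := fun y => by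
      rw [← pow_succ]; congr 1; omega
    by_cases hb : ‖z‖ < b
    · simp only [indicator, mem_Iio, hb, if_true, g1, g2, mem_Ioo, hz0, true_and, and_true]
      rcases lt_or_gt_of_ne hz.1 with hlt | hgt
      · simp only [hlt, if_true, not_lt.2 hlt.le, if_false, add_zero]
        rw [max_eq_right hlt.le, e, mul_inv]
        gcongr
      · simp only [hgt, if_true, not_lt.2 hgt.le, if_false, zero_add]
        rw [max_eq_left hgt.le, e, mul_inv]
    · have h1 : g1 ‖z‖ = 0 := by
        simp only [g1, indicator, mem_Ioo]
        rw [if_neg]; intro h; linarith [h.2]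
      have h2 : g2 ‖z‖ = 0 := by
        simp only [g2, indicator, mem_Ioo]
        rw [if_neg]; intro h; exact hb h.2
      simp [indicator, hb, h1, h2]
  have hnn : ∀ z : Sp d, 0 ≤ (Iio b).indicator (fun y : ℝ => (max y a ^ d)⁻¹) ‖z‖ := fun z =>
    indicator_nonneg (fun y _ => by have := ha.trans_le (le_max_right y a); positivity) _
  have hmeas : Measurable fun z : Sp d => (Iio b).indicator (fun y : ℝ => (max y a ^ d)⁻¹) ‖z‖ := by
    have : Measurable ((Iio b).indicator (fun y : ℝ => (max y a ^ d)⁻¹)) :=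
      Measurable.indicator (by fun_prop) measurableSet_Iio
    exact this.comp measurable_norm
  have hi : Integrable (fun z : Sp d => (Iio b).indicator (fun y : ℝ => (max y a ^ d)⁻¹) ‖z‖) := by
    refine h.1.mono' hmeas.aestronglyMeasurable ?_
    filter_upwards [hle] with z hz
    rwa [Real.norm_of_nonneg (hnn z)]
  refine ⟨hi, (integral_mono_ae hi h.1 hle).trans (le_of_eq ?_)⟩
  rw [h.2, hint]

/-- The basic estimate of a potential by the sup norm and the mass of its density. -/
theorem integral_mul_radialKernel_le (hd : 1 ≤ d) {φ : Sp d → ℝ} {A m r : ℝ}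
    (hφ : Integrable φ) (hA : ∀ y, |φ y| ≤ A) (hm : ∫ y, |φ y| ≤ m) (hr : 0 < r) (x : Sp d) :
    Integrable (fun y => |φ y| * radialKernel (x - y)) ∧
      ∫ y, |φ y| * radialKernel (x - y) ≤ A * (sphereArea d * r) + m / r ^ (d - 1) := by
  have hb := integral_radialKernel_ball hd hr.le
  have hi1 : Integrable fun y => (Metric.ball (0 : Sp d) r).indicator radialKernel (x - y) :=
    hb.1.comp_sub_left x
  have hA0 : 0 ≤ A := (abs_nonneg _).trans (hA 0)
  have hle : ∀ y, |φ y| * radialKernel (x - y)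
      ≤ A * (Metric.ball (0 : Sp d) r).indicator radialKernel (x - y) + |φ y| / r ^ (d - 1) := by
    intro y
    -- Inside radius `r` the sup norm of the density is used and the kernel is integrated; outside,
    -- the kernel is at most `r^(1-d)` and the mass is used.
    by_cases h : x - y ∈ Metric.ball (0 : Sp d) r
    · rw [indicator_of_mem h]
      have := mul_le_mul_of_nonneg_right (hA y) (radialKernel_nonneg (x - y))
      have h2 : 0 ≤ |φ y| / r ^ (d - 1) := by positivity
      linarith
    · rw [indicator_of_notMem h, mul_zero, zero_add, div_eq_mul_inv]
      refine mul_le_mul_of_nonneg_left ?_ (abs_nonneg _)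
      have : r ≤ ‖x - y‖ := by simpa using h
      unfold radialKernel
      gcongr
  have hmaj := (hi1.const_mul A).add (hφ.abs.div_const (r ^ (d - 1)))
  have hi : Integrable (fun y => |φ y| * radialKernel (x - y)) := by
    refine hmaj.mono' (hφ.abs.aestronglyMeasurable.mul
      (measurable_radialKernel.comp (measurable_const.sub measurable_id)).aestronglyMeasurable) ?_
    refine Eventually.of_forall fun y => ?_
    rw [Real.norm_of_nonneg (mul_nonneg (abs_nonneg _) (radialKernel_nonneg _))]
    exact hle y
  refine ⟨hi, (integral_mono hi hmaj hle).trans ?_⟩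
  rw [integral_add' (hi1.const_mul A) (hφ.abs.div_const _), integral_const_mul, integral_div]
  have : ∫ y, (Metric.ball (0 : Sp d) r).indicator radialKernel (x - y) = sphereArea d * r := by
    rw [← hb.2]; exact integral_sub_left_eq_self _ volume x
  rw [this]
  gcongr

end Kernel

end VlasovPoisson
end

noncomputable section

namespace VlasovPoisson

open scoped NNReal ENNReal

variable {d : ℕ}

/-! ### Solutions with decaying data: Lagrangian formulas -/

/-- The standing assumptions on the solution `f`, with the data expressed in the coordinates
`(x - α v, v)`. -/
structure IsDispersing (α p C₀ : ℝ) (f₀ : Sp d → Sp d → ℝ) (f : ℝ → Sp d → Sp d → ℝ) :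
    Prop where
  four_le : 4 ≤ d
  alpha_nonneg : 0 ≤ α
  lt_p : (d : ℝ) + 1 < p
  const_nonneg : 0 ≤ C₀
  sol : IsClassicalSolution f₀ f
  nonneg : ∀ z, 0 ≤ sheared α f 0 z
  integrable : Integrable (sheared α f 0)
  decay : ∀ z, sheared α f 0 z ≤ C₀ * (1 + ‖z.1‖) ^ (-p)
  fderiv_decay : ∀ z, ‖fderiv ℝ (sheared α f 0) z‖ ≤ C₀ * (1 + ‖z.1‖) ^ (-p)
  second_moment : Integrable fun z => sheared α f 0 z * ‖z.1‖ ^ 2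

/-- The phase-space flow generated by the electric field of `f`. -/
abbrev phaseFlow (α : ℝ) (f : ℝ → Sp d → Sp d → ℝ) (s t : ℝ) (z : Sp d × Sp d) : Sp d × Sp d :=
  flow (phaseField α (efield f)) s t z

/-- The position at time `t` of the particle that starts at `z`. -/
def position (α : ℝ) (f : ℝ → Sp d → Sp d → ℝ) (t : ℝ) (z : Sp d × Sp d) : Sp d :=
  (phaseFlow α f 0 t z).1 + (t + α) • (phaseFlow α f 0 t z).2

namespace IsDispersing

variable {α p C₀ : ℝ} {f₀ : Sp d → Sp d → ℝ} {f : ℝ → Sp d → Sp d → ℝ}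

theorem isFlowField (h : IsDispersing α p C₀ f₀ f) : IsFlowField (phaseField α (efield f)) :=
  h.sol.isFlowField_efield.phaseField α

theorem continuous_phaseFlow (h : IsDispersing α p C₀ f₀ f) (s t : ℝ) :
    Continuous (phaseFlow α f s t) := h.isFlowField.continuous_flow s t

theorem continuous_position (h : IsDispersing α p C₀ f₀ f) (t : ℝ) :
    Continuous (position α f t) := by
  have := h.continuous_phaseFlow 0 t
  unfold position
  fun_prop

theorem measurePreserving (h : IsDispersing α p C₀ f₀ f) (s t : ℝ) :
    MeasurePreserving (phaseFlow α f s t) volume volume :=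
  h.sol.isFlowField_efield.measurePreserving_phaseFlow α s t

theorem sheared_eq (h : IsDispersing α p C₀ f₀ f) {t : ℝ} (ht : 0 ≤ t) (z : Sp d × Sp d) :
    sheared α f t z = sheared α f 0 (phaseFlow α f t 0 z) :=
  (h.sol.sheared_flow α ht le_rfl z).symm

theorem sheared_phaseFlow (h : IsDispersing α p C₀ f₀ f) {t : ℝ} (ht : 0 ≤ t) (z : Sp d × Sp d) :
    sheared α f t (phaseFlow α f 0 t z) = sheared α f 0 z :=
  h.sol.sheared_flow α le_rfl ht z

theorem sheared_nonneg (h : IsDispersing α p C₀ f₀ f) {t : ℝ} (ht : 0 ≤ t) (z : Sp d × Sp d) :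
    0 ≤ sheared α f t z := by rw [h.sheared_eq ht]; exact h.nonneg _

theorem f_eq_sheared (α t : ℝ) (f : ℝ → Sp d → Sp d → ℝ) (x v : Sp d) :
    f t x v = sheared α f t (x - (t + α) • v, v) := by simp [sheared]

theorem f_nonneg (h : IsDispersing α p C₀ f₀ f) {t : ℝ} (ht : 0 ≤ t) (x v : Sp d) :
    0 ≤ f t x v := by rw [f_eq_sheared α t f]; exact h.sheared_nonneg ht _

theorem continuous_sheared (h : IsDispersing α p C₀ f₀ f) {t : ℝ} (ht : 0 ≤ t) :
    Continuous (sheared α f t) := (h.sol.contDiff_sheared α ht).continuous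

/-- The phase-space density is transported by the measure-preserving flow. -/
theorem integrable_sheared_smul_iff (h : IsDispersing α p C₀ f₀ f) {F : Type*}
    [NormedAddCommGroup F] [NormedSpace ℝ F] {t : ℝ} (ht : 0 ≤ t) {φ : Sp d × Sp d → F}
    (hφ : AEStronglyMeasurable φ) :
    Integrable (fun z => sheared α f 0 z • φ (phaseFlow α f 0 t z)) ↔
      Integrable fun z => sheared α f t z • φ z := by
  have := (h.measurePreserving 0 t).integrable_comp (g := fun z => sheared α f t z • φ z)
    ((h.continuous_sheared ht).aestronglyMeasurable.smul hφ)
  rw [← this]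
  simp only [Function.comp_def, h.sheared_phaseFlow ht]

theorem integral_sheared_smul (h : IsDispersing α p C₀ f₀ f) {F : Type*}
    [NormedAddCommGroup F] [NormedSpace ℝ F] {t : ℝ} (ht : 0 ≤ t) {φ : Sp d × Sp d → F}
    (hφ : AEStronglyMeasurable φ) :
    ∫ z, sheared α f 0 z • φ (phaseFlow α f 0 t z) = ∫ z, sheared α f t z • φ z := by
  have hm := h.measurePreserving 0 t
  have := integral_map (μ := volume) hm.aemeasurable (f := fun z => sheared α f t z • φ z)
    (by rw [hm.map_eq]; exact (h.continuous_sheared ht).aestronglyMeasurable.smul hφ)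
  rw [hm.map_eq] at this
  rw [this]
  simp only [h.sheared_phaseFlow ht]

theorem integrable_sheared (h : IsDispersing α p C₀ f₀ f) {t : ℝ} (ht : 0 ≤ t) :
    Integrable (sheared α f t) := by
  have := (h.integrable_sheared_smul_iff (F := ℝ) ht (φ := fun _ => (1 : ℝ))
    aestronglyMeasurable_const).1 (by simpa using h.integrable)
  simpa using this

/-- The total mass. -/
def mass (α : ℝ) (f : ℝ → Sp d → Sp d → ℝ) : ℝ := ∫ z, sheared α f 0 z

theorem integral_sheared (h : IsDispersing α p C₀ f₀ f) {t : ℝ} (ht : 0 ≤ t) :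
    ∫ z, sheared α f t z = mass α f := by
  have := h.integral_sheared_smul (F := ℝ) ht (φ := fun _ => (1 : ℝ)) aestronglyMeasurable_const
  simpa [mass] using this.symm

theorem mass_nonneg (h : IsDispersing α p C₀ f₀ f) : 0 ≤ mass α f :=
  integral_nonneg h.nonneg

theorem density_nonneg (h : IsDispersing α p C₀ f₀ f) {t : ℝ} (ht : 0 ≤ t) (x : Sp d) :
    0 ≤ density (f t) x := integral_nonneg fun v => h.f_nonneg ht x v

/-- Undoing the shear in an integral over phase space. -/
theorem integrable_shear_iff {F : Type*} [NormedAddCommGroup F] {ψ : Sp d × Sp d → F} (τ : ℝ)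
    (hψ : AEStronglyMeasurable ψ) :
    Integrable (fun z : Sp d × Sp d => ψ (z.1 + τ • z.2, z.2)) ↔ Integrable ψ :=
  (measurePreserving_shear_fst τ).integrable_comp hψ

theorem integral_shear {F : Type*} [NormedAddCommGroup F] [NormedSpace ℝ F]
    {ψ : Sp d × Sp d → F} (τ : ℝ) (hψ : AEStronglyMeasurable ψ) :
    ∫ z : Sp d × Sp d, ψ (z.1 + τ • z.2, z.2) = ∫ z, ψ z := by
  have hm := measurePreserving_shear_fst (d := d) τ
  have := integral_map (μ := volume) hm.aemeasurable (f := ψ) (by rwa [hm.map_eq])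
  rw [hm.map_eq] at this
  exact this.symm

theorem integrable_f (h : IsDispersing α p C₀ f₀ f) {t : ℝ} (ht : 0 ≤ t) :
    Integrable fun z : Sp d × Sp d => f t z.1 z.2 :=
  (integrable_shear_iff (t + α)
    (h.sol.contDiff_slice ht).continuous.aestronglyMeasurable).1 (h.integrable_sheared ht)

theorem integrable_density (h : IsDispersing α p C₀ f₀ f) {t : ℝ} (ht : 0 ≤ t) :
    Integrable (density (f t)) := (h.integrable_f ht).integral_prod_left

theorem integral_density (h : IsDispersing α p C₀ f₀ f) {t : ℝ} (ht : 0 ≤ t) :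
    ∫ x, density (f t) x = mass α f := by
  rw [← h.integral_sheared ht]
  have e1 := integral_shear (d := d) (ψ := fun z => f t z.1 z.2) (t + α)
    (h.sol.contDiff_slice ht).continuous.aestronglyMeasurable
  have e2 := integral_prod _ (h.integrable_f ht)
  exact (e1.trans e2).symm

theorem integral_abs_density (h : IsDispersing α p C₀ f₀ f) {t : ℝ} (ht : 0 ≤ t) :
    ∫ x, |density (f t) x| = mass α f := by
  simp only [abs_of_nonneg (h.density_nonneg ht _), h.integral_density ht]

/-- An integral against the charge density is an integral over the particles. -/
theorem integral_density_smul (h : IsDispersing α p C₀ f₀ f) {F : Type*}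
    [NormedAddCommGroup F] [NormedSpace ℝ F] [CompleteSpace F] {t : ℝ} (ht : 0 ≤ t) {φ : Sp d → F}
    (hφ : AEStronglyMeasurable φ) (hi : Integrable fun x => density (f t) x • φ x) :
    Integrable (fun z => sheared α f 0 z • φ (position α f t z)) ∧
      ∫ z, sheared α f 0 z • φ (position α f t z) = ∫ x, density (f t) x • φ x := by
  have hq : Measure.QuasiMeasurePreserving (Prod.fst : Sp d × Sp d → Sp d) volume volume :=
    Measure.quasiMeasurePreserving_fst
  have hφ1 : AEStronglyMeasurable fun z : Sp d × Sp d => φ z.1 := hφ.comp_quasiMeasurePreserving hq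
  have hm1 : AEStronglyMeasurable fun z : Sp d × Sp d => f t z.1 z.2 • φ z.1 :=
    (h.sol.contDiff_slice ht).continuous.aestronglyMeasurable.smul hφ1
  have hi1 : Integrable fun z : Sp d × Sp d => f t z.1 z.2 • φ z.1 := by
    refine (integrable_prod_iff hm1).2 ⟨Eventually.of_forall fun x => ?_, ?_⟩
    · exact (h.sol.density_exists t ht x).smul_const (φ x)
    · refine hi.norm.congr (Eventually.of_forall fun x => ?_)
      simp only [norm_smul, Real.norm_of_nonneg (h.f_nonneg ht x _),
        Real.norm_of_nonneg (h.density_nonneg ht x)]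
      rw [integral_mul_const, density]
  have hshear := (measurePreserving_shear_fst (d := d) (t + α)).quasiMeasurePreserving
  have hφ2 : AEStronglyMeasurable fun z : Sp d × Sp d => φ (z.1 + (t + α) • z.2) :=
    hφ1.comp_quasiMeasurePreserving hshear
  have hi2 : Integrable fun z => sheared α f t z • φ (z.1 + (t + α) • z.2) :=
    (integrable_shear_iff (t + α) hm1).2 hi1
  refine ⟨(h.integrable_sheared_smul_iff ht hφ2).2 hi2, ?_⟩
  have e1 := h.integral_sheared_smul ht hφ2
  have e2 := integral_shear (d := d) (t + α) hm1
  have e3 := integral_prod _ hi1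
  refine e1.trans (e2.trans (e3.trans ?_))
  simp only [integral_smul_const]
  rfl

/-- The electric field as a superposition of the fields of the particles. -/
theorem efield_eq (h : IsDispersing α p C₀ f₀ f) {t : ℝ} (ht : 0 ≤ t) (x : Sp d) :
    Integrable (fun z => sheared α f 0 z • kernel (x - position α f t z)) ∧
      efield f t x = ∫ z, sheared α f 0 z • kernel (x - position α f t z) := by
  have hφ : AEStronglyMeasurable fun y : Sp d => kernel (x - y) :=
    (measurable_kernel.comp (measurable_const.sub measurable_id)).aestronglyMeasurable
  have := h.integral_density_smul ht hφ (h.sol.field_exists t ht x)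
  refine ⟨this.1, ?_⟩
  rw [this.2, efield_of_nonneg f ht]
  rfl

/-! ### Pointwise bounds in terms of the displacement of the characteristics -/

/-- A characteristic displaced by at most `R` can spoil the spatial decay of the datum only at the
length scale `R`. -/
theorem weight_le (h : IsDispersing α p C₀ f₀ f) {t R : ℝ} (hR : 1 ≤ R)
    {z : Sp d × Sp d} (hz : ‖(phaseFlow α f t 0 z).1 - z.1‖ ≤ R) :
    (1 + ‖(phaseFlow α f t 0 z).1‖) ^ (-p) ≤ 2 ^ p * (1 + ‖z.1‖ / R) ^ (-p) := by
  have hp : 0 ≤ p := by linarith [h.lt_p, Nat.cast_nonneg (α := ℝ) d]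
  set w := (phaseFlow α f t 0 z).1
  have h1 : ‖z.1‖ ≤ ‖w‖ + R := by
    have := norm_sub_le w (w - z.1)
    simp only [sub_sub_cancel] at this
    linarith
  have hR0 : 0 < R := by linarith
  have h2 : 1 + ‖z.1‖ / R ≤ 2 * (1 + ‖w‖) := by
    have : ‖z.1‖ / R ≤ ‖w‖ + 1 := by
      rw [div_le_iff₀ hR0]
      nlinarith [norm_nonneg w]
    linarith [norm_nonneg w]
  have hpos : 0 < 1 + ‖w‖ := by positivity
  have hpos2 : 0 < 1 + ‖z.1‖ / R := by positivity
  rw [Real.rpow_neg hpos.le, Real.rpow_neg hpos2.le, ← div_eq_mul_inv, inv_eq_one_div,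
    div_le_div_iff₀ (by positivity) (by positivity), one_mul, ← Real.mul_rpow (by norm_num) hpos.le]
  exact Real.rpow_le_rpow hpos2.le h2 hp

theorem sheared_le (h : IsDispersing α p C₀ f₀ f) {t R : ℝ} (ht : 0 ≤ t) (hR : 1 ≤ R)
    {z : Sp d × Sp d} (hz : ‖(phaseFlow α f t 0 z).1 - z.1‖ ≤ R) :
    sheared α f t z ≤ C₀ * 2 ^ p * (1 + ‖z.1‖ / R) ^ (-p) := by
  rw [h.sheared_eq ht, mul_assoc]
  exact (h.decay _).trans (mul_le_mul_of_nonneg_left (h.weight_le hR hz) h.const_nonneg)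

theorem sheared_le_const (h : IsDispersing α p C₀ f₀ f) {t : ℝ} (ht : 0 ≤ t)
    (z : Sp d × Sp d) : sheared α f t z ≤ C₀ := by
  rw [h.sheared_eq ht]
  refine (h.decay _).trans (mul_le_of_le_one_right h.const_nonneg ?_)
  refine Real.rpow_le_one_of_one_le_of_nonpos ?_ ?_
  · linarith [norm_nonneg (phaseFlow α f t 0 z).1]
  · linarith [h.lt_p, Nat.cast_nonneg (α := ℝ) d]

theorem integrable_weight (h : IsDispersing α p C₀ f₀ f) :
    Integrable fun u : Sp d => (1 + ‖u‖) ^ (-p) :=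
  integrable_one_add_norm (by simp; linarith [h.lt_p])

/-- The integral of the weight `(1 + |u|)^{-p}`. -/
def weightIntegral (d : ℕ) (p : ℝ) : ℝ := ∫ u : Sp d, (1 + ‖u‖) ^ (-p)

theorem weightIntegral_nonneg (d : ℕ) (p : ℝ) : 0 ≤ weightIntegral d p :=
  integral_nonneg fun u => by positivity

theorem integral_weight_scaled (h : IsDispersing α p C₀ f₀ f) {τ R : ℝ} (hτ : 0 < τ) (hR : 0 < R)
    (x : Sp d) :
    Integrable (fun v : Sp d => (1 + ‖x - τ • v‖ / R) ^ (-p)) ∧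
      ∫ v : Sp d, (1 + ‖x - τ • v‖ / R) ^ (-p) = (R / τ) ^ d * weightIntegral d p := by
  have e : (fun v : Sp d => (1 + ‖x - τ • v‖ / R) ^ (-p))
      = fun v => (fun u : Sp d => (1 + ‖R⁻¹ • x - u‖) ^ (-p)) ((τ / R) • v) := by
    ext v
    have : x - τ • v = R • (R⁻¹ • x - (τ / R) • v) := by
      rw [smul_sub, smul_smul, smul_smul]
      field_simp
      simp
    simp only
    rw [this, norm_smul, Real.norm_of_nonneg hR.le, mul_div_cancel_left₀ _ hR.ne']
  have hi := h.integrable_weight.comp_sub_left (R⁻¹ • x)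
  rw [e]
  refine ⟨hi.comp_smul (div_pos hτ hR).ne', ?_⟩
  rw [Measure.integral_comp_smul volume (fun u : Sp d => (1 + ‖R⁻¹ • x - u‖) ^ (-p)),
    integral_sub_left_eq_self (fun u : Sp d => (1 + ‖u‖) ^ (-p))]
  simp only [finrank_euclideanSpace_fin, smul_eq_mul, weightIntegral]
  rw [abs_of_nonneg (by positivity), ← inv_pow, inv_div]

/-- The dispersive mechanism: at fixed `x` the bound on the integrand in `v` is concentrated where
`|x - τ v| ≲ R`, a ball of radius `R/τ` in velocity space. -/
theorem density_le (h : IsDispersing α p C₀ f₀ f) {t R : ℝ} (ht : 0 ≤ t) (hτ : 0 < t + α)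
    (hR : 1 ≤ R) (hz : ∀ z, ‖(phaseFlow α f t 0 z).1 - z.1‖ ≤ R) (x : Sp d) :
    density (f t) x ≤ C₀ * 2 ^ p * weightIntegral d p * (R / (t + α)) ^ d := by
  have hw := h.integral_weight_scaled hτ (by linarith : 0 < R) x
  calc density (f t) x ≤ ∫ v : Sp d, C₀ * 2 ^ p * (1 + ‖x - (t + α) • v‖ / R) ^ (-p) := by
        refine integral_mono (h.sol.density_exists t ht x) (hw.1.const_mul _) fun v => ?_
        have := h.sheared_le ht hR (hz (x - (t + α) • v, v))
        rwa [← f_eq_sheared] at this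
    _ = _ := by rw [integral_const_mul, hw.2]; ring

end IsDispersing

end VlasovPoisson
end

noncomputable section

namespace VlasovPoisson

open scoped NNReal ENNReal

variable {d : ℕ}

/-! ### Regularized kernels -/

/-- The regularized distance `√(|z|² + ε²)`. -/
def regNorm (ε : ℝ) (z : Sp d) : ℝ := Real.sqrt (‖z‖ ^ 2 + ε ^ 2)

/-- The regularized potential, proportional to `(|z|² + ε²)^{-(d-2)/2}`. -/
def regPotential (ε : ℝ) (z : Sp d) : ℝ :=
  (sphereArea d)⁻¹ / ((d : ℝ) - 2) * (regNorm ε z ^ (d - 2))⁻¹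

/-- The regularized kernel `-∇` of `regPotential`. -/
def regKernel (ε : ℝ) (z : Sp d) : Sp d := ((sphereArea d)⁻¹ * (regNorm ε z ^ d)⁻¹) • z

theorem regNorm_sq (ε : ℝ) (z : Sp d) : regNorm ε z ^ 2 = ‖z‖ ^ 2 + ε ^ 2 :=
  Real.sq_sqrt (by positivity)

theorem le_regNorm (ε : ℝ) (z : Sp d) : ε ≤ regNorm ε z :=
  Real.le_sqrt_of_sq_le (by nlinarith [sq_nonneg ‖z‖])

theorem norm_le_regNorm (ε : ℝ) (z : Sp d) : ‖z‖ ≤ regNorm ε z :=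
  Real.le_sqrt_of_sq_le (by nlinarith [sq_nonneg ε])

theorem regNorm_le {ε : ℝ} (hε : 0 < ε) (z : Sp d) : regNorm ε z ≤ ‖z‖ + ε :=
  Real.sqrt_le_iff.2 ⟨by positivity, by nlinarith [norm_nonneg z]⟩

theorem regNorm_pos {ε : ℝ} (hε : 0 < ε) (z : Sp d) : 0 < regNorm ε z :=
  hε.trans_le (le_regNorm ε z)

theorem continuous_regNorm (ε : ℝ) : Continuous (regNorm ε : Sp d → ℝ) := by
  unfold regNorm; fun_prop

theorem continuous_regPotential {ε : ℝ} (hε : 0 < ε) : Continuous (regPotential ε : Sp d → ℝ) := by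
  have := continuous_regNorm (d := d) ε
  unfold regPotential
  exact continuous_const.mul ((this.pow _).inv₀ fun z => (pow_pos (regNorm_pos hε z) _).ne')

theorem continuous_regKernel {ε : ℝ} (hε : 0 < ε) : Continuous (regKernel ε : Sp d → Sp d) := by
  have := continuous_regNorm (d := d) ε
  unfold regKernel
  exact (continuous_const.mul
    ((this.pow _).inv₀ fun z => (pow_pos (regNorm_pos hε z) _).ne')).smul continuous_id

theorem hasDerivAt_regPotential (hd : 3 ≤ d) {ε : ℝ} (hε : 0 < ε) {X : ℝ → Sp d} {V : Sp d}
    {t : ℝ} (hX : HasDerivAt X V t) :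
    HasDerivAt (fun s => regPotential ε (X s)) (-inner ℝ (regKernel ε (X t)) V) t := by
  obtain ⟨e, rfl⟩ : ∃ e, d = e + 3 := ⟨d - 3, by omega⟩
  have hq := regNorm_pos hε (X t)
  have h1 : HasDerivAt (fun s => ‖X s‖ ^ 2 + ε ^ 2) (2 * inner ℝ (X t) V) t :=
    (hX.norm_sq).add_const _
  have h2 : HasDerivAt (fun s => regNorm ε (X s)) (2 * inner ℝ (X t) V / (2 * regNorm ε (X t))) t :=
    h1.sqrt (by positivity)
  have h3 := ((h2.pow (e + 1)).inv (pow_pos hq _).ne').const_mul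
    ((sphereArea (e + 3))⁻¹ / (((e + 3 : ℕ) : ℝ) - 2))
  refine (h3.congr_deriv ?_)
  rw [regKernel, real_inner_smul_left]
  have he : ((e + 3 : ℕ) : ℝ) - 2 = e + 1 := by push_cast; ring
  have he0 : (e : ℝ) + 1 ≠ 0 := by positivity
  rw [he]
  simp only [Nat.add_sub_cancel, Pi.pow_apply]
  push_cast
  field_simp
  ring

/-- The place where the dimension matters for the energy: `2/(d-2) ≤ 1`. For the exact kernel the
left side is nonpositive; the right side is the price of the regularization. -/
theorem two_mul_regPotential_sub_le (hd : 4 ≤ d) {ε : ℝ} (hε : 0 < ε) (z : Sp d) :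
    2 * regPotential ε z - inner ℝ (regKernel ε z) z
      ≤ (sphereArea d)⁻¹ * (ε ^ 2 * (regNorm ε z ^ d)⁻¹) := by
  have hκ : 0 < (sphereArea d)⁻¹ := inv_pos.2 (sphereArea_pos (by omega))
  have hq := regNorm_pos hε z
  have hd' : (4 : ℝ) ≤ d := by exact_mod_cast hd
  have e1 : (regNorm ε z ^ (d - 2))⁻¹ = (‖z‖ ^ 2 + ε ^ 2) * (regNorm ε z ^ d)⁻¹ := by
    rw [← regNorm_sq]
    obtain ⟨e, rfl⟩ : ∃ e, d = e + 2 := ⟨d - 2, by omega⟩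
    simp only [Nat.add_sub_cancel]
    field_simp
    ring
  have e2 : 2 * regPotential ε z
      ≤ (sphereArea d)⁻¹ * ((‖z‖ ^ 2 + ε ^ 2) * (regNorm ε z ^ d)⁻¹) := by
    rw [regPotential, e1, ← mul_assoc]
    refine mul_le_mul_of_nonneg_right ?_ (by positivity)
    rw [mul_div_assoc', div_le_iff₀ (by linarith)]
    nlinarith
  rw [regKernel, real_inner_smul_left, real_inner_self_eq_norm_sq]
  nlinarith

/-- Makes the defect of the energy inequality small with `ε`, relative to a kernel whose potentials
are bounded. The origin is excluded because `radialKernel` takes the value `0` there when `2 ≤ d`.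
-/
theorem sq_mul_inv_regNorm_le (hd : 1 ≤ d) {ε : ℝ} (hε : 0 < ε) {z : Sp d} (hz : z ≠ 0) :
    ε ^ 2 * (regNorm ε z ^ d)⁻¹ ≤ ε * radialKernel z := by
  have hz0 : 0 < ‖z‖ := norm_pos_iff.2 hz
  have h1 : ε * ‖z‖ ^ (d - 1) ≤ regNorm ε z ^ d := by
    obtain ⟨e, rfl⟩ : ∃ e, d = e + 1 := ⟨d - 1, by omega⟩
    simp only [Nat.add_sub_cancel]
    rw [pow_succ, mul_comm]
    exact mul_le_mul (pow_le_pow_left₀ hz0.le (norm_le_regNorm ε z) _) (le_regNorm ε z) hε.le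
      (pow_nonneg (regNorm_pos hε z).le _)
  have h2 : (regNorm ε z ^ d)⁻¹ ≤ (ε * ‖z‖ ^ (d - 1))⁻¹ := by gcongr
  calc ε ^ 2 * (regNorm ε z ^ d)⁻¹ ≤ ε ^ 2 * (ε * ‖z‖ ^ (d - 1))⁻¹ := by gcongr
    _ = ε * radialKernel z := by rw [radialKernel]; field_simp

theorem regPotential_nonneg (hd : 3 ≤ d) (ε : ℝ) (z : Sp d) : 0 ≤ regPotential ε z := by
  have hκ : 0 < (sphereArea d)⁻¹ := inv_pos.2 (sphereArea_pos (by omega))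
  have hd' : (3 : ℝ) ≤ d := by exact_mod_cast hd
  have : 0 ≤ regNorm ε z := Real.sqrt_nonneg _
  have : 0 ≤ (sphereArea d)⁻¹ / ((d : ℝ) - 2) := div_nonneg hκ.le (by linarith)
  unfold regPotential; positivity

theorem regPotential_le (hd : 3 ≤ d) {ε : ℝ} (hε : 0 < ε) {z : Sp d} (hz : z ≠ 0) :
    regPotential ε z ≤ (sphereArea d)⁻¹ * (1 + radialKernel z) := by
  have hκ : 0 < (sphereArea d)⁻¹ := inv_pos.2 (sphereArea_pos (by omega))
  have hd' : (3 : ℝ) ≤ d := by exact_mod_cast hd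
  have hz0 : 0 < ‖z‖ := norm_pos_iff.2 hz
  have hq := regNorm_pos hε z
  have h1 : (regNorm ε z ^ (d - 2))⁻¹ ≤ 1 + radialKernel z := by
    have h2 : (regNorm ε z ^ (d - 2))⁻¹ ≤ (‖z‖ ^ (d - 2))⁻¹ := by
      gcongr; exact norm_le_regNorm ε z
    refine h2.trans ?_
    have hr := radialKernel_nonneg z
    rcases le_total 1 ‖z‖ with h | h
    · have : (‖z‖ ^ (d - 2))⁻¹ ≤ 1 := inv_le_one_of_one_le₀ (one_le_pow₀ h)
      linarith
    · have : (‖z‖ ^ (d - 2))⁻¹ ≤ radialKernel z := by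
        unfold radialKernel
        refine inv_anti₀ (by positivity) (pow_le_pow_of_le_one hz0.le h (by omega))
      linarith
  unfold regPotential
  refine mul_le_mul ?_ h1 (by positivity) hκ.le
  exact div_le_self hκ.le (by linarith)

theorem abs_regPotential_le (hd : 3 ≤ d) {ε : ℝ} (hε : 0 < ε) (z : Sp d) :
    |regPotential ε z| ≤ (sphereArea d)⁻¹ * (ε ^ (d - 2))⁻¹ := by
  have hκ : 0 < (sphereArea d)⁻¹ := inv_pos.2 (sphereArea_pos (by omega))
  have hd' : (3 : ℝ) ≤ d := by exact_mod_cast hd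
  rw [abs_of_nonneg (regPotential_nonneg hd ε z)]
  unfold regPotential
  have hq := regNorm_pos hε z
  refine mul_le_mul (div_le_self hκ.le (by linarith)) ?_ (by positivity) hκ.le
  gcongr
  exact le_regNorm ε z

theorem norm_regKernel_le (hd : 1 ≤ d) {ε : ℝ} (hε : 0 < ε) (z : Sp d) :
    ‖regKernel ε z‖ ≤ (sphereArea d)⁻¹ * (ε ^ (d - 1))⁻¹ := by
  have hκ : 0 < (sphereArea d)⁻¹ := inv_pos.2 (sphereArea_pos hd)
  have hq := regNorm_pos hε z
  rw [regKernel, norm_smul, Real.norm_of_nonneg (by positivity), mul_assoc]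
  refine mul_le_mul_of_nonneg_left ?_ hκ.le
  obtain ⟨e, rfl⟩ : ∃ e, d = e + 1 := ⟨d - 1, by omega⟩
  simp only [Nat.add_sub_cancel]
  calc (regNorm ε z ^ (e + 1))⁻¹ * ‖z‖ ≤ (regNorm ε z ^ (e + 1))⁻¹ * regNorm ε z := by
        gcongr; exact norm_le_regNorm ε z
    _ = (regNorm ε z ^ e)⁻¹ := by field_simp; ring
    _ ≤ (ε ^ e)⁻¹ := by gcongr; exact le_regNorm ε z

theorem abs_inner_regKernel_le (hd : 2 ≤ d) {ε : ℝ} (hε : 0 < ε) (z : Sp d) :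
    |inner ℝ (regKernel ε z) z| ≤ (sphereArea d)⁻¹ * (ε ^ (d - 2))⁻¹ := by
  have hκ : 0 < (sphereArea d)⁻¹ := inv_pos.2 (sphereArea_pos (by omega))
  have hq := regNorm_pos hε z
  rw [regKernel, real_inner_smul_left, real_inner_self_eq_norm_sq, abs_of_nonneg (by positivity),
    mul_assoc]
  refine mul_le_mul_of_nonneg_left ?_ hκ.le
  obtain ⟨e, rfl⟩ : ∃ e, d = e + 2 := ⟨d - 2, by omega⟩
  simp only [Nat.add_sub_cancel]
  calc (regNorm ε z ^ (e + 2))⁻¹ * ‖z‖ ^ 2 ≤ (regNorm ε z ^ (e + 2))⁻¹ * regNorm ε z ^ 2 := by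
        gcongr; exact norm_le_regNorm ε z
    _ = (regNorm ε z ^ e)⁻¹ := by field_simp; ring
    _ ≤ (ε ^ e)⁻¹ := by gcongr; exact le_regNorm ε z

/-- Within distance `r` the difference is bounded by the kernel itself, which has small integral
there. Farther out, the relative error of the `d`-th power is at most `d ε / r` by Bernoulli's
inequality. -/
theorem norm_regKernel_sub_kernel_le (hd : 2 ≤ d) {ε r : ℝ} (hε : 0 < ε) (hr : 0 < r) (z : Sp d) :
    ‖regKernel ε z - kernel z‖ ≤ (sphereArea d)⁻¹ *
      ((Metric.ball (0 : Sp d) r).indicator radialKernel z + d * ε / r * radialKernel z) := by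
  have hκ : 0 < (sphereArea d)⁻¹ := inv_pos.2 (sphereArea_pos (by omega))
  rcases eq_or_ne z 0 with rfl | hz
  · have h1 : (0 : ℝ) ≤ (Metric.ball (0 : Sp d) r).indicator radialKernel 0 :=
      indicator_nonneg (fun z _ => radialKernel_nonneg z) _
    have h2 := radialKernel_nonneg (0 : Sp d)
    simp only [regKernel, kernel, smul_zero, sub_zero, norm_zero]
    positivity
  have hz0 : 0 < ‖z‖ := norm_pos_iff.2 hz
  have hq := regNorm_pos hε z
  have hle := norm_le_regNorm ε z
  have e0 : radialKernel z = (‖z‖ ^ d)⁻¹ * ‖z‖ := by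
    rw [radialKernel]
    obtain ⟨e, rfl⟩ : ∃ e, d = e + 1 := ⟨d - 1, by omega⟩
    simp only [Nat.add_sub_cancel]
    field_simp
    ring
  have hdiff : (regNorm ε z ^ d)⁻¹ ≤ (‖z‖ ^ d)⁻¹ := by gcongr
  have e1 : ‖regKernel ε z - kernel z‖
      = (sphereArea d)⁻¹ * (((‖z‖ ^ d)⁻¹ - (regNorm ε z ^ d)⁻¹) * ‖z‖) := by
    rw [kernel_eq, regKernel, ← sub_smul, norm_smul, ← mul_sub, norm_mul,
      Real.norm_of_nonneg hκ.le, Real.norm_of_nonpos (by linarith), neg_sub, mul_assoc]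
  rw [e1]
  refine mul_le_mul_of_nonneg_left ?_ hκ.le
  have hpos : 0 ≤ (regNorm ε z ^ d)⁻¹ * ‖z‖ := by positivity
  by_cases hzr : z ∈ Metric.ball (0 : Sp d) r
  · rw [indicator_of_mem hzr, e0, sub_mul]
    have : 0 ≤ d * ε / r * ((‖z‖ ^ d)⁻¹ * ‖z‖) := by positivity
    linarith
  · rw [indicator_of_notMem hzr, zero_add, e0, ← mul_assoc]
    refine mul_le_mul_of_nonneg_right ?_ hz0.le
    have hrz : r ≤ regNorm ε z := by
      have : r ≤ ‖z‖ := by simpa using hzr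
      exact this.trans hle
    have hb := one_add_mul_le_pow (a := ‖z‖ / regNorm ε z - 1) (by
      have : 0 ≤ ‖z‖ / regNorm ε z := by positivity
      linarith) d
    have h2 : -(ε / r) ≤ ‖z‖ / regNorm ε z - 1 := by
      have h3 : regNorm ε z - ‖z‖ ≤ ε := by linarith [regNorm_le hε z]
      have : 1 - ‖z‖ / regNorm ε z = (regNorm ε z - ‖z‖) / regNorm ε z := by field_simp
      have h4 : (regNorm ε z - ‖z‖) / regNorm ε z ≤ ε / r := div_le_div₀ hε.le h3 hr hrz
      linarith
    have h5 : 1 - d * (ε / r) ≤ (‖z‖ / regNorm ε z) ^ d := by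
      refine le_trans ?_ (hb.trans (le_of_eq (by ring)))
      nlinarith [Nat.cast_nonneg (α := ℝ) d]
    have h6 : (regNorm ε z ^ d)⁻¹ = (‖z‖ / regNorm ε z) ^ d * (‖z‖ ^ d)⁻¹ := by
      rw [div_pow]; field_simp
    rw [h6]
    have h7 : 0 < (‖z‖ ^ d)⁻¹ := by positivity
    have h8 : d * ε / r = d * (ε / r) := by ring
    rw [h8]
    nlinarith

end VlasovPoisson
end

noncomputable section

namespace VlasovPoisson

open scoped NNReal ENNReal

variable {d : ℕ}

/-! ### The dispersion estimate: bound on the second moment -/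

/-- The initial distribution of the particles in phase space, as a measure. -/
def particles (α : ℝ) (f : ℝ → Sp d → Sp d → ℝ) : Measure (Sp d × Sp d) :=
  volume.withDensity fun z => ENNReal.ofReal (sheared α f 0 z)

namespace IsDispersing

variable {α p C₀ : ℝ} {f₀ : Sp d → Sp d → ℝ} {f : ℝ → Sp d → Sp d → ℝ}

section Particles

variable {F : Type*} [NormedAddCommGroup F] [NormedSpace ℝ F]

theorem measurable_sheared_zero (h : IsDispersing α p C₀ f₀ f) :
    Measurable fun z => ENNReal.ofReal (sheared α f 0 z) :=
  (h.continuous_sheared le_rfl).measurable.ennreal_ofReal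

theorem integrable_particles_iff (h : IsDispersing α p C₀ f₀ f) {φ : Sp d × Sp d → F} :
    Integrable φ (particles α f) ↔ Integrable fun z => sheared α f 0 z • φ z := by
  rw [particles, integrable_withDensity_iff_integrable_smul' h.measurable_sheared_zero
    (Eventually.of_forall fun _ => ENNReal.ofReal_lt_top)]
  simp only [ENNReal.toReal_ofReal (h.nonneg _)]

theorem integral_particles (h : IsDispersing α p C₀ f₀ f) (φ : Sp d × Sp d → F) :
    ∫ z, φ z ∂(particles α f) = ∫ z, sheared α f 0 z • φ z := by
  rw [particles, integral_withDensity_eq_integral_toReal_smul h.measurable_sheared_zero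
    (Eventually.of_forall fun _ => ENNReal.ofReal_lt_top)]
  simp only [ENNReal.toReal_ofReal (h.nonneg _)]

theorem isFiniteMeasure_particles (h : IsDispersing α p C₀ f₀ f) :
    IsFiniteMeasure (particles α f) :=
  isFiniteMeasure_withDensity_ofReal h.integrable.2

theorem integral_particles_const (h : IsDispersing α p C₀ f₀ f) (c : ℝ) :
    ∫ _, c ∂(particles α f) = c * mass α f := by
  rw [h.integral_particles]
  simp only [smul_eq_mul, integral_mul_const, mass]
  ring

end Particles

theorem quasiMeasurePreserving_position (h : IsDispersing α p C₀ f₀ f) (t : ℝ) :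
    Measure.QuasiMeasurePreserving (position α f t) volume volume := by
  have h1 : Measure.QuasiMeasurePreserving (Prod.fst : Sp d × Sp d → Sp d) volume volume :=
    Measure.quasiMeasurePreserving_fst
  exact h1.comp ((measurePreserving_shear_fst (d := d) (t + α)).comp
    (h.measurePreserving 0 t)).quasiMeasurePreserving

/-- Lets the pointwise kernel bounds, valid away from the singularity, be integrated over the
particles. -/
theorem ae_position_ne (h : IsDispersing α p C₀ f₀ f) (t : ℝ) (x : Sp d) :
    ∀ᵐ z ∂(particles α f), x - position α f t z ≠ 0 := by
  have hd := h.four_le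
  have : Nonempty (Fin d) := ⟨⟨0, by omega⟩⟩
  have h1 : ∀ᵐ y : Sp d, y ≠ x := compl_mem_ae_iff.2 (measure_singleton x)
  have h2 := (h.quasiMeasurePreserving_position t).ae h1
  refine (withDensity_absolutelyContinuous volume _).ae_le ?_
  filter_upwards [h2] with z hz
  exact sub_ne_zero.2 (Ne.symm hz)

theorem efield_eq_particles (h : IsDispersing α p C₀ f₀ f) {t : ℝ} (ht : 0 ≤ t) (x : Sp d) :
    efield f t x = ∫ z, kernel (x - position α f t z) ∂(particles α f) := by
  rw [h.integral_particles, (h.efield_eq ht x).2]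

theorem integral_comp_position (h : IsDispersing α p C₀ f₀ f) {t : ℝ} (ht : 0 ≤ t) {φ : Sp d → ℝ}
    (hφ : Measurable φ) {x : Sp d} (hi : Integrable fun y => |density (f t) y| * φ (x - y)) :
    Integrable (fun z => φ (x - position α f t z)) (particles α f) ∧
      ∫ z, φ (x - position α f t z) ∂(particles α f) = ∫ y, |density (f t) y| * φ (x - y) := by
  simp only [abs_of_nonneg (h.density_nonneg ht _)] at hi ⊢
  have := h.integral_density_smul ht (φ := fun y => φ (x - y))
    (hφ.comp (measurable_const.sub measurable_id)).aestronglyMeasurable hi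
  exact ⟨h.integrable_particles_iff.2 this.1, (h.integral_particles _).trans this.2⟩

theorem integral_radialKernel_position (h : IsDispersing α p C₀ f₀ f) {t A r : ℝ} (ht : 0 ≤ t)
    (hA : ∀ x, density (f t) x ≤ A) (hr : 0 < r) (x : Sp d) :
    Integrable (fun z => radialKernel (x - position α f t z)) (particles α f) ∧
      ∫ z, radialKernel (x - position α f t z) ∂(particles α f)
        ≤ A * (sphereArea d * r) + mass α f / r ^ (d - 1) := by
  have h1 := integral_mul_radialKernel_le (by have := h.four_le; omega) (h.integrable_density ht)
    (A := A) (m := mass α f)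
    (fun y => by rw [abs_of_nonneg (h.density_nonneg ht y)]; exact hA y)
    (h.integral_abs_density ht).le hr x
  have h2 := h.integral_comp_position ht measurable_radialKernel h1.1
  exact ⟨h2.1, h2.2.trans_le h1.2⟩

theorem integral_ball_radialKernel_position (h : IsDispersing α p C₀ f₀ f) {t A r : ℝ} (ht : 0 ≤ t)
    (hA : ∀ x, density (f t) x ≤ A) (hr : 0 < r) (x : Sp d) :
    Integrable (fun z => (Metric.ball (0 : Sp d) r).indicator radialKernel
        (x - position α f t z)) (particles α f) ∧
      ∫ z, (Metric.ball (0 : Sp d) r).indicator radialKernel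
          (x - position α f t z) ∂(particles α f) ≤ A * (sphereArea d * r) := by
  have hd := h.four_le
  have hb := integral_radialKernel_ball (d := d) (by omega) hr.le
  have hmeas : Measurable ((Metric.ball (0 : Sp d) r).indicator radialKernel) :=
    measurable_radialKernel.indicator measurableSet_ball
  have hnn : ∀ z, 0 ≤ (Metric.ball (0 : Sp d) r).indicator radialKernel z := fun z =>
    indicator_nonneg (fun z _ => radialKernel_nonneg z) z
  have hbi := hb.1.comp_sub_left x
  have hle : ∀ y, |density (f t) y| * (Metric.ball (0 : Sp d) r).indicator radialKernel (x - y)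
      ≤ A * (Metric.ball (0 : Sp d) r).indicator radialKernel (x - y) := fun y => by
    rw [abs_of_nonneg (h.density_nonneg ht y)]
    exact mul_le_mul_of_nonneg_right (hA y) (hnn _)
  have hi : Integrable fun y =>
      |density (f t) y| * (Metric.ball (0 : Sp d) r).indicator radialKernel (x - y) := by
    refine (hbi.const_mul A).mono' ((h.integrable_density ht).abs.aestronglyMeasurable.mul
      (hmeas.comp (measurable_const.sub measurable_id)).aestronglyMeasurable)
      (Eventually.of_forall fun y => ?_)
    rw [Real.norm_of_nonneg (mul_nonneg (abs_nonneg _) (hnn _))]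
    exact hle y
  have h2 := h.integral_comp_position ht hmeas hi
  refine ⟨h2.1, h2.2.trans_le ((integral_mono hi (hbi.const_mul A) hle).trans (le_of_eq ?_))⟩
  rw [integral_const_mul, integral_sub_left_eq_self
    (fun z => (Metric.ball (0 : Sp d) r).indicator radialKernel z), hb.2]

/-- Integrability over pairs of particles, from a uniform bound on the potential. -/
theorem integrable_pair (h : IsDispersing α p C₀ f₀ f) {t D : ℝ} {e : Sp d → ℝ}
    (he : Measurable e) (he0 : ∀ z, 0 ≤ e z)
    (hD : ∀ x, Integrable (fun z => e (x - position α f t z)) (particles α f) ∧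
      ∫ z, e (x - position α f t z) ∂(particles α f) ≤ D)
    {ω : Sp d × Sp d → ℝ} (hω : Continuous ω) (hω0 : ∀ z, 0 ≤ ω z)
    (hωi : Integrable ω (particles α f)) :
    Integrable (fun w : (Sp d × Sp d) × (Sp d × Sp d) =>
        ω w.1 * e (position α f t w.1 - position α f t w.2))
        ((particles α f).prod (particles α f)) ∧
      ∫ w : (Sp d × Sp d) × (Sp d × Sp d), ω w.1 * e (position α f t w.1 - position α f t w.2)
        ∂((particles α f).prod (particles α f)) ≤ D * ∫ z, ω z ∂(particles α f) := by
  have := h.isFiniteMeasure_particles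
  have hX := (h.continuous_position t).measurable
  have hm : Measurable fun w : (Sp d × Sp d) × (Sp d × Sp d) =>
      ω w.1 * e (position α f t w.1 - position α f t w.2) :=
    (hω.measurable.comp measurable_fst).mul
      (he.comp ((hX.comp measurable_fst).sub (hX.comp measurable_snd)))
  have hle : ∀ z, ∫ z', ω z * e (position α f t z - position α f t z') ∂(particles α f)
      ≤ D * ω z := fun z => by
    rw [integral_const_mul, mul_comm D]
    exact mul_le_mul_of_nonneg_left (hD (position α f t z)).2 (hω0 z)
  have hnn : ∀ z, 0 ≤ ∫ z', ω z * e (position α f t z - position α f t z') ∂(particles α f) :=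
    fun z => integral_nonneg fun z' => mul_nonneg (hω0 _) (he0 _)
  have hi2 : Integrable (fun z => ∫ z', ω z * e (position α f t z - position α f t z')
      ∂(particles α f)) (particles α f) := by
    refine (hωi.const_mul D).mono' ?_ (Eventually.of_forall fun z => ?_)
    · exact hm.aestronglyMeasurable.integral_prod_right'
    · rw [Real.norm_of_nonneg (hnn z)]; exact hle z
  have hi : Integrable (fun w : (Sp d × Sp d) × (Sp d × Sp d) =>
        ω w.1 * e (position α f t w.1 - position α f t w.2))
        ((particles α f).prod (particles α f)) := by
    refine (integrable_prod_iff hm.aestronglyMeasurable).2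
      ⟨Eventually.of_forall fun z => ((hD (position α f t z)).1.const_mul (ω z)), ?_⟩
    refine hi2.congr (Eventually.of_forall fun z => integral_congr_ae (Eventually.of_forall ?_))
    exact fun z' => (Real.norm_of_nonneg (mul_nonneg (hω0 _) (he0 _))).symm
  refine ⟨hi, ?_⟩
  rw [integral_prod _ hi, ← integral_const_mul]
  exact integral_mono hi2 (hωi.const_mul D) hle

/-- Bounds on the flow, locally uniform in time. -/
theorem exists_bound (h : IsDispersing α p C₀ f₀ f) (T : ℝ) :
    ∃ C : ℝ, 1 ≤ C ∧ ∀ t, |t| ≤ T → |t + α| ≤ C ∧ (∀ x, ‖efield f t x‖ ≤ C) ∧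
      ∀ z, ‖(phaseFlow α f 0 t z).1 - z.1‖ ≤ C ∧ ‖(phaseFlow α f t 0 z).1 - z.1‖ ≤ C ∧
        ‖(phaseFlow α f 0 t z).1‖ ≤ ‖z.1‖ + C := by
  obtain ⟨C₁, h1, hC₁⟩ := h.sol.isFlowField_efield.bdd T
  obtain ⟨C₂, h2, hC₂⟩ := h.isFlowField.bdd T
  refine ⟨1 + C₁ + C₂ * |T| + |T| + |α|, ?_, fun t ht => ⟨?_, fun x => ?_, fun z => ?_⟩⟩
  · have : 0 ≤ C₂ * |T| := by positivity
    linarith [abs_nonneg T, abs_nonneg α]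
  · have := abs_add_le t α
    have : 0 ≤ C₂ * |T| := by positivity
    linarith [le_abs_self T]
  · have : 0 ≤ C₂ * |T| := by positivity
    linarith [hC₁ t ht x, abs_nonneg T, abs_nonneg α]
  · have h0 : |(0 : ℝ)| ≤ T := by simpa using (abs_nonneg t).trans ht
    have e1 : ‖(phaseFlow α f 0 t z).1 - z.1‖ ≤ 1 + C₁ + C₂ * |T| + |T| + |α| := by
      have := (norm_fst_le (phaseFlow α f 0 t z - z)).trans
        (h.isFlowField.norm_flow_sub_le hC₂ h0 ht z)
      have h3 : C₂ * |t - 0| ≤ C₂ * |T| := by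
        rw [sub_zero]; exact mul_le_mul_of_nonneg_left (ht.trans (le_abs_self T)) h2
      rw [Prod.fst_sub] at this
      linarith [abs_nonneg T, abs_nonneg α]
    have e2 : ‖(phaseFlow α f t 0 z).1 - z.1‖ ≤ 1 + C₁ + C₂ * |T| + |T| + |α| := by
      have := (norm_fst_le (phaseFlow α f t 0 z - z)).trans
        (h.isFlowField.norm_flow_sub_le hC₂ ht h0 z)
      have h3 : C₂ * |0 - t| ≤ C₂ * |T| := by
        rw [zero_sub, abs_neg]; exact mul_le_mul_of_nonneg_left (ht.trans (le_abs_self T)) h2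
      rw [Prod.fst_sub] at this
      linarith [abs_nonneg T, abs_nonneg α]
    refine ⟨e1, e2, ?_⟩
    have := norm_add_le z.1 ((phaseFlow α f 0 t z).1 - z.1)
    rw [add_sub_cancel] at this
    linarith

theorem hasDerivAt_fst (h : IsDispersing α p C₀ f₀ f) (t : ℝ) (z : Sp d × Sp d) :
    HasDerivAt (fun t => (phaseFlow α f 0 t z).1)
      (-((t + α) • efield f t (position α f t z))) t := by
  have h1 := h.isFlowField.hasDerivAt_flow 0 z t
  have h2 : HasDerivAt (fun t => (flow (phaseField α (efield f)) 0 t z).1)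
      (phaseField α (efield f) t (flow (phaseField α (efield f)) 0 t z)).1 t :=
    (ContinuousLinearMap.fst ℝ (Sp d) (Sp d)).hasFDerivAt.comp_hasDerivAt t h1
  exact h2

theorem hasDerivAt_snd (h : IsDispersing α p C₀ f₀ f) (t : ℝ) (z : Sp d × Sp d) :
    HasDerivAt (fun t => (phaseFlow α f 0 t z).2) (efield f t (position α f t z)) t := by
  have h1 := h.isFlowField.hasDerivAt_flow 0 z t
  have h2 : HasDerivAt (fun t => (flow (phaseField α (efield f)) 0 t z).2)
      (phaseField α (efield f) t (flow (phaseField α (efield f)) 0 t z)).2 t :=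
    (ContinuousLinearMap.snd ℝ (Sp d) (Sp d)).hasFDerivAt.comp_hasDerivAt t h1
  exact h2

theorem hasDerivAt_position (h : IsDispersing α p C₀ f₀ f) (t : ℝ) (z : Sp d × Sp d) :
    HasDerivAt (fun t => position α f t z) (phaseFlow α f 0 t z).2 t := by
  have := (h.hasDerivAt_fst t z).add (((hasDerivAt_id t).add_const α).smul (h.hasDerivAt_snd t z))
  refine this.congr_deriv ?_
  simp

theorem integrable_sq_norm (h : IsDispersing α p C₀ f₀ f) (C : ℝ) :
    Integrable (fun z => (‖z.1‖ + C) ^ 2) (particles α f) := by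
  have := h.isFiniteMeasure_particles
  have h1 : Integrable (fun z : Sp d × Sp d => ‖z.1‖ ^ 2) (particles α f) :=
    h.integrable_particles_iff.2 h.second_moment
  refine ((h1.const_mul 2).add (integrable_const (2 * C ^ 2))).mono' ?_ ?_
  · exact (by fun_prop : Continuous fun z : Sp d × Sp d => (‖z.1‖ + C) ^ 2).aestronglyMeasurable
  · refine Eventually.of_forall fun z => ?_
    rw [Real.norm_of_nonneg (sq_nonneg _)]
    simp only [Pi.add_apply]
    nlinarith [sq_nonneg (‖z.1‖ - C)]

theorem integrable_norm_add (h : IsDispersing α p C₀ f₀ f) (C : ℝ) :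
    Integrable (fun z => ‖z.1‖ + C) (particles α f) := by
  have := h.isFiniteMeasure_particles
  refine ((h.integrable_sq_norm C).add (integrable_const 1)).mono' ?_ ?_
  · exact (by fun_prop : Continuous fun z : Sp d × Sp d => ‖z.1‖ + C).aestronglyMeasurable
  · refine Eventually.of_forall fun z => ?_
    rw [Real.norm_eq_abs]
    simp only [Pi.add_apply]
    refine abs_le.2 ⟨?_, ?_⟩ <;> nlinarith [sq_nonneg (‖z.1‖ + C - 1), sq_nonneg (‖z.1‖ + C + 1)]

/-- The second moment of the particles in the sheared coordinates. -/
def secondMoment (α : ℝ) (f : ℝ → Sp d → Sp d → ℝ) (t : ℝ) : ℝ :=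
  ∫ z, ‖(phaseFlow α f 0 t z).1‖ ^ 2 ∂(particles α f)

theorem continuous_efield_position (h : IsDispersing α p C₀ f₀ f) (t : ℝ) :
    Continuous fun z => efield f t (position α f t z) :=
  h.sol.isFlowField_efield.cont.comp (continuous_const.prodMk (h.continuous_position t))

theorem integrable_secondMoment (h : IsDispersing α p C₀ f₀ f) (t : ℝ) :
    Integrable (fun z => ‖(phaseFlow α f 0 t z).1‖ ^ 2) (particles α f) := by
  obtain ⟨C, hC1, hC⟩ := h.exists_bound |t|
  have hc := h.continuous_phaseFlow 0 t
  refine (h.integrable_sq_norm C).mono' (by fun_prop) (Eventually.of_forall fun z => ?_)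
  rw [Real.norm_of_nonneg (sq_nonneg _)]
  exact pow_le_pow_left₀ (norm_nonneg _) ((hC t le_rfl).2.2 z).2.2 2

theorem hasDerivAt_secondMoment (h : IsDispersing α p C₀ f₀ f) (t : ℝ) :
    HasDerivAt (secondMoment α f) (∫ z, 2 * inner ℝ (phaseFlow α f 0 t z).1
      (-((t + α) • efield f t (position α f t z))) ∂(particles α f)) t := by
  obtain ⟨C, hC1, hC⟩ := h.exists_bound (|t| + 1)
  have hball : ∀ s ∈ Metric.ball t 1, |s| ≤ |t| + 1 := fun s hs => by
    have h1 : |s - t| < 1 := by simpa [Real.dist_eq] using hs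
    have := abs_add_le (s - t) t
    rw [sub_add_cancel] at this
    linarith
  have hcF := fun s => h.continuous_phaseFlow 0 s
  have hcE := h.continuous_efield_position t
  refine (hasDerivAt_integral_of_dominated_loc_of_deriv_le (μ := particles α f)
    (F := fun s z => ‖(phaseFlow α f 0 s z).1‖ ^ 2)
    (F' := fun s z => 2 * inner ℝ (phaseFlow α f 0 s z).1
      (-((s + α) • efield f s (position α f s z))))
    (bound := fun z => 2 * ((‖z.1‖ + C) * (C * C)))
    (Metric.ball_mem_nhds t one_pos) (Eventually.of_forall fun s => ?_)
    (h.integrable_secondMoment t) ?_ (Eventually.of_forall fun z s hs => ?_) ?_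
    (Eventually.of_forall fun z s hs => ?_)).2
  · have := hcF s
    exact (by fun_prop : Continuous fun z => ‖(phaseFlow α f 0 s z).1‖ ^ 2).aestronglyMeasurable
  · have := hcF t
    exact ((this.fst.inner (hcE.const_smul (t + α)).neg).const_mul 2).aestronglyMeasurable
  · obtain ⟨h1, h2, h3⟩ := hC s (hball s hs)
    rw [norm_mul, Real.norm_of_nonneg (by norm_num : (0 : ℝ) ≤ 2)]
    refine mul_le_mul_of_nonneg_left ((norm_inner_le_norm _ _).trans ?_) (by norm_num)
    rw [norm_neg, norm_smul, Real.norm_eq_abs]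
    exact mul_le_mul (h3 z).2.2 (mul_le_mul h1 (h2 _) (norm_nonneg _) (by linarith))
      (by positivity) (by positivity)
  · exact ((h.integrable_norm_add C).mul_const _).const_mul 2
  · exact (h.hasDerivAt_fst s z).norm_sq

end IsDispersing

end VlasovPoisson
end

/-! ### The regularized interaction energy of pairs of particles -/

noncomputable section

namespace VlasovPoisson

open scoped NNReal ENNReal

variable {d : ℕ}

namespace IsDispersing

variable {α p C₀ : ℝ} {f₀ : Sp d → Sp d → ℝ} {f : ℝ → Sp d → Sp d → ℝ}

/-- The distribution of pairs of particles. -/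
abbrev pairs (α : ℝ) (f : ℝ → Sp d → Sp d → ℝ) : Measure ((Sp d × Sp d) × (Sp d × Sp d)) :=
  (particles α f).prod (particles α f)

/-- The difference of the positions of a pair of particles. -/
def posDiff (α : ℝ) (f : ℝ → Sp d → Sp d → ℝ) (t : ℝ) (w : (Sp d × Sp d) × (Sp d × Sp d)) : Sp d :=
  position α f t w.1 - position α f t w.2

/-- The difference of the sheared positions of a pair of particles. -/
def shearDiff (α : ℝ) (f : ℝ → Sp d → Sp d → ℝ) (t : ℝ) (w : (Sp d × Sp d) × (Sp d × Sp d)) :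
    Sp d :=
  (phaseFlow α f 0 t w.1).1 - (phaseFlow α f 0 t w.2).1

/-- The regularized potential energy, scaled by `(t + α)²`. -/
def pairEnergy (α : ℝ) (f : ℝ → Sp d → Sp d → ℝ) (ε t : ℝ) : ℝ :=
  ∫ w, (t + α) ^ 2 * regPotential ε (posDiff α f t w) ∂(pairs α f)

/-- The time derivative of the integrand of `pairEnergy`. -/
def pairPower (α : ℝ) (f : ℝ → Sp d → Sp d → ℝ) (ε t : ℝ)
    (w : (Sp d × Sp d) × (Sp d × Sp d)) : ℝ :=
  (t + α) * (2 * regPotential ε (posDiff α f t w)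
    - inner ℝ (regKernel ε (posDiff α f t w)) (posDiff α f t w)
    + inner ℝ (regKernel ε (posDiff α f t w)) (shearDiff α f t w))

theorem continuous_posDiff (h : IsDispersing α p C₀ f₀ f) (t : ℝ) :
    Continuous (posDiff α f t) := by
  have := h.continuous_position t
  unfold posDiff; fun_prop

theorem continuous_shearDiff (h : IsDispersing α p C₀ f₀ f) (t : ℝ) :
    Continuous (shearDiff α f t) := by
  have := h.continuous_phaseFlow 0 t
  unfold shearDiff; fun_prop

theorem continuous_pairPower (h : IsDispersing α p C₀ f₀ f) {ε : ℝ} (hε : 0 < ε) (t : ℝ) :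
    Continuous (pairPower α f ε t) := by
  have h1 := (continuous_regPotential hε).comp (h.continuous_posDiff t)
  have h2 := (continuous_regKernel hε).comp (h.continuous_posDiff t)
  unfold pairPower
  exact continuous_const.mul (((continuous_const.mul h1).sub
    (h2.inner (h.continuous_posDiff t))).add (h2.inner (h.continuous_shearDiff t)))

theorem hasDerivAt_pair (h : IsDispersing α p C₀ f₀ f) {ε : ℝ} (hε : 0 < ε) (t : ℝ)
    (w : (Sp d × Sp d) × (Sp d × Sp d)) :
    HasDerivAt (fun s => (s + α) ^ 2 * regPotential ε (posDiff α f s w)) (pairPower α f ε t w) t := by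
  have h1 : HasDerivAt (fun s => posDiff α f s w)
      ((phaseFlow α f 0 t w.1).2 - (phaseFlow α f 0 t w.2).2) t :=
    (h.hasDerivAt_position t w.1).sub (h.hasDerivAt_position t w.2)
  have h2 := hasDerivAt_regPotential (by have := h.four_le; omega) hε h1
  have h3 := (((hasDerivAt_id t).add_const α).pow 2).mul h2
  refine h3.congr_deriv ?_
  -- Expressing the relative velocity by `τ (v - v') = (x - x') - (y - y')` splits the power into a
  -- virial term and a term that will cancel the work done on the second moment.
  have e : (t + α) • ((phaseFlow α f 0 t w.1).2 - (phaseFlow α f 0 t w.2).2)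
      = posDiff α f t w - shearDiff α f t w := by
    simp only [posDiff, shearDiff, position, smul_sub]; abel
  have e2 : (t + α) * inner ℝ (regKernel ε (posDiff α f t w))
        ((phaseFlow α f 0 t w.1).2 - (phaseFlow α f 0 t w.2).2)
      = inner ℝ (regKernel ε (posDiff α f t w)) (posDiff α f t w)
        - inner ℝ (regKernel ε (posDiff α f t w)) (shearDiff α f t w) := by
    rw [← real_inner_smul_right, e, inner_sub_right]
  simp only [pairPower, id, Pi.pow_apply]
  push_cast
  linear_combination (-(t + α)) * e2

theorem norm_shearDiff_le (w : (Sp d × Sp d) × (Sp d × Sp d)) (t : ℝ) :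
    ‖shearDiff α f t w‖ ≤ ‖(phaseFlow α f 0 t w.1).1‖ + ‖(phaseFlow α f 0 t w.2).1‖ :=
  norm_sub_le _ _

theorem integrable_pair_fst {F : Type*} [NormedAddCommGroup F] (h : IsDispersing α p C₀ f₀ f)
    {φ : Sp d × Sp d → F}
    (hφ : Integrable φ (particles α f)) : Integrable (fun w => φ w.1) (pairs α f) := by
  have := h.isFiniteMeasure_particles
  exact hφ.comp_fst _

theorem integrable_pair_snd {F : Type*} [NormedAddCommGroup F] (h : IsDispersing α p C₀ f₀ f)
    {φ : Sp d × Sp d → F}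
    (hφ : Integrable φ (particles α f)) : Integrable (fun w => φ w.2) (pairs α f) := by
  have := h.isFiniteMeasure_particles
  exact hφ.comp_snd _

theorem hasDerivAt_pairEnergy (h : IsDispersing α p C₀ f₀ f) {ε : ℝ} (hε : 0 < ε) (t : ℝ) :
    Integrable (pairPower α f ε t) (pairs α f) ∧
    HasDerivAt (pairEnergy α f ε) (∫ w, pairPower α f ε t w ∂(pairs α f)) t := by
  have := h.isFiniteMeasure_particles
  have hd := h.four_le
  obtain ⟨C, hC1, hC⟩ := h.exists_bound (|t| + 1)
  have hball : ∀ s ∈ Metric.ball t 1, |s| ≤ |t| + 1 := fun s hs => by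
    have h1 : |s - t| < 1 := by simpa [Real.dist_eq] using hs
    have := abs_add_le (s - t) t
    rw [sub_add_cancel] at this
    linarith
  set a := (sphereArea d)⁻¹ * (ε ^ (d - 2))⁻¹
  set b := (sphereArea d)⁻¹ * (ε ^ (d - 1))⁻¹
  have hb0 : 0 ≤ b := (norm_nonneg _).trans (norm_regKernel_le (by omega) hε (0 : Sp d))
  refine hasDerivAt_integral_of_dominated_loc_of_deriv_le (μ := pairs α f)
    (F := fun s w => (s + α) ^ 2 * regPotential ε (posDiff α f s w))
    (F' := fun s w => pairPower α f ε s w)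
    (bound := fun w => C * (2 * a + a + b * ((‖w.1.1‖ + C) + (‖w.2.1‖ + C))))
    (Metric.ball_mem_nhds t one_pos) (Eventually.of_forall fun s => ?_) ?_
    (h.continuous_pairPower hε t).aestronglyMeasurable (Eventually.of_forall fun w s hs => ?_) ?_
    (Eventually.of_forall fun w s _ => h.hasDerivAt_pair hε s w)
  · exact (continuous_const.mul
      ((continuous_regPotential hε).comp (h.continuous_posDiff s))).aestronglyMeasurable
  · refine (integrable_const ((t + α) ^ 2 * a)).mono' (continuous_const.mul
      ((continuous_regPotential hε).comp (h.continuous_posDiff t))).aestronglyMeasurable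
      (Eventually.of_forall fun w => ?_)
    rw [norm_mul, Real.norm_of_nonneg (sq_nonneg _)]
    exact mul_le_mul_of_nonneg_left (abs_regPotential_le (by omega) hε _) (sq_nonneg _)
  · obtain ⟨h1, h2, h3⟩ := hC s (hball s hs)
    rw [pairPower, norm_mul]
    refine mul_le_mul h1 ?_ (norm_nonneg _) (by linarith)
    have e1 := abs_regPotential_le (by omega) hε (posDiff α f s w)
    have e2 := abs_inner_regKernel_le (by omega) hε (posDiff α f s w)
    have e3 : |inner ℝ (regKernel ε (posDiff α f s w)) (shearDiff α f s w)|
        ≤ b * ((‖w.1.1‖ + C) + (‖w.2.1‖ + C)) := by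
      refine (abs_real_inner_le_norm _ _).trans ?_
      refine mul_le_mul (norm_regKernel_le (by omega) hε _) ?_ (norm_nonneg _) hb0
      exact (norm_shearDiff_le w s).trans (add_le_add (h3 _).2.2 (h3 _).2.2)
    rw [Real.norm_eq_abs]
    refine (abs_add_le _ _).trans (add_le_add ((abs_sub _ _).trans (add_le_add ?_ e2)) e3)
    rw [abs_mul, abs_of_pos (by norm_num : (0 : ℝ) < 2)]
    linarith
  · have i1 := h.integrable_pair_fst (h.integrable_norm_add C)
    have i2 := h.integrable_pair_snd (h.integrable_norm_add C)
    exact ((integrable_const _).add ((i1.add i2).const_mul b)).const_mul C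

/-- The bound does not involve `ε`, so it survives the removal of the regularization. -/
theorem integral_pairEnergy_one_le (h : IsDispersing α p C₀ f₀ f) {ε A t : ℝ} (hε : 0 < ε)
    (ht : 0 ≤ t) (hA : ∀ x, density (f t) x ≤ A) :
    pairEnergy α f ε t ≤ (t + α) ^ 2 * ((sphereArea d)⁻¹ *
      (mass α f + (A * sphereArea d + mass α f)) * mass α f) := by
  have := h.isFiniteMeasure_particles
  have hd := h.four_le
  have hκ : 0 < (sphereArea d)⁻¹ := inv_pos.2 (sphereArea_pos (by omega))
  have hD : ∀ x, Integrable (fun z => regPotential ε (x - position α f t z)) (particles α f) ∧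
      ∫ z, regPotential ε (x - position α f t z) ∂(particles α f)
        ≤ (sphereArea d)⁻¹ * (mass α f + (A * sphereArea d + mass α f)) := by
    intro x
    have hN := h.integral_radialKernel_position ht hA one_pos x
    have hle : ∀ᵐ z ∂(particles α f), regPotential ε (x - position α f t z)
        ≤ (sphereArea d)⁻¹ * (1 + radialKernel (x - position α f t z)) := by
      filter_upwards [h.ae_position_ne t x] with z hz
      exact regPotential_le (by omega) hε hz
    have hmaj := ((integrable_const (1 : ℝ)).add hN.1).const_mul (sphereArea d)⁻¹
    have hi : Integrable (fun z => regPotential ε (x - position α f t z)) (particles α f) := by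
      refine hmaj.mono' ((continuous_regPotential hε).comp
        (continuous_const.sub (h.continuous_position t))).aestronglyMeasurable ?_
      filter_upwards [hle] with z hz
      rwa [Real.norm_of_nonneg (regPotential_nonneg (by omega) _ _)]
    refine ⟨hi, (integral_mono_ae hi hmaj hle).trans ?_⟩
    rw [integral_const_mul, integral_add' (integrable_const _) hN.1, h.integral_particles_const]
    have := hN.2
    simp only [mul_one, one_pow, div_one] at this
    gcongr
    linarith
  have := (h.integrable_pair (continuous_regPotential hε).measurable
    (regPotential_nonneg (by omega) ε) hD (ω := fun _ => 1) continuous_const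
    (fun _ => zero_le_one) (integrable_const _)).2
  rw [h.integral_particles_const] at this
  simp only [one_mul] at this
  rw [pairEnergy, integral_const_mul]
  exact mul_le_mul_of_nonneg_left this (sq_nonneg _)

theorem integral_swap_pairs (h : IsDispersing α p C₀ f₀ f)
    (φ : (Sp d × Sp d) × (Sp d × Sp d) → ℝ) :
    ∫ w, φ w.swap ∂(pairs α f) = ∫ w, φ w ∂(pairs α f) := by
  have := h.isFiniteMeasure_particles
  exact integral_prod_swap φ

theorem integrable_swap_pairs (h : IsDispersing α p C₀ f₀ f)
    {φ : (Sp d × Sp d) × (Sp d × Sp d) → ℝ} (hφ : Integrable φ (pairs α f)) :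
    Integrable (fun w => φ w.swap) (pairs α f) := by
  have := h.isFiniteMeasure_particles
  exact hφ.swap

/-- The work of the electric field on the sheared positions, symmetrized over pairs. -/
theorem integral_inner_efield (h : IsDispersing α p C₀ f₀ f) {A t : ℝ}
    (ht : 0 ≤ t) (hA : ∀ x, density (f t) x ≤ A) :
    Integrable (fun w => inner ℝ (kernel (posDiff α f t w)) (shearDiff α f t w)) (pairs α f) ∧
    ∫ w, inner ℝ (kernel (posDiff α f t w)) (shearDiff α f t w) ∂(pairs α f)
      = 2 * ∫ z, inner ℝ (phaseFlow α f 0 t z).1 (efield f t (position α f t z))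
          ∂(particles α f) := by
  have := h.isFiniteMeasure_particles
  have hd := h.four_le
  have hκ : 0 < (sphereArea d)⁻¹ := inv_pos.2 (sphereArea_pos (by omega))
  obtain ⟨C, hC1, hC⟩ := h.exists_bound |t|
  have hcF := h.continuous_phaseFlow 0 t
  have hN := h.integral_radialKernel_position ht hA one_pos
  have hi0 := (h.integrable_pair measurable_radialKernel radialKernel_nonneg hN
    (ω := fun z => ‖z.1‖ + C) (by fun_prop) (fun z => by positivity) (h.integrable_norm_add C)).1
  set φ : (Sp d × Sp d) × (Sp d × Sp d) → ℝ := fun w =>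
    inner ℝ (kernel (posDiff α f t w)) (phaseFlow α f 0 t w.1).1 with hφ
  have hi : Integrable φ (pairs α f) := by
    refine (hi0.const_mul (sphereArea d)⁻¹).mono' ?_ (Eventually.of_forall fun w => ?_)
    · exact ((measurable_kernel.comp (h.continuous_posDiff t).measurable).inner
        (hcF.comp continuous_fst).fst.measurable).aestronglyMeasurable
    · refine (norm_inner_le_norm _ _).trans ?_
      rw [norm_kernel (by omega)]
      have h1 := (((hC t le_rfl).2.2 w.1).2.2)
      have h2 := radialKernel_nonneg (posDiff α f t w)
      calc _ ≤ (sphereArea d)⁻¹ * radialKernel (posDiff α f t w) * (‖w.1.1‖ + C) := by gcongr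
        _ = _ := by simp only [posDiff]; ring
  -- The kernel is odd, so exchanging the two particles turns the contribution of the second one
  -- into that of the first.
  have hsplit : ∀ w, inner ℝ (kernel (posDiff α f t w)) (shearDiff α f t w) = φ w + φ w.swap := by
    intro w
    have e : posDiff α f t w.swap = -posDiff α f t w := by simp [posDiff]
    simp only [hφ, e, kernel_neg, inner_neg_left, shearDiff, inner_sub_right, Prod.fst_swap]
    ring
  have hi' := h.integrable_swap_pairs hi
  simp only [hsplit]
  refine ⟨hi.add hi', ?_⟩
  rw [integral_add hi hi', h.integral_swap_pairs, ← two_mul, integral_prod _ hi]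
  congr 1
  refine integral_congr_ae (Eventually.of_forall fun z => ?_)
  have hk : Integrable (fun z' => kernel (position α f t z - position α f t z')) (particles α f) :=
    h.integrable_particles_iff.2 (h.efield_eq ht (position α f t z)).1
  simp only [hφ, posDiff]
  rw [h.efield_eq_particles ht]
  simp only [real_inner_comm (phaseFlow α f 0 t z).1]
  exact integral_inner hk _

end IsDispersing

end VlasovPoisson
end

/-! ### The energy inequality and the uniform bound on the second moment -/

noncomputable section

namespace VlasovPoisson

open scoped NNReal ENNReal

variable {d : ℕ}

namespace IsDispersing

variable {α p C₀ : ℝ} {f₀ : Sp d → Sp d → ℝ} {f : ℝ → Sp d → Sp d → ℝ}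

/-- A crude bound depending on `T`, needed only to make error terms finite. Times start at `1`,
which keeps `t + α` away from zero even when `α = 0`. -/
theorem exists_density_le (h : IsDispersing α p C₀ f₀ f) (T : ℝ) :
    ∃ A : ℝ, 0 ≤ A ∧ ∀ t, 1 ≤ t → t ≤ T → ∀ x, density (f t) x ≤ A := by
  obtain ⟨C, hC1, hC⟩ := h.exists_bound |T|
  have hα := h.alpha_nonneg
  have hw := weightIntegral_nonneg d p
  have h0 := h.const_nonneg
  refine ⟨C₀ * 2 ^ p * weightIntegral d p * C ^ d, by positivity, fun t ht1 htT x => ?_⟩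
  have htT' : |t| ≤ |T| := by rw [abs_of_nonneg (by linarith)]; exact htT.trans (le_abs_self T)
  refine (h.density_le (by linarith) (by linarith) hC1
    (fun z => ((hC t htT').2.2 z).2.1) x).trans ?_
  refine mul_le_mul_of_nonneg_left ?_ (by positivity)
  exact pow_le_pow_left₀ (by positivity) (div_le_self (by linarith) (by linarith)) _

/-- The error made by regularizing the interaction. -/
theorem deriv_energy_le (h : IsDispersing α p C₀ f₀ f) {A C t r : ℝ} (ht : 0 ≤ t)
    (hr : 0 < r) (hr1 : r ≤ 1) (hA : ∀ x, density (f t) x ≤ A)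
    (hC : ∀ z, ‖(phaseFlow α f 0 t z).1‖ ≤ ‖z.1‖ + C) (hC0 : 0 ≤ C) :
    ((∫ z, 2 * inner ℝ (phaseFlow α f 0 t z).1
      (-((t + α) • efield f t (position α f t z))) ∂(particles α f))
      + ∫ w, pairPower α f (r ^ 2) t w ∂(pairs α f)) ≤
    (t + α) * (sphereArea d)⁻¹ * ((A * sphereArea d + mass α f) * mass α f +
      2 * (A * sphereArea d + d * (A * sphereArea d + mass α f))
        * ∫ z, (‖z.1‖ + C) ∂(particles α f)) * r := by
  have := h.isFiniteMeasure_particles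
  have hd := h.four_le
  have hα := h.alpha_nonneg
  -- With regularization parameter `ε = r²` and splitting radius `r`, the relative error `d ε / r`
  -- is `d r`, so every error below is `O(r)`.
  have hε : 0 < r ^ 2 := by positivity
  have hκ0 := sphereArea_pos (d := d) (by omega)
  have hκ : 0 < (sphereArea d)⁻¹ := inv_pos.2 hκ0
  have hA0 : 0 ≤ A := (h.density_nonneg ht 0).trans (hA 0)
  have hm := h.mass_nonneg
  set B := A * sphereArea d + mass α f with hB
  have hB0 : 0 ≤ B := by positivity
  set m₁ := ∫ z, (‖z.1‖ + C) ∂(particles α f) with hm₁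
  have hm₁0 : 0 ≤ m₁ := integral_nonneg fun z => by positivity
  have hN : ∀ x, Integrable (fun z => radialKernel (x - position α f t z)) (particles α f) ∧
      ∫ z, radialKernel (x - position α f t z) ∂(particles α f) ≤ B := fun x => by
    simpa [hB] using h.integral_radialKernel_position ht hA one_pos x
  -- the two error kernels
  set e₁ : Sp d → ℝ := fun z => (sphereArea d)⁻¹ * ((r ^ 2) ^ 2 * (regNorm (r ^ 2) z ^ d)⁻¹)
  have he₁c : Continuous e₁ := continuous_const.mul (continuous_const.mul
    (((continuous_regNorm _).pow _).inv₀ fun z => (pow_pos (regNorm_pos hε z) _).ne'))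
  have he₁0 : ∀ z, 0 ≤ e₁ z := fun z => by
    have := regNorm_pos hε z
    positivity
  have he₁D : ∀ x, Integrable (fun z => e₁ (x - position α f t z)) (particles α f) ∧
      ∫ z, e₁ (x - position α f t z) ∂(particles α f) ≤ (sphereArea d)⁻¹ * (r ^ 2 * B) := by
    intro x
    have hle : ∀ᵐ z ∂(particles α f), e₁ (x - position α f t z)
        ≤ (sphereArea d)⁻¹ * (r ^ 2 * radialKernel (x - position α f t z)) := by
      filter_upwards [h.ae_position_ne t x] with z hz
      exact mul_le_mul_of_nonneg_left (sq_mul_inv_regNorm_le (by omega) hε hz) hκ.le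
    have hmaj := ((hN x).1.const_mul (r ^ 2)).const_mul (sphereArea d)⁻¹
    have hi : Integrable (fun z => e₁ (x - position α f t z)) (particles α f) := by
      refine hmaj.mono' (he₁c.comp
        (continuous_const.sub (h.continuous_position t))).aestronglyMeasurable ?_
      filter_upwards [hle] with z hz
      rwa [Real.norm_of_nonneg (he₁0 _)]
    refine ⟨hi, (integral_mono_ae hi hmaj hle).trans ?_⟩
    rw [integral_const_mul, integral_const_mul]
    have := (hN x).2
    gcongr
  set e₂ : Sp d → ℝ := fun z => (sphereArea d)⁻¹ *
      ((Metric.ball (0 : Sp d) r).indicator radialKernel z + d * r ^ 2 / r * radialKernel z)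
  have he₂m : Measurable e₂ := ((measurable_radialKernel.indicator measurableSet_ball).add
    (measurable_radialKernel.const_mul _)).const_mul _
  have he₂0 : ∀ z, 0 ≤ e₂ z := fun z => by
    have h1 : (0 : ℝ) ≤ (Metric.ball (0 : Sp d) r).indicator radialKernel z :=
      indicator_nonneg (fun z _ => radialKernel_nonneg z) _
    have h2 := radialKernel_nonneg z
    positivity
  have he₂D : ∀ x, Integrable (fun z => e₂ (x - position α f t z)) (particles α f) ∧
      ∫ z, e₂ (x - position α f t z) ∂(particles α f)
        ≤ (sphereArea d)⁻¹ * ((A * sphereArea d + d * B) * r) := by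
    intro x
    have h1 := h.integral_ball_radialKernel_position ht hA hr x
    have h2 := hN x
    refine ⟨(h1.1.add (h2.1.const_mul _)).const_mul _, ?_⟩
    rw [integral_const_mul, integral_add h1.1 (h2.1.const_mul _), integral_const_mul]
    refine mul_le_mul_of_nonneg_left ?_ hκ.le
    have e : d * r ^ 2 / r = d * r := by field_simp
    rw [e]
    have h3 := mul_le_mul_of_nonneg_left h2.2 (by positivity : 0 ≤ (d : ℝ) * r)
    nlinarith [h1.2]
  have p₁ := h.integrable_pair he₁c.measurable he₁0 he₁D (ω := fun _ => 1) continuous_const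
    (fun _ => zero_le_one) (integrable_const _)
  have p₂ := h.integrable_pair he₂m he₂0 he₂D (ω := fun z => ‖z.1‖ + C) (by fun_prop)
    (fun z => by positivity) (h.integrable_norm_add C)
  obtain ⟨Q₁, hQ₁⟩ : ∃ Q : (Sp d × Sp d) × (Sp d × Sp d) → ℝ,
    Q = fun w => 1 * e₁ (position α f t w.1 - position α f t w.2) := ⟨_, rfl⟩
  obtain ⟨Q₂, hQ₂⟩ : ∃ Q : (Sp d × Sp d) × (Sp d × Sp d) → ℝ,
    Q = fun w => (‖w.1.1‖ + C) * e₂ (position α f t w.1 - position α f t w.2) := ⟨_, rfl⟩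
  rw [← hQ₁] at p₁
  rw [← hQ₂] at p₂
  have p₃i := h.integrable_swap_pairs p₂.1
  have p₃ := h.integral_swap_pairs Q₂
  -- Evenness of the error kernel: exchanging the particles in `Q₂` changes only the weight, from
  -- the first to the second one.
  have he₂neg : ∀ z, e₂ (-z) = e₂ z := fun z => by
    simp [e₂, radialKernel, indicator]
  -- the derivative of the total energy
  obtain ⟨hki, hk⟩ := h.integral_inner_efield ht hA
  have hpi := (h.hasDerivAt_pairEnergy hε t).1
  -- After symmetrization, the derivative of the second moment is the negative of the exact-kernel
  -- version of the last term of `pairPower`. In the sum only the virial defect and the kernel error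
  -- remain.
  have hfirst : (∫ z, 2 * inner ℝ (phaseFlow α f 0 t z).1
      (-((t + α) • efield f t (position α f t z))) ∂(particles α f))
      = -∫ w, (t + α) * inner ℝ (kernel (posDiff α f t w)) (shearDiff α f t w) ∂(pairs α f) := by
    rw [integral_const_mul, integral_const_mul, hk]
    simp only [inner_neg_right, real_inner_smul_right]
    rw [integral_neg, integral_const_mul]
    ring
  rw [hfirst, neg_add_eq_sub, ← integral_sub hpi (hki.const_mul _)]
  have hmaj : Integrable (fun w => (t + α) * (Q₁ w + (Q₂ w + Q₂ w.swap))) (pairs α f) :=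
    (p₁.1.add (p₂.1.add p₃i)).const_mul (t + α)
  have p₂₃ : Integrable (fun w => Q₂ w + Q₂ w.swap) (pairs α f) := p₂.1.add p₃i
  have hpt : ∀ w, pairPower α f (r ^ 2) t w
      - (t + α) * inner ℝ (kernel (posDiff α f t w)) (shearDiff α f t w)
      ≤ (t + α) * (Q₁ w + (Q₂ w + Q₂ w.swap)) := by
    intro w
    rw [pairPower, ← mul_sub]
    refine mul_le_mul_of_nonneg_left ?_ (by linarith)
    have g1 := two_mul_regPotential_sub_le hd hε (posDiff α f t w)
    have g2 : inner ℝ (regKernel (r ^ 2) (posDiff α f t w)) (shearDiff α f t w)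
        - inner ℝ (kernel (posDiff α f t w)) (shearDiff α f t w)
        ≤ e₂ (posDiff α f t w) * ((‖w.1.1‖ + C) + (‖w.2.1‖ + C)) := by
      rw [← inner_sub_left]
      refine (real_inner_le_norm _ _).trans ?_
      refine mul_le_mul (norm_regKernel_sub_kernel_le (by omega) hε hr _) ?_ (norm_nonneg _)
        (he₂0 _)
      exact (norm_shearDiff_le w t).trans (add_le_add (hC _) (hC _))
    have g3 : Q₂ w.swap = (‖w.2.1‖ + C) * e₂ (posDiff α f t w) := by
      rw [← he₂neg, hQ₂]; simp [posDiff]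
    have g4 : Q₂ w = (‖w.1.1‖ + C) * e₂ (posDiff α f t w) := by rw [hQ₂]; rfl
    have g6 : Q₁ w = e₁ (posDiff α f t w) := by rw [hQ₁]; simp [posDiff]
    rw [g3, g4, g6]
    have g5 : e₁ (posDiff α f t w)
      = (sphereArea d)⁻¹ * ((r ^ 2) ^ 2 * (regNorm (r ^ 2) (posDiff α f t w) ^ d)⁻¹) := rfl
    linarith
  refine (integral_mono (hpi.sub (hki.const_mul _)) hmaj hpt).trans ?_
  · have e : ∫ w, (t + α) * (Q₁ w + (Q₂ w + Q₂ w.swap)) ∂(pairs α f)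
        ≤ (t + α) * ((sphereArea d)⁻¹ * (r ^ 2 * B) * mass α f
          + ((sphereArea d)⁻¹ * ((A * sphereArea d + d * B) * r) * m₁
            + (sphereArea d)⁻¹ * ((A * sphereArea d + d * B) * r) * m₁)) := by
      rw [integral_const_mul, integral_add p₁.1 p₂₃,
        integral_add p₂.1 p₃i, p₃]
      refine mul_le_mul_of_nonneg_left ?_ (by linarith)
      have q1 := p₁.2
      rw [h.integral_particles_const, one_mul] at q1
      exact add_le_add q1 (add_le_add p₂.2 p₂.2)
    refine le_trans e ?_
    have hr2 : r ^ 2 ≤ r := by nlinarith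
    have : (sphereArea d)⁻¹ * (r ^ 2 * B) * mass α f ≤ (sphereArea d)⁻¹ * (r * B) * mass α f := by
      gcongr
    calc _ ≤ (t + α) * ((sphereArea d)⁻¹ * (r * B) * mass α f
          + ((sphereArea d)⁻¹ * ((A * sphereArea d + d * B) * r) * m₁
            + (sphereArea d)⁻¹ * ((A * sphereArea d + d * B) * r) * m₁)) := by
          have : 0 ≤ t + α := by linarith
          gcongr
      _ = _ := by ring

/-- Second moment plus pair energy grows at rate at most `D r` on `[1, T]`. The constant `D` depends
on `T`, but with `T` fixed and `r` tending to zero only the value at time `1` is left, and its bound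
`M` depends on neither. The pair energy at time `T` is dropped since the interaction is repulsive.
-/
theorem exists_secondMoment_le (h : IsDispersing α p C₀ f₀ f) :
    ∃ M : ℝ, 0 ≤ M ∧ ∀ t, 1 ≤ t → secondMoment α f t ≤ M := by
  have := h.isFiniteMeasure_particles
  have hd := h.four_le
  have hα := h.alpha_nonneg
  have hκ0 := sphereArea_pos (d := d) (by omega)
  have hm := h.mass_nonneg
  obtain ⟨A₁, hA₁0, hA₁⟩ := h.exists_density_le 1
  set M := secondMoment α f 1 + (1 + α) ^ 2 * ((sphereArea d)⁻¹ *
      (mass α f + (A₁ * sphereArea d + mass α f)) * mass α f) with hM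
  refine ⟨|M|, abs_nonneg _, fun T hT => le_trans ?_ (le_abs_self M)⟩
  obtain ⟨A, hA0, hA⟩ := h.exists_density_le T
  obtain ⟨C, hC1, hC⟩ := h.exists_bound T
  set D := (T + α) * (sphereArea d)⁻¹ * ((A * sphereArea d + mass α f) * mass α f +
      2 * (A * sphereArea d + d * (A * sphereArea d + mass α f))
        * ∫ z, (‖z.1‖ + C) ∂(particles α f)) with hD
  have hm₁0 : 0 ≤ ∫ z, (‖z.1‖ + C) ∂(particles α f) := integral_nonneg fun z => by positivity
  have key : ∀ r : ℝ, 0 < r → r ≤ 1 → secondMoment α f T ≤ M + D * r * (T - 1) := by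
    intro r hr hr1
    have hε : 0 < r ^ 2 := by positivity
    set Ψ : ℝ → ℝ := fun s => secondMoment α f s + pairEnergy α f (r ^ 2) s
    have hder : ∀ s, HasDerivAt Ψ _ s := fun s =>
      (h.hasDerivAt_secondMoment s).add (h.hasDerivAt_pairEnergy hε s).2
    have := (convex_Icc 1 T).image_sub_le_mul_sub_of_deriv_le (f := Ψ) (C := D * r)
      (fun s _ => (hder s).continuousAt.continuousWithinAt)
      (fun s _ => (hder s).differentiableAt.differentiableWithinAt) (fun s hs => ?_) 1
      (left_mem_Icc.2 hT) T (right_mem_Icc.2 hT) hT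
    · have h1 : 0 ≤ pairEnergy α f (r ^ 2) T := integral_nonneg fun w =>
        mul_nonneg (sq_nonneg _) (regPotential_nonneg (by omega) _ _)
      have h2 := h.integral_pairEnergy_one_le hε zero_le_one (fun x => hA₁ 1 le_rfl le_rfl x)
      simp only [Ψ] at this
      linarith
    · rw [interior_Icc] at hs
      rw [(hder s).deriv]
      have hs' : |s| ≤ T := by rw [abs_of_pos (by linarith [hs.1])]; exact hs.2.le
      refine (h.deriv_energy_le (A := A) (C := C) (by linarith [hs.1]) hr hr1
        (hA s hs.1.le hs.2.le) (fun z => ((hC s hs').2.2 z).2.2) (by linarith)).trans ?_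
      rw [hD]
      have : s + α ≤ T + α := by linarith [hs.2]
      have hs0 : 0 ≤ s + α := by linarith [hs.1]
      gcongr
  have hlim : Tendsto (fun r : ℝ => M + D * r * (T - 1)) (𝓝[>] 0) (𝓝 (M + D * 0 * (T - 1))) := by
    have : Continuous fun r : ℝ => M + D * r * (T - 1) := by fun_prop
    exact (this.tendsto 0).mono_left nhdsWithin_le_nhds
  rw [mul_zero, zero_mul, add_zero] at hlim
  refine ge_of_tendsto hlim ?_
  filter_upwards [Ioc_mem_nhdsGT (zero_lt_one (α := ℝ))] with r hr using key r hr.1 hr.2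

theorem integral_sheared_sq (h : IsDispersing α p C₀ f₀ f) {t : ℝ} (ht : 0 ≤ t) :
    Integrable (fun z => sheared α f t z * ‖z.1‖ ^ 2) ∧
      ∫ z, sheared α f t z * ‖z.1‖ ^ 2 = secondMoment α f t := by
  have hφ : AEStronglyMeasurable (fun z : Sp d × Sp d => ‖z.1‖ ^ 2) :=
    (by fun_prop : Continuous fun z : Sp d × Sp d => ‖z.1‖ ^ 2).aestronglyMeasurable
  refine ⟨(h.integrable_sheared_smul_iff ht hφ).1
    (h.integrable_particles_iff.1 (h.integrable_secondMoment t)), ?_⟩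
  rw [secondMoment, h.integral_particles]
  exact (h.integral_sheared_smul ht hφ).symm

end IsDispersing

end VlasovPoisson
end

noncomputable section

namespace VlasovPoisson

open scoped NNReal ENNReal

variable {d : ℕ}

namespace IsDispersing

variable {α p C₀ : ℝ} {f₀ : Sp d → Sp d → ℝ} {f : ℝ → Sp d → Sp d → ℝ}

/-! ### Decay of the field -/

theorem volume_ball_scaled {τ A : ℝ} (hτ : 0 < τ) (hA : 0 < A) (x : Sp d) :
    volume.real {v : Sp d | ‖x - τ • v‖ < A} = unitBallVolume d * (A / τ) ^ d := by
  have e : {v : Sp d | ‖x - τ • v‖ < A} = Metric.ball (τ⁻¹ • x) (A / τ) := by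
    ext v
    have : x - τ • v = τ • (τ⁻¹ • x - v) := by
      rw [smul_sub, smul_smul, mul_inv_cancel₀ hτ.ne', one_smul]
    rw [mem_ofPred_eq, this, norm_smul, Real.norm_of_nonneg hτ.le, Metric.mem_ball, dist_comm,
      dist_eq_norm, lt_div_iff₀ hτ, mul_comm]
  rw [e, Measure.real, Measure.addHaar_ball_of_pos _ _ (by positivity), ENNReal.toReal_mul,
    ENNReal.toReal_ofReal (by positivity), finrank_euclideanSpace_fin, mul_comm]
  rfl

/-- The density of the second moment in the sheared coordinates. -/
def momentDensity (α : ℝ) (f : ℝ → Sp d → Sp d → ℝ) (t : ℝ) (x : Sp d) : ℝ :=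
  ∫ v, f t x v * ‖x - (t + α) • v‖ ^ 2

theorem integrable_moment (h : IsDispersing α p C₀ f₀ f) {t : ℝ} (ht : 0 ≤ t) :
    Integrable (fun z : Sp d × Sp d => f t z.1 z.2 * ‖z.1 - (t + α) • z.2‖ ^ 2) ∧
    ∫ z : Sp d × Sp d, f t z.1 z.2 * ‖z.1 - (t + α) • z.2‖ ^ 2 = secondMoment α f t := by
  have hc : Continuous fun z : Sp d × Sp d => f t z.1 z.2 * ‖z.1 - (t + α) • z.2‖ ^ 2 :=
    (h.sol.contDiff_slice ht).continuous.mul (by fun_prop)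
  have h1 := h.integral_sheared_sq ht
  have e : (fun z : Sp d × Sp d => sheared α f t z * ‖z.1‖ ^ 2) = fun z : Sp d × Sp d =>
      (fun z : Sp d × Sp d => f t z.1 z.2 * ‖z.1 - (t + α) • z.2‖ ^ 2)
        (z.1 + (t + α) • z.2, z.2) := by
    ext z; simp [sheared]
  rw [e] at h1
  rw [integrable_shear_iff (ψ := fun z : Sp d × Sp d => f t z.1 z.2 * ‖z.1 - (t + α) • z.2‖ ^ 2)
    (t + α) hc.aestronglyMeasurable, integral_shear
    (ψ := fun z : Sp d × Sp d => f t z.1 z.2 * ‖z.1 - (t + α) • z.2‖ ^ 2)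
    (t + α) hc.aestronglyMeasurable] at h1
  exact h1

theorem integral_momentDensity (h : IsDispersing α p C₀ f₀ f) {t : ℝ} (ht : 0 ≤ t) :
    Integrable (momentDensity α f t) ∧ ∫ x, momentDensity α f t x = secondMoment α f t := by
  obtain ⟨h1, h2⟩ := h.integrable_moment ht
  refine ⟨h1.integral_prod_left, ?_⟩
  rw [← h2]
  exact (integral_prod _ h1).symm

theorem momentDensity_nonneg (h : IsDispersing α p C₀ f₀ f) {t : ℝ} (ht : 0 ≤ t) (x : Sp d) :
    0 ≤ momentDensity α f t x :=
  integral_nonneg fun v => mul_nonneg (h.f_nonneg ht x v) (sq_nonneg _)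

/-- Chebyshev in velocity space: where `|x - τ v| < A` use the sup bound of `f` and the volume of a
ball, elsewhere use the moment. The null set does not depend on `A`, so `A` may later be chosen as a
function of the point. -/
theorem ae_density_le (h : IsDispersing α p C₀ f₀ f) {t : ℝ} (ht : 0 ≤ t) (hτ : 0 < t + α) :
    ∀ᵐ x, ∀ A : ℝ, 0 < A → density (f t) x
      ≤ C₀ * unitBallVolume d * (A / (t + α)) ^ d + momentDensity α f t x / A ^ 2 := by
  have hi := (h.integrable_moment ht).1.prod_right_ae
  filter_upwards [hi] with x hx A hA
  set s : Set (Sp d) := {v : Sp d | ‖x - (t + α) • v‖ < A} with hs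
  have hsm : MeasurableSet s := measurableSet_lt (by fun_prop) measurable_const
  have hvol := volume_ball_scaled (d := d) hτ hA x
  have hfin : volume s ≠ ⊤ := by
    intro htop
    rw [Measure.real, htop, ENNReal.toReal_top] at hvol
    have : 0 < unitBallVolume d * (A / (t + α)) ^ d := by
      have := unitBallVolume_pos d
      positivity
    linarith
  have hind : Integrable (s.indicator fun _ => C₀) :=
    (integrable_indicator_iff hsm).2 (integrableOn_const hfin)
  calc density (f t) x ≤ ∫ v, (s.indicator (fun _ => C₀) v
        + f t x v * ‖x - (t + α) • v‖ ^ 2 / A ^ 2) := by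
        refine integral_mono (h.sol.density_exists t ht x) (hind.add (hx.div_const _)) fun v => ?_
        have hf0 := h.f_nonneg ht x v
        by_cases hv : v ∈ s
        · rw [indicator_of_mem hv]
          have h1 : f t x v ≤ C₀ := by rw [f_eq_sheared α t f]; exact h.sheared_le_const ht _
          have : 0 ≤ f t x v * ‖x - (t + α) • v‖ ^ 2 / A ^ 2 := by positivity
          linarith
        · rw [indicator_of_notMem hv, zero_add, le_div_iff₀ (by positivity)]
          have : A ≤ ‖x - (t + α) • v‖ := by simpa [hs] using hv
          gcongr
    _ = _ := by
        rw [integral_add hind (hx.div_const _), integral_div, integral_indicator hsm,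
          setIntegral_const, hvol, momentDensity, smul_eq_mul]
        ring

theorem norm_efield_le_integral (h : IsDispersing α p C₀ f₀ f) {t : ℝ} (ht : 0 ≤ t) (x : Sp d) :
    ‖efield f t x‖ ≤ (sphereArea d)⁻¹ * ∫ y, density (f t) y * radialKernel (x - y) := by
  rw [efield_of_nonneg f ht, field, gradInvLaplacian, ← integral_const_mul]
  refine (norm_integral_le_integral_norm _).trans (le_of_eq ?_)
  refine integral_congr_ae (Eventually.of_forall fun y => ?_)
  simp only [norm_smul, Real.norm_of_nonneg (h.density_nonneg ht y)]
  rw [norm_kernel (by have := h.four_le; omega)]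
  ring

/-- The field is controlled by the second moment and the displacement `R`. -/
theorem norm_efield_le (h : IsDispersing α p C₀ f₀ f) : ∃ K : ℝ, 0 ≤ K ∧ ∀ t R : ℝ, 1 ≤ t →
    1 ≤ R → (∀ z, ‖(phaseFlow α f t 0 z).1 - z.1‖ ≤ R) → ∀ x,
      ‖efield f t x‖ ≤ K * ((t + α) ^ (1 - (d : ℝ)) * R ^ ((d : ℝ) - 1 - 2 / d)) := by
  have hd := h.four_le
  have hα := h.alpha_nonneg
  have hκ0 := sphereArea_pos (d := d) (by omega)
  have hω := unitBallVolume_pos d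
  have hC₀ := h.const_nonneg
  obtain ⟨M, hM0, hM⟩ := h.exists_secondMoment_le
  set D : ℝ := (d : ℝ) with hD
  have hD4 : 4 ≤ D := by rw [hD]; exact_mod_cast hd
  -- The power of the distance in `A^d` times the radial kernel for the `A` chosen below; it exceeds
  -- `d`, so it is integrable at infinity.
  set s : ℝ := (D - 1) * (D / 2 + 1) with hs
  have hsD : s - D = (D ^ 2 - D - 2) / 2 := by rw [hs]; ring
  have hsD0 : 0 < s - D := by rw [hsD]; nlinarith
  set K₁ := C₀ * 2 ^ p * weightIntegral d p
  have hK₁ : 0 ≤ K₁ := by have := weightIntegral_nonneg d p; positivity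
  refine ⟨(sphereArea d)⁻¹ * (K₁ * sphereArea d
    + C₀ * unitBallVolume d * (sphereArea d / (s - D)) + M), by positivity, ?_⟩
  intro t R ht1 hR hz x
  have ht : 0 ≤ t := by linarith
  set τ := t + α with hτ
  have hτ0 : 0 < τ := by linarith
  have hR0 : 0 < R := by linarith
  -- The target size of the field. The radius `r` is chosen so that the inner part `(R/τ)^d r`
  -- equals `S`; the outer part then also scales like `S`.
  set S := τ ^ (1 - D) * R ^ (D - 1 - 2 / D) with hS
  have hS0 : 0 < S := by positivity
  set r := τ * R ^ (-1 - 2 / D) with hr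
  have hr0 : 0 < r := by positivity
  have hρ := h.density_le ht hτ0 hR hz
  have hb := integral_radialKernel_ball (d := d) (by omega) hr0.le
  have hb1 := hb.1.comp_sub_left x
  have hb2 : ∫ y, (Metric.ball (0 : Sp d) r).indicator radialKernel (x - y) = sphereArea d * r := by
    rw [integral_sub_left_eq_self
      (fun z => (Metric.ball (0 : Sp d) r).indicator radialKernel z), hb.2]
  have hf := integral_rpow_compl_ball (d := d) (by omega) hr0 (s := s) (by linarith)
  have hf1 := hf.1.comp_sub_left x
  have hf2 : ∫ y, (Ici r).indicator (fun y : ℝ => y ^ (-s)) ‖x - y‖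
      = sphereArea d * (r ^ (D - s) / (s - D)) := by
    rw [integral_sub_left_eq_self
      (fun z : Sp d => (Ici r).indicator (fun y : ℝ => y ^ (-s)) ‖z‖), hf.2]
  obtain ⟨hm1, hm2⟩ := h.integral_momentDensity ht
  set P := C₀ * unitBallVolume d * (τ ^ (-D) * S ^ (-(D / 2))) with hP
  have hP0 : 0 ≤ P := by positivity
  have hpt : ∀ᵐ y, density (f t) y * radialKernel (x - y)
      ≤ K₁ * (R / τ) ^ d * (Metric.ball (0 : Sp d) r).indicator radialKernel (x - y)
        + (P * (Ici r).indicator (fun y : ℝ => y ^ (-s)) ‖x - y‖ + S * momentDensity α f t y) := by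
    filter_upwards [h.ae_density_le ht hτ0] with y hy
    have hN := radialKernel_nonneg (x - y)
    have hm := h.momentDensity_nonneg ht y
    by_cases hyr : x - y ∈ Metric.ball (0 : Sp d) r
    · have hlt : ¬ r ≤ ‖x - y‖ := by simpa using hyr
      rw [indicator_of_mem hyr]
      simp only [indicator, mem_Ici, hlt, if_false, mul_zero, zero_add]
      have := mul_le_mul_of_nonneg_right (hρ y) hN
      have h2 : 0 ≤ S * momentDensity α f t y := by positivity
      linarith
    · have hle : r ≤ ‖x - y‖ := by simpa using hyr
      have hn0 : 0 < ‖x - y‖ := hr0.trans_le hle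
      rw [indicator_of_notMem hyr, mul_zero, zero_add]
      simp only [indicator, mem_Ici, hle, if_true]
      have hNe : radialKernel (x - y) = ‖x - y‖ ^ (-(D - 1)) := by
        rw [radialKernel, Real.rpow_neg hn0.le, hD, ← Nat.cast_pred (by omega), Real.rpow_natCast]
      have hNpos : 0 < radialKernel (x - y) := by rw [hNe]; positivity
      -- The cutoff depends on the distance: `A² = radialKernel / S` makes the moment term equal to
      -- `S` times the moment density, whose integral is bounded uniformly in time.
      set A := (S⁻¹ * radialKernel (x - y)) ^ (1 / 2 : ℝ) with hA
      have hbase : 0 < S⁻¹ * radialKernel (x - y) := by positivity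
      have hA0 : 0 < A := by positivity
      have hA2 : A ^ 2 = S⁻¹ * radialKernel (x - y) := by
        rw [hA, ← Real.rpow_natCast, ← Real.rpow_mul hbase.le]; norm_num
      have hAd : A ^ d * radialKernel (x - y) = S ^ (-(D / 2)) * ‖x - y‖ ^ (-s) := by
        rw [hA, ← Real.rpow_natCast, ← Real.rpow_mul hbase.le, Real.mul_rpow (by positivity) hN,
          Real.inv_rpow hS0.le, ← Real.rpow_neg hS0.le, hNe, ← Real.rpow_mul hn0.le, mul_assoc,
          ← Real.rpow_add hn0, ← hD]
        congr 2
        · ring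
        · rw [hs]; ring
      have h1 := mul_le_mul_of_nonneg_right (hy A hA0) hN
      refine h1.trans (le_of_eq ?_)
      rw [add_mul, div_pow, hA2, hP, Real.rpow_neg hτ0.le, hD, Real.rpow_natCast]
      have e1 : C₀ * unitBallVolume d * (A ^ d / τ ^ d) * radialKernel (x - y)
        = C₀ * unitBallVolume d * (τ ^ d)⁻¹ * (A ^ d * radialKernel (x - y)) := by ring
      rw [e1, hAd, ← hD]
      congr 1
      · ring
      · field_simp
  have hmaj := (hb1.const_mul (K₁ * (R / τ) ^ d)).add
    ((hf1.const_mul P).add (hm1.const_mul S))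
  have hint : Integrable fun y => density (f t) y * radialKernel (x - y) := by
    refine hmaj.mono' ((h.integrable_density ht).aestronglyMeasurable.mul
      (measurable_radialKernel.comp (measurable_const.sub measurable_id)).aestronglyMeasurable) ?_
    filter_upwards [hpt] with y hy
    rw [Real.norm_of_nonneg (mul_nonneg (h.density_nonneg ht y) (radialKernel_nonneg _))]
    exact hy
  have hI := integral_mono_ae hint hmaj hpt
  rw [integral_add' (hb1.const_mul _) ((hf1.const_mul P).add (hm1.const_mul S)),
    integral_add' (hf1.const_mul P) (hm1.const_mul S), integral_const_mul, integral_const_mul,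
    integral_const_mul, hb2, hf2, hm2] at hI
  have e1 : (R / τ) ^ d * r = S := by
    rw [hr, hS, div_pow, ← Real.rpow_natCast R, ← Real.rpow_natCast τ, ← hD]
    have : τ ^ (1 - D) = τ / τ ^ D := by rw [Real.rpow_sub hτ0, Real.rpow_one]
    rw [this, show D - 1 - 2 / D = D + (-1 - 2 / D) by ring, Real.rpow_add hR0]
    field_simp
  -- The far part at radius `r` scales exactly like `S`; the powers of `τ` and of `R` are compared
  -- separately.
  have e2 : τ ^ (-D) * S ^ (-(D / 2)) * r ^ (D - s) = S := by
    have hDs : D - s = -((D ^ 2 - D - 2) / 2) := by linarith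
    rw [hDs, hr, hS, Real.mul_rpow (by positivity) (by positivity),
      Real.mul_rpow hτ0.le (by positivity), ← Real.rpow_mul hτ0.le, ← Real.rpow_mul hR0.le,
      ← Real.rpow_mul hR0.le]
    calc _ = (τ ^ (-D) * τ ^ ((1 - D) * -(D / 2)) * τ ^ (-((D ^ 2 - D - 2) / 2)))
          * (R ^ ((D - 1 - 2 / D) * -(D / 2)) * R ^ ((-1 - 2 / D) * -((D ^ 2 - D - 2) / 2))) := by
          ring
      _ = _ := by
          rw [← Real.rpow_add hτ0, ← Real.rpow_add hτ0, ← Real.rpow_add hR0]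
          congr 2
          · ring
          · field_simp; ring
  have hE := h.norm_efield_le_integral ht x
  refine hE.trans ?_
  rw [mul_assoc (sphereArea d)⁻¹]
  refine mul_le_mul_of_nonneg_left (hI.trans ?_) (inv_pos.2 hκ0).le
  have g1 : K₁ * (R / τ) ^ d * (sphereArea d * r) = K₁ * sphereArea d * S := by rw [← e1]; ring
  have g2 : P * (sphereArea d * (r ^ (D - s) / (s - D)))
      = C₀ * unitBallVolume d * (sphereArea d / (s - D)) * S := by
    rw [hP]
    calc _ = C₀ * unitBallVolume d * (sphereArea d / (s - D))
        * (τ ^ (-D) * S ^ (-(D / 2)) * r ^ (D - s)) := by ring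
      _ = _ := by rw [e2]
  rw [g1, g2]
  have g3 := mul_le_mul_of_nonneg_left (hM t ht1) hS0.le
  linarith

end IsDispersing

end VlasovPoisson
end

/-! ### Bootstrap of the decay exponent of the field -/

noncomputable section

namespace VlasovPoisson

open scoped NNReal ENNReal

variable {d : ℕ}

/-- The field is of order `t ^ (-b)` for large times. -/
def HasFieldDecay (f : ℝ → Sp d → Sp d → ℝ) (b : ℝ) : Prop :=
  ∃ K : ℝ, 0 ≤ K ∧ ∀ t : ℝ, 1 ≤ t → ∀ x, ‖efield f t x‖ ≤ K * t ^ (-b)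

theorem HasFieldDecay.mono {f : ℝ → Sp d → Sp d → ℝ} {b b' : ℝ} (h : HasFieldDecay f b)
    (hb : b' ≤ b) : HasFieldDecay f b' := by
  obtain ⟨K, hK, H⟩ := h
  refine ⟨K, hK, fun t ht x => (H t ht x).trans ?_⟩
  gcongr

theorem norm_sub_le_of_deriv_le_rpow {F : Type*} [NormedAddCommGroup F] [NormedSpace ℝ F]
    {u u' : ℝ → F} {L q t : ℝ} (hq : q ≠ 0) (hu : ∀ s, HasDerivAt u (u' s) s) (ht : 1 ≤ t)
    (hb : ∀ s, 1 ≤ s → ‖u' s‖ ≤ L * s ^ (q - 1)) : ‖u t - u 1‖ ≤ L * ((t ^ q - 1) / q) := by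
  refine image_norm_le_of_norm_deriv_right_le_deriv_boundary' (f := fun s => u s - u 1) (f' := u')
    (a := 1) (b := t) (B := fun s => L * ((s ^ q - 1) / q)) (B' := fun s => L * s ^ (q - 1))
    (fun s _ => ((hu s).sub_const _).continuousAt.continuousWithinAt)
    (fun s _ => ((hu s).sub_const _).hasDerivWithinAt) (by simp) ?_ ?_
    (fun s hs => hb s hs.1) ⟨ht, le_rfl⟩
  · intro s hs
    have hs0 : s ≠ 0 := by linarith [hs.1]
    have := (Real.continuousAt_rpow_const s q (Or.inl hs0))
    exact (continuousAt_const.mul ((this.sub_const 1).div_const q)).continuousWithinAt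
  · intro s hs
    have hs0 : s ≠ 0 := by linarith [hs.1]
    have h1 := (((Real.hasDerivAt_rpow_const (p := q) (Or.inl hs0)).sub_const 1).div_const q).const_mul L
    refine (h1.congr_deriv ?_).hasDerivWithinAt
    field_simp

namespace IsDispersing

variable {α p C₀ : ℝ} {f₀ : Sp d → Sp d → ℝ} {f : ℝ → Sp d → Sp d → ℝ}

/-- Integrates `τ |E| ≲ s^(1-b)` along the characteristic ending at `z`. On `[0, 1]`, where no decay
is available, a local bound is used. The integral is a power of `t` rather than a logarithm because
`b ≠ 2`. -/
theorem norm_displacement_le (h : IsDispersing α p C₀ f₀ f) {b : ℝ} (hb : b ≠ 2)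
    (hE : HasFieldDecay f b) : ∃ C L : ℝ, 1 ≤ C ∧ 0 ≤ L ∧ ∀ t, 1 ≤ t → ∀ z,
      ‖(phaseFlow α f t 0 z).1 - z.1‖ ≤ C + L * ((t ^ (2 - b) - 1) / (2 - b)) := by
  obtain ⟨C, hC1, hC⟩ := h.exists_bound 1
  obtain ⟨K, hK, H⟩ := hE
  have hα := h.alpha_nonneg
  refine ⟨C, (1 + α) * K, hC1, by positivity, fun t ht z => ?_⟩
  set w := phaseFlow α f t 0 z with hw
  have hz : phaseFlow α f 0 t w = z := h.isFlowField.flow_flow_cancel t 0 z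
  have h1 := norm_sub_le_of_deriv_le_rpow (q := 2 - b) (L := (1 + α) * K)
    (sub_ne_zero.2 hb.symm) (fun s => h.hasDerivAt_fst s w) ht fun s hs => by
      have hs0 : 0 < s := by linarith
      rw [norm_neg, norm_smul, Real.norm_of_nonneg (by linarith : 0 ≤ s + α)]
      calc (s + α) * ‖efield f s (position α f s w)‖ ≤ ((1 + α) * s) * (K * s ^ (-b)) := by
            gcongr
            · nlinarith
            · exact H s hs _
        _ = (1 + α) * K * (s ^ (1 : ℝ) * s ^ (-b)) := by rw [Real.rpow_one]; ring
        _ = _ := by rw [← Real.rpow_add hs0]; congr 2; ring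
  have h2 := ((hC 1 (by simp)).2.2 w).1
  rw [hz] at h1
  calc ‖w.1 - z.1‖ = ‖((phaseFlow α f 0 1 w).1 - w.1) + (z.1 - (phaseFlow α f 0 1 w).1)‖ := by
        rw [← norm_neg]; congr 1; abel
    _ ≤ _ := (norm_add_le _ _).trans (add_le_add h2 h1)

/-- Feeds the displacement `R ≲ t^(2-b)` into the field bound. -/
theorem hasFieldDecay_step (h : IsDispersing α p C₀ f₀ f) {b : ℝ} (hb : b < 2)
    (hE : HasFieldDecay f b) :
    HasFieldDecay f (((d : ℝ) - 1) - ((d : ℝ) - 1 - 2 / d) * (2 - b)) := by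
  obtain ⟨C, L, hC, hL, H⟩ := h.norm_displacement_le hb.ne hE
  obtain ⟨K, hK, HE⟩ := h.norm_efield_le
  have hD : (4 : ℝ) ≤ d := by exact_mod_cast h.four_le
  have hα := h.alpha_nonneg
  have hμ : 0 ≤ (d : ℝ) - 1 - 2 / d := by
    have : (2 : ℝ) / d ≤ 1 := by rw [div_le_one (by linarith)]; linarith
    linarith
  set μ := (d : ℝ) - 1 - 2 / d
  have hb0 : 0 < 2 - b := by linarith
  set A := C + L / (2 - b) with hA
  have hA1 : 1 ≤ A := by
    have : 0 ≤ L / (2 - b) := by positivity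
    linarith
  refine ⟨K * A ^ μ, by positivity, fun t ht x => ?_⟩
  have ht0 : 0 < t := by linarith
  have h1t : 1 ≤ t ^ (2 - b) := Real.one_le_rpow ht hb0.le
  have hR : ∀ z, ‖(phaseFlow α f t 0 z).1 - z.1‖ ≤ A * t ^ (2 - b) := fun z => by
    refine (H t ht z).trans ?_
    have e : A * t ^ (2 - b) = C * t ^ (2 - b) + L * (t ^ (2 - b) / (2 - b)) := by rw [hA]; ring
    rw [e]
    gcongr
    · nlinarith
    · linarith
  refine (HE t _ ht (by nlinarith) hR x).trans ?_
  have h2 : (t + α) ^ (1 - (d : ℝ)) ≤ t ^ (1 - (d : ℝ)) :=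
    Real.rpow_le_rpow_of_nonpos ht0 (by linarith) (by linarith)
  calc K * ((t + α) ^ (1 - (d : ℝ)) * (A * t ^ (2 - b)) ^ μ)
      ≤ K * (t ^ (1 - (d : ℝ)) * (A * t ^ (2 - b)) ^ μ) := by gcongr
    _ = K * A ^ μ * (t ^ (1 - (d : ℝ)) * t ^ ((2 - b) * μ)) := by
        rw [Real.mul_rpow (by positivity) (by positivity), ← Real.rpow_mul ht0.le]; ring
    _ = _ := by rw [← Real.rpow_add ht0]; congr 2; ring

/-- The step is an affine map of the exponent with slope `μ ≥ 5/2`, so the distance to its fixed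
point `A` grows geometrically. Iteration from an exponent above `A` therefore exceeds `2` after
finitely many steps. -/
theorem exists_hasFieldDecay_gt_two (h : IsDispersing α p C₀ f₀ f) {a : ℝ}
    (ha : ((d : ℝ) ^ 2 - d - 4) / ((d : ℝ) ^ 2 - 2 * d - 2) < a) (hE : HasFieldDecay f a) :
    ∃ b, 2 < b ∧ HasFieldDecay f b := by
  have hD : (4 : ℝ) ≤ d := by exact_mod_cast h.four_le
  set D : ℝ := (d : ℝ)
  have h2D : 2 / D ≤ 1 / 2 := by rw [div_le_iff₀ (by linarith)]; linarith
  have hstep := fun b hb => h.hasFieldDecay_step (b := b) hb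
  have hpos : 0 < D ^ 2 - 2 * D - 2 := by nlinarith
  set A := (D ^ 2 - D - 4) / (D ^ 2 - 2 * D - 2) with hA
  set μ := D - 1 - 2 / D with hμ
  have hμ2 : 5 / 2 ≤ μ := by linarith
  have hfix : ∀ b, (D - 1) - μ * (2 - b) = A + μ * (b - A) := fun b => by
    have : D - 1 - 2 * μ = A * (1 - μ) := by
      have h1 : D * (2 / D) = 2 := by field_simp
      have h2 : A * (D ^ 2 - 2 * D - 2) = D ^ 2 - D - 4 := div_mul_cancel₀ _ hpos.ne'
      refine mul_left_cancel₀ (by linarith : D ≠ 0) ?_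
      rw [hμ]
      linear_combination (2 - A) * h1 + h2
    linarith
  have key : ∀ k : ℕ, (∃ b, 2 < b ∧ HasFieldDecay f b) ∨ HasFieldDecay f (A + μ ^ k * (a - A)) := by
    intro k
    induction k with
    | zero => right; simpa using hE
    | succ k ih =>
      rcases ih with ih | ih
      · exact Or.inl ih
      · rcases lt_or_ge (A + μ ^ k * (a - A)) 2 with hlt | hge
        · right
          have := hstep _ hlt ih
          rw [hfix] at this
          convert this using 1
          ring
        · left
          -- An exponent that has reached `2`, possibly exactly, is lowered slightly so that the
          -- step applies; the next exponent is then `d - 1 - 1/2 > 2`.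
          have hlt : 2 - 1 / (2 * μ) < 2 := by
            have : 0 < 1 / (2 * μ) := by positivity
            linarith
          have := hstep _ hlt (ih.mono (by linarith))
          refine ⟨_, ?_, this⟩
          have e : μ * (2 - (2 - 1 / (2 * μ))) = 1 / 2 := by
            have : μ ≠ 0 := by linarith
            field_simp; ring
          rw [e]; linarith
  have hδ : 0 < a - A := by linarith
  obtain ⟨k, hk⟩ := pow_unbounded_of_one_lt ((2 - A) / (a - A)) (by linarith : 1 < μ)
  rw [div_lt_iff₀ hδ] at hk
  rcases key k with H | H
  · exact H
  · exact ⟨_, by linarith, H⟩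

/-- Above the decay threshold the particles stay within a bounded distance of free transport. -/
theorem exists_displacement_le (h : IsDispersing α p C₀ f₀ f) {a : ℝ}
    (ha : ((d : ℝ) ^ 2 - d - 4) / ((d : ℝ) ^ 2 - 2 * d - 2) < a) (hE : HasFieldDecay f a) :
    ∃ R : ℝ, 1 ≤ R ∧ ∀ t, 0 ≤ t → ∀ z, ‖(phaseFlow α f t 0 z).1 - z.1‖ ≤ R := by
  obtain ⟨b, hb, hEb⟩ := h.exists_hasFieldDecay_gt_two ha hE
  obtain ⟨C, L, hC, hL, H⟩ := h.norm_displacement_le hb.ne' hEb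
  obtain ⟨C', hC1', hC'⟩ := h.exists_bound 1
  have hb0 : 0 < b - 2 := by linarith
  have hLb : 0 ≤ L / (b - 2) := by positivity
  refine ⟨C + C' + L / (b - 2), by linarith, fun t ht z => ?_⟩
  rcases le_total t 1 with h1 | h1
  · have := ((hC' t (by rwa [abs_of_nonneg ht])).2.2 z).2.1
    linarith
  · refine (H t h1 z).trans ?_
    have e : L * ((t ^ (2 - b) - 1) / (2 - b)) = L / (b - 2) * (1 - t ^ (2 - b)) := by
      have : 2 - b ≠ 0 := by linarith
      field_simp; ring
    rw [e]
    have : 0 ≤ t ^ (2 - b) := by positivity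
    nlinarith

end IsDispersing

end VlasovPoisson

end

noncomputable section

namespace VlasovPoisson

open scoped NNReal ENNReal

variable {d : ℕ}

/-! ### Logarithmic bound on the gradient of a field -/

/-- The kernel, truncated at distance `a` from the origin. -/
def truncKernel (a : ℝ) (z : Sp d) : Sp d := (sphereArea d)⁻¹ • ((max ‖z‖ a ^ d)⁻¹ • z)

theorem measurable_truncKernel (a : ℝ) : Measurable (truncKernel (d := d) a) := by
  unfold truncKernel
  fun_prop

theorem norm_kernel_sub_truncKernel_le (hd : 2 ≤ d) {a : ℝ} (ha : 0 < a) (z : Sp d) :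
    ‖kernel z - truncKernel a z‖
      ≤ (sphereArea d)⁻¹ * (Metric.ball (0 : Sp d) a).indicator radialKernel z := by
  have hκ := sphereArea_pos (d := d) (by omega)
  by_cases hz : z ∈ Metric.ball (0 : Sp d) a
  · rw [indicator_of_mem hz]
    rw [mem_ball_zero_iff] at hz
    rcases eq_or_ne z 0 with rfl | hz0
    · simpa [kernel, truncKernel, radialKernel] using
        mul_nonneg (inv_nonneg.2 hκ.le) (inv_nonneg.2 (pow_nonneg le_rfl _))
    have hn : 0 < ‖z‖ := norm_pos_iff.2 hz0
    have e : kernel z - truncKernel a z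
        = ((sphereArea d)⁻¹ * ((‖z‖ ^ d)⁻¹ - (a ^ d)⁻¹)) • z := by
      rw [kernel, truncKernel, max_eq_right hz.le, smul_smul, ← sub_smul]
      congr 1
      rw [one_div, mul_inv, sphereArea]
      ring
    have h1 : (a ^ d)⁻¹ ≤ (‖z‖ ^ d)⁻¹ := by gcongr
    have h2 : 0 ≤ (a ^ d)⁻¹ := by positivity
    rw [e, norm_smul, Real.norm_of_nonneg (by
      have := inv_pos.2 hκ
      exact mul_nonneg this.le (sub_nonneg.2 h1)), mul_assoc]
    gcongr
    calc ((‖z‖ ^ d)⁻¹ - (a ^ d)⁻¹) * ‖z‖ ≤ (‖z‖ ^ d)⁻¹ * ‖z‖ := by gcongr; linarith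
      _ = radialKernel z := by
        rw [radialKernel]
        obtain ⟨k, rfl⟩ : ∃ k, d = k + 1 := ⟨d - 1, by omega⟩
        rw [Nat.add_sub_cancel, pow_succ]
        field_simp
  · rw [indicator_of_notMem hz, mul_zero]
    rw [mem_ball_zero_iff, not_lt] at hz
    rw [kernel, truncKernel, max_eq_left hz, smul_smul, ← sub_smul]
    have : (1 / (d * unitBallVolume d * ‖z‖ ^ d) - (sphereArea d)⁻¹ * (‖z‖ ^ d)⁻¹) = 0 := by
      rw [one_div, mul_inv, sphereArea]
      ring
    rw [this]; simp

/-- A mean value estimate at the truncated scale: moving by at most `a/2` changes `max ‖z‖ a` by a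
factor of at most `2`, so one inverse power of it is gained per unit of displacement. -/
theorem norm_truncKernel_sub_le (hd : 2 ≤ d) {a : ℝ} (ha : 0 < a) {z w : Sp d}
    (hw : ‖w - z‖ ≤ a / 2) :
    ‖truncKernel a w - truncKernel a z‖
      ≤ (sphereArea d)⁻¹ * (2 ^ d + d * 2 ^ (d - 1) * 2 ^ d) * ‖w - z‖ * (max ‖z‖ a ^ d)⁻¹ := by
  have hκ := sphereArea_pos (d := d) (by omega)
  set M := max ‖z‖ a
  set M' := max ‖w‖ a
  have hM : a ≤ M := le_max_right _ _
  have hM0 : 0 < M := by linarith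
  have hM'0 : 0 < M' := lt_of_lt_of_le ha (le_max_right _ _)
  have hdiff : |M' - M| ≤ ‖w - z‖ := by
    have h1 := abs_max_sub_max_le_abs ‖w‖ ‖z‖ a
    exact h1.trans (abs_norm_sub_norm_le w z)
  have hle := abs_le.1 (hdiff.trans hw)
  have hMM' : M / 2 ≤ M' := by linarith
  have hM'M : M' ≤ 2 * M := by linarith
  have hinv : (M' ^ d)⁻¹ ≤ 2 ^ d * (M ^ d)⁻¹ := by
    have h1 : 2 ^ d * (M ^ d)⁻¹ = ((M / 2) ^ d)⁻¹ := by rw [div_pow, inv_div, div_eq_mul_inv]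
    rw [h1]
    gcongr
  have hpow : |M ^ d - M' ^ d| ≤ ‖w - z‖ * d * (2 * M) ^ (d - 1) := by
    refine (abs_pow_sub_pow_le M M' d).trans ?_
    rw [abs_sub_comm, abs_of_pos hM0, abs_of_pos hM'0]
    have : max M M' ≤ 2 * M := max_le (by linarith) hM'M
    gcongr
  have hsub : |(M' ^ d)⁻¹ - (M ^ d)⁻¹| * ‖z‖ ≤ d * 2 ^ (d - 1) * 2 ^ d * ‖w - z‖ * (M ^ d)⁻¹ := by
    have e : (M' ^ d)⁻¹ - (M ^ d)⁻¹ = (M ^ d - M' ^ d) * ((M' ^ d)⁻¹ * (M ^ d)⁻¹) := by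
      field_simp
    rw [e, abs_mul, abs_of_pos (by positivity : 0 < (M' ^ d)⁻¹ * (M ^ d)⁻¹)]
    have hz : ‖z‖ ≤ M := le_max_left _ _
    calc |M ^ d - M' ^ d| * ((M' ^ d)⁻¹ * (M ^ d)⁻¹) * ‖z‖
        ≤ (‖w - z‖ * d * (2 * M) ^ (d - 1)) * ((2 ^ d * (M ^ d)⁻¹) * (M ^ d)⁻¹) * M := by gcongr
      _ = _ := by
        obtain ⟨k, rfl⟩ : ∃ k, d = k + 1 := ⟨d - 1, by omega⟩
        rw [Nat.add_sub_cancel]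
        field_simp
        ring
  have e : truncKernel a w - truncKernel a z = (sphereArea d)⁻¹ •
      ((M' ^ d)⁻¹ • (w - z) + ((M' ^ d)⁻¹ - (M ^ d)⁻¹) • z) := by
    simp only [truncKernel, ← smul_sub]
    congr 1
    change (M' ^ d)⁻¹ • w - (M ^ d)⁻¹ • z = _
    module
  rw [e, norm_smul, Real.norm_of_nonneg (inv_nonneg.2 hκ.le), mul_assoc, mul_assoc]
  refine mul_le_mul_of_nonneg_left ?_ (inv_nonneg.2 hκ.le)
  refine (norm_add_le _ _).trans ?_
  rw [norm_smul, norm_smul, Real.norm_of_nonneg (by positivity), Real.norm_eq_abs]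
  calc _ ≤ 2 ^ d * (M ^ d)⁻¹ * ‖w - z‖ + d * 2 ^ (d - 1) * 2 ^ d * ‖w - z‖ * (M ^ d)⁻¹ := by
        gcongr
    _ = _ := by ring

theorem integrable_smul_kernel (hd : 2 ≤ d) {φ : Sp d → ℝ} {A : ℝ} (hφ : Integrable φ)
    (hA : ∀ y, |φ y| ≤ A) (x : Sp d) : Integrable fun y => φ y • kernel (x - y) := by
  have h1 := (integral_mul_radialKernel_le (d := d) (by omega) hφ hA le_rfl one_pos x).1
  refine (h1.const_mul (sphereArea d)⁻¹).mono' (hφ.1.smul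
    (measurable_kernel.comp (measurable_const.sub measurable_id)).aestronglyMeasurable)
    (Eventually.of_forall fun y => ?_)
  rw [norm_smul, norm_kernel hd, Real.norm_eq_abs]
  exact le_of_eq (by ring)

/-- The kernel is split at distance `a`. The singular part has `L¹` norm at most `a`, and the
increment is moved onto the Lipschitz density. For the rest the increment falls on the kernel,
giving a logarithm between `a` and `b` and the mass beyond `b`. -/
theorem norm_gradInvLaplacian_sub_le (hd : 2 ≤ d) {φ : Sp d → ℝ} {A m Λ a b : ℝ}
    (hφ : Integrable φ) (hA : ∀ y, |φ y| ≤ A) (hm : ∫ y, |φ y| ≤ m)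
    (hΛ : ∀ x y, |φ x - φ y| ≤ Λ * ‖x - y‖) (ha : 0 < a) (hab : a ≤ b) {x x' : Sp d}
    (hx : ‖x' - x‖ ≤ a / 2) :
    ‖gradInvLaplacian φ x' - gradInvLaplacian φ x‖ ≤
      ((2 ^ d + d * 2 ^ (d - 1) * 2 ^ d) *
        (A * (1 + Real.log (b / a)) + (sphereArea d)⁻¹ * (m / b ^ d)) + Λ * a) * ‖x' - x‖ := by
  have hκ := sphereArea_pos (d := d) (by omega)
  have hb : 0 < b := ha.trans_le hab
  have hA0 : 0 ≤ A := (abs_nonneg _).trans (hA 0)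
  set c := (sphereArea d)⁻¹ with hc
  set L : ℝ := 2 ^ d + d * 2 ^ (d - 1) * 2 ^ d with hL
  set N : Sp d → Sp d := fun z => kernel z - truncKernel a z with hN
  have hNm : Measurable N := measurable_kernel.sub (measurable_truncKernel a)
  have hball := integral_radialKernel_ball (d := d) (by omega) ha.le
  have hNi : Integrable N := by
    refine (hball.1.const_mul c).mono' hNm.aestronglyMeasurable
      (Eventually.of_forall fun z => norm_kernel_sub_truncKernel_le hd ha z)
  have hNn : ∫ z, ‖N z‖ ≤ a := by
    calc ∫ z, ‖N z‖ ≤ ∫ z, c * (Metric.ball (0 : Sp d) a).indicator radialKernel z :=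
          integral_mono hNi.norm (hball.1.const_mul c)
            fun z => norm_kernel_sub_truncKernel_le hd ha z
      _ = a := by rw [integral_const_mul, hball.2, hc]; field_simp
  have hsub : ∀ u : Sp d, Measure.QuasiMeasurePreserving (fun y : Sp d => u - y) volume volume :=
    fun u => (Measure.measurePreserving_sub_left volume u).quasiMeasurePreserving
  have hφN : ∀ u, Integrable fun z => φ (u - z) • N z := fun u => by
    refine (hNi.norm.const_mul A).mono'
      ((hφ.1.comp_quasiMeasurePreserving (hsub u)).smul hNi.1) (Eventually.of_forall fun z => ?_)
    rw [norm_smul]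
    exact mul_le_mul_of_nonneg_right (hA _) (norm_nonneg _)
  have hφN' : ∀ u, Integrable fun y => φ y • N (u - y) := fun u => by
    have := (hφN u).comp_sub_left u
    simpa using this
  have hφT : ∀ u, Integrable fun y => φ y • truncKernel a (u - y) := fun u => by
    refine ((integrable_smul_kernel hd hφ hA u).sub (hφN' u)).congr
      (Eventually.of_forall fun y => ?_)
    simp only [Pi.sub_apply, hN, ← smul_sub, sub_sub_cancel]
  have hdec : ∀ u, gradInvLaplacian φ u
      = (∫ y, φ y • truncKernel a (u - y)) + ∫ z, φ (u - z) • N z := fun u => by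
    have e : ∫ z, φ (u - z) • N z = ∫ y, φ y • N (u - y) := by
      rw [← integral_sub_left_eq_self (fun z => φ (u - z) • N z) volume u]
      simp
    rw [e, ← integral_add (hφT u) (hφN' u), gradInvLaplacian]
    refine integral_congr_ae (Eventually.of_forall fun y => ?_)
    simp only [hN, ← smul_add, add_sub_cancel]
  have hnear : ‖(∫ z, φ (x' - z) • N z) - ∫ z, φ (x - z) • N z‖ ≤ Λ * a * ‖x' - x‖ := by
    rw [← integral_sub (hφN x') (hφN x)]
    have hΛ0 : 0 ≤ Λ * ‖x' - x‖ := (abs_nonneg _).trans (hΛ x' x)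
    calc _ ≤ ∫ z, Λ * ‖x' - x‖ * ‖N z‖ := by
          refine norm_integral_le_of_norm_le (hNi.norm.const_mul _)
            (Eventually.of_forall fun z => ?_)
          rw [← sub_smul, norm_smul]
          refine mul_le_mul_of_nonneg_right ?_ (norm_nonneg _)
          have := hΛ (x' - z) (x - z)
          rwa [sub_sub_sub_cancel_right] at this
      _ ≤ Λ * ‖x' - x‖ * a := by
          rw [integral_const_mul]; exact mul_le_mul_of_nonneg_left hNn hΛ0
      _ = _ := by ring
  have hmax := integral_max_pow_ball (d := d) (by omega) ha hab
  have hmax1 := hmax.1.comp_sub_left x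
  have hmax2 : ∫ y, (Iio b).indicator (fun y => (max y a ^ d)⁻¹) ‖x - y‖
      ≤ sphereArea d * (1 + Real.log (b / a)) := by
    rw [integral_sub_left_eq_self
      (fun z : Sp d => (Iio b).indicator (fun y => (max y a ^ d)⁻¹) ‖z‖)]
    exact hmax.2
  have hfar : ‖(∫ y, φ y • truncKernel a (x' - y)) - ∫ y, φ y • truncKernel a (x - y)‖
      ≤ L * (A * (1 + Real.log (b / a)) + c * (m / b ^ d)) * ‖x' - x‖ := by
    rw [← integral_sub (hφT x') (hφT x)]
    have hi1 := hmax1.const_mul A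
    have hi2 := hφ.abs.mul_const (b ^ d)⁻¹
    calc _ ≤ ∫ y, c * L * ‖x' - x‖ * (A * (Iio b).indicator (fun y => (max y a ^ d)⁻¹) ‖x - y‖
            + |φ y| * (b ^ d)⁻¹) := by
          refine norm_integral_le_of_norm_le ((hi1.add hi2).const_mul _)
            (Eventually.of_forall fun y => ?_)
          rw [← smul_sub, norm_smul, Real.norm_eq_abs]
          have h1 := norm_truncKernel_sub_le hd ha (z := x - y) (w := x' - y)
            (by rwa [sub_sub_sub_cancel_right])
          rw [sub_sub_sub_cancel_right] at h1
          -- Within distance `b` the density is replaced by its sup norm; beyond it the kernel is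
          -- replaced by `b^(-d)`.
          have h2 : |φ y| * (max ‖x - y‖ a ^ d)⁻¹ ≤
              A * (Iio b).indicator (fun y => (max y a ^ d)⁻¹) ‖x - y‖ + |φ y| * (b ^ d)⁻¹ := by
            by_cases hy : ‖x - y‖ ∈ Iio b
            · rw [indicator_of_mem hy]
              have : 0 ≤ |φ y| * (b ^ d)⁻¹ := by positivity
              have : |φ y| * (max ‖x - y‖ a ^ d)⁻¹ ≤ A * (max ‖x - y‖ a ^ d)⁻¹ := by
                gcongr; exact hA y
              linarith
            · rw [indicator_of_notMem hy, mul_zero, zero_add]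
              have : b ≤ max ‖x - y‖ a := le_max_of_le_left (not_lt.1 hy)
              gcongr
          calc _ ≤ |φ y| * (c * L * ‖x' - x‖ * (max ‖x - y‖ a ^ d)⁻¹) := by gcongr
            _ = c * L * ‖x' - x‖ * (|φ y| * (max ‖x - y‖ a ^ d)⁻¹) := by ring
            _ ≤ _ := by gcongr
      _ = c * L * ‖x' - x‖ * (A * (∫ y, (Iio b).indicator (fun y => (max y a ^ d)⁻¹) ‖x - y‖)
            + (∫ y, |φ y|) * (b ^ d)⁻¹) := by
          rw [integral_const_mul, integral_add hi1 hi2, integral_const_mul, integral_mul_const]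
      _ ≤ c * L * ‖x' - x‖ * (A * (sphereArea d * (1 + Real.log (b / a))) + m * (b ^ d)⁻¹) := by
          gcongr
      _ = _ := by rw [hc]; field_simp
  rw [hdec, hdec]
  calc _ = ‖((∫ y, φ y • truncKernel a (x' - y)) - ∫ y, φ y • truncKernel a (x - y))
        + ((∫ z, φ (x' - z) • N z) - ∫ z, φ (x - z) • N z)‖ := by congr 1; abel
    _ ≤ _ := (norm_add_le _ _).trans (add_le_add hfar hnear)
    _ = _ := by ring

theorem norm_fderiv_gradInvLaplacian_le (hd : 2 ≤ d) {φ : Sp d → ℝ} {A m Λ a b : ℝ}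
    (hφ : Integrable φ) (hA : ∀ y, |φ y| ≤ A) (hm : ∫ y, |φ y| ≤ m) (hΛ0 : 0 ≤ Λ)
    (hΛ : ∀ x y, |φ x - φ y| ≤ Λ * ‖x - y‖) (ha : 0 < a) (hab : a ≤ b) (x : Sp d) :
    ‖fderiv ℝ (gradInvLaplacian φ) x‖ ≤
      (2 ^ d + d * 2 ^ (d - 1) * 2 ^ d) *
        (A * (1 + Real.log (b / a)) + (sphereArea d)⁻¹ * (m / b ^ d)) + Λ * a := by
  have hκ := sphereArea_pos (d := d) (by omega)
  have hA0 : 0 ≤ A := (abs_nonneg _).trans (hA 0)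
  have hm0 : 0 ≤ m := (integral_nonneg fun _ => abs_nonneg _).trans hm
  have hlog : 0 ≤ Real.log (b / a) := Real.log_nonneg ((one_le_div ha).2 hab)
  have hb : 0 < b := ha.trans_le hab
  refine norm_fderiv_le_of_lip' ℝ (by positivity) ?_
  filter_upwards [Metric.closedBall_mem_nhds x (half_pos ha)] with x' hx'
  rw [mem_closedBall_iff_norm] at hx'
  exact norm_gradInvLaplacian_sub_le hd hφ hA hm hΛ ha hab hx'

end VlasovPoisson

end

noncomputable section

namespace VlasovPoisson

open scoped NNReal ENNReal

variable {d : ℕ}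

/-! ### Propagation of regularity -/

section Gronwall

variable {F : Type*} [NormedAddCommGroup F] [NormedSpace ℝ F]

/-- Grönwall with the rate given through a primitive `Λ`, so no integral of the rate appears. The
comparison argument needs a strict inequality, supplied by an `ε` that is removed at the end. -/
theorem norm_le_mul_exp_of_norm_deriv_le {u u' : ℝ → F} {Λ Λ' : ℝ → ℝ} {a b : ℝ} (hab : a ≤ b)
    (hu : ∀ s ∈ Icc a b, HasDerivAt u (u' s) s) (hΛ : ∀ s ∈ Icc a b, HasDerivAt Λ (Λ' s) s)
    (h : ∀ s ∈ Icc a b, ‖u' s‖ ≤ Λ' s * ‖u s‖) : ‖u b‖ ≤ ‖u a‖ * Real.exp (Λ b - Λ a) := by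
  have key : ∀ ε > 0, ‖u b‖ ≤ (‖u a‖ + ε) * Real.exp (Λ b - Λ a + ε * (b - a)) := by
    intro ε hε
    have hB : ∀ s ∈ Icc a b, HasDerivAt
        (fun s => (‖u a‖ + ε) * Real.exp (Λ s - Λ a + ε * (s - a)))
        ((Λ' s + ε) * ((‖u a‖ + ε) * Real.exp (Λ s - Λ a + ε * (s - a)))) s := fun s hs => by
      have h1 := (((hΛ s hs).sub_const (Λ a)).add
        (((hasDerivAt_id s).sub_const a).const_mul ε)).exp.const_mul (‖u a‖ + ε)
      refine h1.congr_deriv ?_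
      simp only [Pi.add_apply, id]
      ring
    refine image_norm_le_of_norm_deriv_right_lt_deriv_boundary' (a := a) (b := b) (f := u)
      (f' := u') (B := fun s => (‖u a‖ + ε) * Real.exp (Λ s - Λ a + ε * (s - a)))
      (B' := fun s => (Λ' s + ε) * ((‖u a‖ + ε) * Real.exp (Λ s - Λ a + ε * (s - a))))
      (fun s hs => (hu s hs).continuousAt.continuousWithinAt)
      (fun s hs => (hu s (Ico_subset_Icc_self hs)).hasDerivWithinAt) (by simp [hε.le])
      (fun s hs => (hB s hs).continuousAt.continuousWithinAt)
      (fun s hs => (hB s (Ico_subset_Icc_self hs)).hasDerivWithinAt) ?_ ⟨hab, le_rfl⟩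
    intro s hs heq
    have h1 := h s (Ico_subset_Icc_self hs)
    have h2 : 0 < (‖u a‖ + ε) * Real.exp (Λ s - Λ a + ε * (s - a)) := by positivity
    rw [heq] at h1
    nlinarith
  have hlim : Tendsto (fun ε : ℝ => (‖u a‖ + ε) * Real.exp (Λ b - Λ a + ε * (b - a)))
      (𝓝[>] 0) (𝓝 (‖u a‖ * Real.exp (Λ b - Λ a))) := by
    have : Continuous fun ε : ℝ => (‖u a‖ + ε) * Real.exp (Λ b - Λ a + ε * (b - a)) := by
      fun_prop
    simpa using (this.tendsto 0).mono_left nhdsWithin_le_nhds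
  exact ge_of_tendsto hlim (eventually_nhdsWithin_of_forall fun ε hε => key ε hε)

/-- The same estimate after reflecting time; it controls the flow traced backward. -/
theorem norm_le_mul_exp_of_norm_deriv_le' {u u' : ℝ → F} {Λ Λ' : ℝ → ℝ} {a b : ℝ} (hab : a ≤ b)
    (hu : ∀ s ∈ Icc a b, HasDerivAt u (u' s) s) (hΛ : ∀ s ∈ Icc a b, HasDerivAt Λ (Λ' s) s)
    (h : ∀ s ∈ Icc a b, ‖u' s‖ ≤ Λ' s * ‖u s‖) : ‖u a‖ ≤ ‖u b‖ * Real.exp (Λ b - Λ a) := by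
  have hm : ∀ s ∈ Icc a b, a + b - s ∈ Icc a b := fun s hs =>
    ⟨by linarith [hs.2], by linarith [hs.1]⟩
  have h1 := norm_le_mul_exp_of_norm_deriv_le (u := fun s => u (a + b - s))
    (u' := fun s => -u' (a + b - s)) (Λ := fun s => -Λ (a + b - s))
    (Λ' := fun s => Λ' (a + b - s)) hab
    (fun s hs => (hu _ (hm s hs)).comp_const_sub (a + b) s)
    (fun s hs => ((hΛ _ (hm s hs)).comp_const_sub (a + b) s).neg.congr_deriv (neg_neg _))
    (fun s hs => by rw [norm_neg]; exact h _ (hm s hs))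
  simp only [add_sub_cancel_right, add_sub_cancel_left] at h1
  convert h1 using 3
  ring

theorem integral_comp_inv_smul_sub {τ : ℝ} (hτ : 0 < τ) (x : Sp d) (H : Sp d → F) :
    ∫ y, H (τ⁻¹ • (x - y)) = τ ^ d • ∫ v, H v := by
  rw [integral_sub_left_eq_self (fun y => H (τ⁻¹ • y)), Measure.integral_comp_inv_smul,
    finrank_euclideanSpace_fin, abs_of_pos (pow_pos hτ d)]

theorem integrable_comp_inv_smul_sub_iff {τ : ℝ} (hτ : 0 < τ) (x : Sp d) (H : Sp d → F) :
    Integrable (fun y => H (τ⁻¹ • (x - y))) ↔ Integrable H := by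
  rw [← integrable_comp_smul_iff volume H (inv_pos.2 hτ).ne']
  exact integrable_comp_sub_left (fun y => H (τ⁻¹ • y)) x

end Gronwall

/-- A chain-rule bound that needs no differentiability of `Φ`, so Lipschitz control of the flow
suffices. Near `Φ z` the function `g` is Lipschitz with constant arbitrarily close to the norm of
its derivative. -/
theorem norm_fderiv_comp_lipschitz_le {V : Type*} [NormedAddCommGroup V] [NormedSpace ℝ V]
    {g : V → ℝ} (hg : ContDiff ℝ 1 g) {Φ : V → V} {D : ℝ≥0} (hΦ : LipschitzWith D Φ) (z : V) :
    ‖fderiv ℝ (g ∘ Φ) z‖ ≤ D * ‖fderiv ℝ g (Φ z)‖ := by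
  have key : ∀ ε : ℝ≥0, 0 < ε → ‖fderiv ℝ (g ∘ Φ) z‖ ≤ D * (‖fderiv ℝ g (Φ z)‖ + ε) := by
    intro ε hε
    have h1 : HasStrictFDerivAt g (fderiv ℝ g (Φ z)) (Φ z) :=
      hg.contDiffAt.hasStrictFDerivAt (by simp)
    obtain ⟨s, hs, hl⟩ := h1.exists_lipschitzOnWith_of_nnnorm_lt (‖fderiv ℝ g (Φ z)‖₊ + ε)
      (lt_add_of_pos_right _ hε)
    refine norm_fderiv_le_of_lip' ℝ (by positivity) ?_
    filter_upwards [hΦ.continuous.continuousAt.preimage_mem_nhds hs] with w hw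
    have h2 := hl.dist_le_mul _ hw _ (mem_of_mem_nhds hs)
    have h3 := hΦ.dist_le_mul w z
    rw [dist_eq_norm, dist_eq_norm] at h2 h3
    calc ‖(g ∘ Φ) w - (g ∘ Φ) z‖ ≤ _ := h2
      _ ≤ (‖fderiv ℝ g (Φ z)‖ + ε) * (D * ‖w - z‖) := by
        push_cast
        gcongr
      _ = _ := by ring
  have hlim : Tendsto (fun ε : ℝ≥0 => (D : ℝ) * (‖fderiv ℝ g (Φ z)‖ + ε)) (𝓝[>] 0)
      (𝓝 (D * ‖fderiv ℝ g (Φ z)‖)) := by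
    have : Continuous fun ε : ℝ≥0 => (D : ℝ) * (‖fderiv ℝ g (Φ z)‖ + ε) := by fun_prop
    simpa using (this.tendsto 0).mono_left nhdsWithin_le_nhds
  exact ge_of_tendsto hlim (eventually_nhdsWithin_of_forall fun ε hε => key ε hε)

namespace IsDispersing

variable {α p C₀ : ℝ} {f₀ : Sp d → Sp d → ℝ} {f : ℝ → Sp d → Sp d → ℝ}

theorem norm_fderiv_sheared_le (h : IsDispersing α p C₀ f₀ f) {t R : ℝ} (ht : 0 ≤ t) (hR : 1 ≤ R)
    {D : ℝ≥0} (hD : LipschitzWith D (phaseFlow α f t 0)) {z : Sp d × Sp d}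
    (hz : ‖(phaseFlow α f t 0 z).1 - z.1‖ ≤ R) :
    ‖fderiv ℝ (sheared α f t) z‖ ≤ D * (C₀ * 2 ^ p * (1 + ‖z.1‖ / R) ^ (-p)) := by
  have e : sheared α f t = sheared α f 0 ∘ phaseFlow α f t 0 := funext fun z => h.sheared_eq ht z
  have hC := h.const_nonneg
  rw [e]
  refine (norm_fderiv_comp_lipschitz_le (h.sol.contDiff_sheared α le_rfl) hD z).trans ?_
  gcongr
  refine (h.fderiv_decay _).trans ?_
  rw [mul_assoc]
  gcongr
  exact h.weight_le hR hz

/-- The substitution `v = (x - y)/τ`. In this form `x` enters only through the velocity argument and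
divided by `τ`, so a derivative in `x` costs a factor `1/τ`. -/
theorem density_eq_integral (f : ℝ → Sp d → Sp d → ℝ) {t : ℝ} (hτ : 0 < t + α) (x : Sp d) :
    (t + α) ^ d * density (f t) x = ∫ y, sheared α f t (y, (t + α)⁻¹ • (x - y)) := by
  rw [density, ← smul_eq_mul, ← integral_comp_inv_smul_sub hτ x]
  refine integral_congr_ae (Eventually.of_forall fun y => ?_)
  simp only
  rw [f_eq_sheared α t f, smul_smul, mul_inv_cancel₀ hτ.ne', one_smul, sub_sub_cancel]

theorem integrable_sheared_slice (h : IsDispersing α p C₀ f₀ f) {t : ℝ} (ht : 0 ≤ t)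
    (hτ : 0 < t + α) (x : Sp d) :
    Integrable fun y => sheared α f t (y, (t + α)⁻¹ • (x - y)) := by
  refine ((integrable_comp_inv_smul_sub_iff hτ x (f t x)).2 (h.sol.density_exists t ht x)).congr
    (Eventually.of_forall fun y => ?_)
  simp only
  rw [f_eq_sheared α t f, smul_smul, mul_inv_cancel₀ hτ.ne', one_smul, sub_sub_cancel]

theorem abs_sheared_sub_le (h : IsDispersing α p C₀ f₀ f) {t R : ℝ} (ht : 0 ≤ t) (hR : 1 ≤ R)
    {D : ℝ≥0} (hD : LipschitzWith D (phaseFlow α f t 0))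
    (hz : ∀ z, ‖(phaseFlow α f t 0 z).1 - z.1‖ ≤ R) (y w w' : Sp d) :
    |sheared α f t (y, w) - sheared α f t (y, w')|
      ≤ D * (C₀ * 2 ^ p * (1 + ‖y‖ / R) ^ (-p)) * ‖w - w'‖ := by
  have hconv : Convex ℝ {z : Sp d × Sp d | z.1 = y} :=
    (convex_singleton y).linear_preimage (LinearMap.fst ℝ (Sp d) (Sp d))
  have := hconv.norm_image_sub_le_of_norm_fderiv_le (𝕜 := ℝ) (f := sheared α f t)
    (C := D * (C₀ * 2 ^ p * (1 + ‖y‖ / R) ^ (-p))) (x := (y, w')) (y := (y, w))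
    (fun z _ => (h.sol.contDiff_sheared α ht).differentiable (by simp) z)
    (fun z hzy => by
      have h1 := h.norm_fderiv_sheared_le ht hR hD (hz z)
      rwa [show z.1 = y from hzy] at h1) rfl rfl
  simpa [Prod.norm_def] using this

theorem abs_density_sub_le (h : IsDispersing α p C₀ f₀ f) {t R : ℝ} (ht : 0 ≤ t) (hτ : 0 < t + α)
    (hR : 1 ≤ R) {D : ℝ≥0} (hD : LipschitzWith D (phaseFlow α f t 0))
    (hz : ∀ z, ‖(phaseFlow α f t 0 z).1 - z.1‖ ≤ R) (x x' : Sp d) :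
    |density (f t) x - density (f t) x'|
      ≤ C₀ * 2 ^ p * (R ^ d * weightIntegral d p) * D / (t + α) ^ (d + 1) * ‖x - x'‖ := by
  set τ := t + α
  have hw := h.integral_weight_scaled one_pos (by linarith : 0 < R) 0
  simp only [one_smul, zero_sub, norm_neg, div_one] at hw
  have h1 : |τ ^ d * (density (f t) x - density (f t) x')|
      ≤ D * (C₀ * 2 ^ p) * (τ⁻¹ * ‖x - x'‖) * (R ^ d * weightIntegral d p) := by
    rw [mul_sub, density_eq_integral f hτ, density_eq_integral f hτ,
      ← integral_sub (h.integrable_sheared_slice ht hτ x) (h.integrable_sheared_slice ht hτ x'),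
      ← hw.2, ← integral_const_mul, ← Real.norm_eq_abs]
    refine norm_integral_le_of_norm_le (hw.1.const_mul _) (Eventually.of_forall fun y => ?_)
    have h2 := h.abs_sheared_sub_le ht hR hD hz y (τ⁻¹ • (x - y)) (τ⁻¹ • (x' - y))
    rw [← smul_sub, sub_sub_sub_cancel_right, norm_smul,
      Real.norm_of_nonneg (inv_nonneg.2 hτ.le)] at h2
    rw [Real.norm_eq_abs]
    refine h2.trans (le_of_eq (by ring))
  rw [abs_mul, abs_of_pos (pow_pos hτ d)] at h1
  have hp := pow_pos hτ d
  rw [← le_div_iff₀' hp] at h1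
  refine h1.trans (le_of_eq ?_)
  rw [pow_succ]
  field_simp

/-- The field gradient depends only logarithmically on the Lipschitz constant of the flow. -/
theorem exists_norm_fderiv_efield_le (h : IsDispersing α p C₀ f₀ f) {R : ℝ} (hR : 1 ≤ R)
    (hz : ∀ t, 0 ≤ t → ∀ z, ‖(phaseFlow α f t 0 z).1 - z.1‖ ≤ R) :
    ∃ C : ℝ, 0 ≤ C ∧ ∀ t, 1 ≤ t → ∀ D : ℝ≥0, 1 ≤ D → LipschitzWith D (phaseFlow α f t 0) →
      ∀ x, ‖fderiv ℝ (efield f t) x‖ ≤ C * (1 + Real.log D) / t ^ d := by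
  have hd := h.four_le
  have hα := h.alpha_nonneg
  have hC₀ := h.const_nonneg
  have hI := weightIntegral_nonneg d p
  have hκ := sphereArea_pos (d := d) (by omega)
  have hm := h.mass_nonneg
  set K := C₀ * 2 ^ p * (R ^ d * weightIntegral d p) with hK
  have hK0 : 0 ≤ K := by positivity
  set L : ℝ := 2 ^ d + d * 2 ^ (d - 1) * 2 ^ d with hL
  refine ⟨L * (K + (sphereArea d)⁻¹ * mass α f) + K, by positivity, fun t ht1 D hD hlip x => ?_⟩
  have ht : 0 ≤ t := by linarith
  have ht0 : 0 < t := by linarith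
  have hτ : 0 < t + α := by linarith
  have hD1 : (1 : ℝ) ≤ D := by exact_mod_cast hD
  have hD0 : (0 : ℝ) < D := by linarith
  have hlog := Real.log_nonneg hD1
  have e : efield f t = gradInvLaplacian (density (f t)) :=
    funext fun x => efield_of_nonneg f ht x
  have hρ : ∀ y, |density (f t) y| ≤ K / t ^ d := fun y => by
    rw [abs_of_nonneg (h.density_nonneg ht y)]
    refine (h.density_le ht hτ hR (hz t ht) y).trans ?_
    rw [div_pow, hK]
    calc _ = C₀ * 2 ^ p * (R ^ d * weightIntegral d p) / (t + α) ^ d := by ring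
      _ ≤ _ := by gcongr; linarith
  have hΛ : ∀ y y', |density (f t) y - density (f t) y'| ≤ K * D / t ^ (d + 1) * ‖y - y'‖ :=
    fun y y' => by
      refine (h.abs_density_sub_le ht hτ hR hlip (hz t ht) y y').trans ?_
      gcongr
      linarith
  -- The density has Lipschitz constant of order `D / t^(d+1)`. The inner radius `t/D` absorbs the
  -- factor `D`, leaving it only inside the logarithm of `b/a = D`.
  have h1 := norm_fderiv_gradInvLaplacian_le (d := d) (by omega) (a := t / D) (b := t)
    (h.integrable_density ht) hρ (h.integral_abs_density ht).le (by positivity) hΛ (by positivity)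
    (div_le_self ht hD1) x
  rw [← e] at h1
  refine h1.trans ?_
  have e1 : t / (t / D) = D := by field_simp
  have e2 : K * D / t ^ (d + 1) * (t / D) = K / t ^ d := by rw [pow_succ]; field_simp
  rw [e1, e2]
  have h3 : L * (K / t ^ d * (1 + Real.log D) + (sphereArea d)⁻¹ * (mass α f / t ^ d)) + K / t ^ d
      = (L * (K * (1 + Real.log D) + (sphereArea d)⁻¹ * mass α f) + K) / t ^ d := by ring
  rw [h3]
  gcongr
  have h4 : 0 ≤ L * ((sphereArea d)⁻¹ * mass α f) + K := by positivity
  nlinarith [mul_nonneg h4 hlog]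

end IsDispersing

end VlasovPoisson

end

/-! ### Uniform Lipschitz bound for the flow and decay of the field gradient -/

noncomputable section

namespace VlasovPoisson

open scoped NNReal ENNReal

variable {d : ℕ}

namespace IsDispersing

variable {α p C₀ : ℝ} {f₀ : Sp d → Sp d → ℝ} {f : ℝ → Sp d → Sp d → ℝ}

theorem differentiable_efield (h : IsDispersing α p C₀ f₀ f) {t : ℝ} (ht : 0 ≤ t) :
    Differentiable ℝ (efield f t) := by
  have e : efield f t = field (f t) := funext fun x => efield_of_nonneg f ht x
  rw [e]
  exact h.sol.field_differentiable t ht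

theorem exists_norm_fderiv_efield_le_of_le (h : IsDispersing α p C₀ f₀ f) (T : ℝ) :
    ∃ C : ℝ, 0 ≤ C ∧ ∀ t, 0 ≤ t → t ≤ T → ∀ x, ‖fderiv ℝ (efield f t) x‖ ≤ C := by
  obtain ⟨C, hC⟩ := h.sol.field_locally_bounded T
  refine ⟨max C 0, le_max_right _ _, fun t ht htT x => ?_⟩
  have e : efield f t = field (f t) := funext fun x => efield_of_nonneg f ht x
  rw [e]
  exact (hC t ht htT x).2.trans (le_max_left _ _)

/-- One factor `t` comes from the position `y + τ v`, the other from the coefficient `τ` of the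
field. -/
theorem norm_phaseField_sub_le (h : IsDispersing α p C₀ f₀ f) {t ℓ : ℝ} (ht : 1 ≤ t)
    (hℓ : ∀ x, ‖fderiv ℝ (efield f t) x‖ ≤ ℓ) (z w : Sp d × Sp d) :
    ‖phaseField α (efield f) t z - phaseField α (efield f) t w‖
      ≤ (2 + α) ^ 2 * t ^ 2 * ℓ * ‖z - w‖ := by
  have hα := h.alpha_nonneg
  have hτ : 0 ≤ t + α := by linarith
  have hℓ0 : 0 ≤ ℓ := (norm_nonneg _).trans (hℓ 0)
  set X : Sp d × Sp d → Sp d := fun z => z.1 + (t + α) • z.2 with hX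
  have h1 : ‖efield f t (X z) - efield f t (X w)‖ ≤ ℓ * ‖X z - X w‖ :=
    convex_univ.norm_image_sub_le_of_norm_fderiv_le (𝕜 := ℝ)
      (fun x _ => h.differentiable_efield (by linarith) x) (fun x _ => hℓ x)
      (mem_univ _) (mem_univ _)
  have h2 : ‖X z - X w‖ ≤ (2 + α) * t * ‖z - w‖ := by
    have e : X z - X w = (z - w).1 + (t + α) • (z - w).2 := by
      simp only [hX, Prod.fst_sub, Prod.snd_sub]; module
    rw [e]
    refine (norm_add_le _ _).trans ?_
    rw [norm_smul, Real.norm_of_nonneg hτ]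
    have a1 := norm_fst_le (z - w)
    have a2 := norm_snd_le (z - w)
    have a3 : (t + α) * ‖(z - w).2‖ ≤ (t + α) * ‖z - w‖ := by gcongr
    nlinarith [norm_nonneg (z - w), mul_nonneg hα (norm_nonneg (z - w)),
      mul_nonneg (mul_nonneg hα (sub_nonneg.2 ht)) (norm_nonneg (z - w)),
      mul_nonneg (sub_nonneg.2 ht) (norm_nonneg (z - w))]
  have h3 : ‖efield f t (X z) - efield f t (X w)‖ ≤ ℓ * ((2 + α) * t * ‖z - w‖) :=
    h1.trans (by gcongr)
  have hb : 0 ≤ ℓ * ((2 + α) * t * ‖z - w‖) := (norm_nonneg _).trans h3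
  have e : phaseField α (efield f) t z - phaseField α (efield f) t w
      = (-((t + α) • (efield f t (X z) - efield f t (X w))),
        efield f t (X z) - efield f t (X w)) := by
    simp only [phaseField, Prod.mk_sub_mk, hX]
    congr 1
    module
  have h4 : 1 ≤ (2 + α) * t := by nlinarith
  rw [e, Prod.norm_def]
  refine max_le ?_ ?_
  · rw [norm_neg, norm_smul, Real.norm_of_nonneg hτ]
    calc _ ≤ ((2 + α) * t) * (ℓ * ((2 + α) * t * ‖z - w‖)) := by
          gcongr
          nlinarith
      _ = _ := by ring
  · calc _ ≤ 1 * (ℓ * ((2 + α) * t * ‖z - w‖)) := by rw [one_mul]; exact h3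
      _ ≤ ((2 + α) * t) * (ℓ * ((2 + α) * t * ‖z - w‖)) := by gcongr
      _ = _ := by ring

/-- Stability of the flow under almost optimal decay of the field gradient. -/
theorem lipschitzWith_phaseFlow_of_decay (h : IsDispersing α p C₀ f₀ f) {T₀ T Q : ℝ}
    (hT₀ : 1 ≤ T₀) (hT : T₀ ≤ T) (hQ : 0 ≤ Q)
    (hE : ∀ s, T₀ ≤ s → s ≤ T → ∀ x,
      ‖fderiv ℝ (efield f s) x‖ ≤ Q * s ^ (1 / 2 : ℝ) / s ^ d)
    {D₀ : ℝ≥0} (hD₀ : LipschitzWith D₀ (phaseFlow α f T₀ 0)) :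
    LipschitzWith (D₀ * (Real.exp (2 * (2 + α) ^ 2 * Q * T₀ ^ (-1 / 2 : ℝ))).toNNReal)
      (phaseFlow α f T 0) := by
  have hd := h.four_le
  have hα := h.alpha_nonneg
  refine LipschitzWith.of_dist_le_mul fun z w => ?_
  have e : ∀ z, phaseFlow α f T 0 z = phaseFlow α f T₀ 0 (phaseFlow α f T T₀ z) := fun z =>
    (h.isFlowField.flow_flow T T₀ 0 z).symm
  rw [e, e]
  refine (hD₀.dist_le_mul _ _).trans ?_
  push_cast
  rw [mul_assoc, Real.coe_toNNReal _ (Real.exp_pos _).le]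
  refine mul_le_mul_of_nonneg_left ?_ D₀.2
  have h1 := norm_le_mul_exp_of_norm_deriv_le' (a := T₀) (b := T)
    (u := fun s => phaseFlow α f T s z - phaseFlow α f T s w)
    (u' := fun s => phaseField α (efield f) s (phaseFlow α f T s z)
      - phaseField α (efield f) s (phaseFlow α f T s w))
    (Λ := fun s => -(2 * (2 + α) ^ 2 * Q) * s ^ (-1 / 2 : ℝ))
    (Λ' := fun s => -(2 * (2 + α) ^ 2 * Q) * ((-1 / 2 : ℝ) * s ^ ((-1 / 2 : ℝ) - 1))) hT
    (fun s _ => (h.isFlowField.hasDerivAt_flow T z s).sub (h.isFlowField.hasDerivAt_flow T w s))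
    (fun s hs => (Real.hasDerivAt_rpow_const (Or.inl (by linarith [hs.1]))).const_mul _)
    (fun s hs => by
      have hs1 : 1 ≤ s := by linarith [hs.1]
      have hs0 : 0 < s := by linarith
      refine (h.norm_phaseField_sub_le hs1 (hE s hs.1 hs.2) _ _).trans ?_
      refine mul_le_mul_of_nonneg_right ?_ (norm_nonneg _)
      -- With `d ≥ 4` the Lipschitz rate is at most a multiple of `s^(2 + 1/2 - 4) = s^(-3/2)`,
      -- which is integrable; its primitive is the function `Λ` above.
      have e1 : s ^ ((-1 / 2 : ℝ) - 1) = s ^ 2 * s ^ (1 / 2 : ℝ) / s ^ 4 := by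
        rw [← Real.rpow_natCast s 2, ← Real.rpow_natCast s 4, ← Real.rpow_add hs0,
          ← Real.rpow_sub hs0]
        congr 1; norm_num
      rw [e1]
      have e2 : s ^ 2 * s ^ (1 / 2 : ℝ) / s ^ d ≤ s ^ 2 * s ^ (1 / 2 : ℝ) / s ^ 4 := by
        gcongr
      calc _ = (2 + α) ^ 2 * Q * (s ^ 2 * s ^ (1 / 2 : ℝ) / s ^ d) := by ring
        _ ≤ (2 + α) ^ 2 * Q * (s ^ 2 * s ^ (1 / 2 : ℝ) / s ^ 4) := by gcongr
        _ = _ := by ring)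
  simp only [h.isFlowField.flow_self] at h1
  rw [dist_eq_norm, dist_eq_norm, mul_comm]
  refine h1.trans ?_
  gcongr
  have h2 : 0 ≤ T ^ (-1 / 2 : ℝ) := Real.rpow_nonneg (by linarith) _
  have h3 : 0 ≤ 2 * (2 + α) ^ 2 * Q := by positivity
  nlinarith [mul_nonneg h3 h2]

/-- The backward flow is uniformly Lipschitz, and the field gradient has the optimal decay. -/
theorem exists_regularity (h : IsDispersing α p C₀ f₀ f) {R : ℝ} (hR : 1 ≤ R)
    (hz : ∀ t, 0 ≤ t → ∀ z, ‖(phaseFlow α f t 0 z).1 - z.1‖ ≤ R) :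
    ∃ D : ℝ≥0, ∃ C : ℝ, 1 ≤ D ∧ 0 ≤ C ∧ (∀ t, 0 ≤ t → LipschitzWith D (phaseFlow α f t 0)) ∧
      ∀ t, 0 ≤ t → ∀ x, ‖fderiv ℝ (efield f t) x‖ ≤ C / (1 + t) ^ d := by
  have hα := h.alpha_nonneg
  obtain ⟨C, hC0, hC⟩ := h.exists_norm_fderiv_efield_le hR hz
  set κ := (2 + α) ^ 2 with hκ
  have hκ0 : 0 ≤ κ := by positivity
  -- Chosen so that `T₀^(-1/2) = 1/(1 + 4 κ C)`, which makes the feedback `C · 2 κ Q · T₀^(-1/2)` at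
  -- most `Q/2`.
  set T₀ : ℝ := (1 + 4 * κ * C) ^ 2 with hT₀
  have hq1 : 1 ≤ 1 + 4 * κ * C := by have : 0 ≤ 4 * κ * C := by positivity
                                     linarith
  have hT₀1 : 1 ≤ T₀ := by rw [hT₀]; nlinarith
  have hT₀pow : T₀ ^ (-1 / 2 : ℝ) = (1 + 4 * κ * C)⁻¹ := by
    rw [hT₀, ← Real.rpow_natCast, ← Real.rpow_mul (by linarith), ← Real.rpow_neg_one]
    norm_num
  obtain ⟨D₁, hD₁⟩ := h.isFlowField.exists_lipschitzWith_flow T₀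
  set D₀ : ℝ≥0 := max D₁ 1 with hD₀
  have hD₀1 : 1 ≤ D₀ := le_max_right _ _
  have hlip₀ : ∀ s, 0 ≤ s → s ≤ T₀ → LipschitzWith D₀ (phaseFlow α f s 0) := fun s hs hsT =>
    (hD₁ s 0 (by rwa [abs_of_nonneg hs]) (by rw [abs_zero]; linarith)).weaken (le_max_left _ _)
  set B := C * (1 + Real.log D₀) with hB
  have hlog₀ : 0 ≤ Real.log D₀ := Real.log_nonneg (by exact_mod_cast hD₀1)
  have hB0 : 0 ≤ B := by positivity
  -- the a priori bound improves itself
  have himp : ∀ T Q, 0 ≤ Q → (∀ s, T₀ ≤ s → s ≤ T → ∀ x,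
      ‖fderiv ℝ (efield f s) x‖ ≤ Q * s ^ (1 / 2 : ℝ) / s ^ d) →
      ∀ s, T₀ ≤ s → s ≤ T → ∀ x,
        ‖fderiv ℝ (efield f s) x‖ ≤ (B + Q / 2) * s ^ (1 / 2 : ℝ) / s ^ d := by
    intro T Q hQ hE s hs hsT x
    have hs1 : 1 ≤ s := hT₀1.trans hs
    have hlip := h.lipschitzWith_phaseFlow_of_decay hT₀1 hs hQ
      (fun r hr hrs => hE r hr (hrs.trans hsT)) (hlip₀ T₀ (by linarith) le_rfl)
    rw [← hκ, hT₀pow] at hlip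
    have h0 : 0 ≤ 2 * κ * Q * (1 + 4 * κ * C)⁻¹ := by positivity
    have hE1 : 1 ≤ (Real.exp (2 * κ * Q * (1 + 4 * κ * C)⁻¹)).toNNReal := by
      rw [Real.one_le_toNNReal]
      exact Real.one_le_exp h0
    refine (hC s hs1 _ (one_le_mul hD₀1 hE1) hlip x).trans ?_
    have e1 : Real.log ((D₀ * (Real.exp (2 * κ * Q * (1 + 4 * κ * C)⁻¹)).toNNReal : ℝ≥0) : ℝ)
        = Real.log D₀ + 2 * κ * Q * (1 + 4 * κ * C)⁻¹ := by
      push_cast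
      rw [Real.coe_toNNReal _ (Real.exp_pos _).le, Real.log_mul _ (Real.exp_pos _).ne',
        Real.log_exp]
      have : (1 : ℝ) ≤ D₀ := by exact_mod_cast hD₀1
      linarith
    rw [e1]
    have h1 : C * (2 * κ * Q * (1 + 4 * κ * C)⁻¹) ≤ Q / 2 := by
      rw [← div_eq_mul_inv, mul_div_assoc', div_le_iff₀ (by linarith)]
      nlinarith
    have h2 : 1 ≤ s ^ (1 / 2 : ℝ) := Real.one_le_rpow hs1 (by norm_num)
    have h3 : C * (1 + (Real.log D₀ + 2 * κ * Q * (1 + 4 * κ * C)⁻¹)) ≤ B + Q / 2 := by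
      rw [hB]; linarith
    refine div_le_div_of_nonneg_right ?_ (by positivity)
    nlinarith
  have hfin : ∀ s, T₀ ≤ s → ∀ x,
      ‖fderiv ℝ (efield f s) x‖ ≤ (2 * B) * s ^ (1 / 2 : ℝ) / s ^ d := by
    intro T hT
    obtain ⟨Q, hQ, hQT⟩ := h.exists_norm_fderiv_efield_le_of_le T
    have hT1 : 1 ≤ T := hT₀1.trans hT
    have hT0 : 0 < T := by linarith
    -- On a bounded interval some finite constant is available to start with. Each application of `Q
    -- ↦ B + Q/2` halves the excess over the fixed point `2 B`, so the limit bound does not depend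
    -- on `T`.
    have key : ∀ k : ℕ, ∀ s, T₀ ≤ s → s ≤ T → ∀ x, ‖fderiv ℝ (efield f s) x‖
        ≤ (2 * B + Q * T ^ d * (1 / 2) ^ k) * s ^ (1 / 2 : ℝ) / s ^ d := by
      intro k
      induction k with
      | zero =>
        intro s hs hsT x
        have hs1 : 1 ≤ s := hT₀1.trans hs
        have hs0 : 0 < s := by linarith
        refine (hQT s (by linarith) hsT x).trans ?_
        rw [le_div_iff₀ (by positivity)]
        have h2 : 1 ≤ s ^ (1 / 2 : ℝ) := Real.one_le_rpow hs1 (by norm_num)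
        have h3 : s ^ d ≤ T ^ d := by gcongr
        have h4 : Q * s ^ d ≤ Q * T ^ d := by gcongr
        have h5 : 0 ≤ Q * T ^ d := by positivity
        rw [pow_zero, mul_one]
        nlinarith
      | succ k ih =>
        have := himp T _ (by positivity) ih
        refine fun s hs hsT x => (this s hs hsT x).trans (le_of_eq ?_)
        ring
    intro x
    have hlim : Tendsto (fun k : ℕ => (2 * B + Q * T ^ d * (1 / 2) ^ k) * T ^ (1 / 2 : ℝ) / T ^ d)
        atTop (𝓝 ((2 * B + Q * T ^ d * 0) * T ^ (1 / 2 : ℝ) / T ^ d)) :=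
      (((tendsto_pow_atTop_nhds_zero_of_lt_one (by norm_num) (by norm_num)).const_mul _).const_add
        _).mul_const _ |>.div_const _
    rw [mul_zero, add_zero] at hlim
    exact ge_of_tendsto' hlim fun k => key k T hT le_rfl x
  set D : ℝ≥0 := D₀ * (Real.exp (2 * κ * (2 * B) * T₀ ^ (-1 / 2 : ℝ))).toNNReal with hD
  have hDD₀ : D₀ ≤ D := by
    refine le_mul_of_one_le_right' ?_
    rw [Real.one_le_toNNReal]
    refine Real.one_le_exp ?_
    rw [hT₀pow]
    positivity
  have hlip : ∀ t, 0 ≤ t → LipschitzWith D (phaseFlow α f t 0) := fun t ht => by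
    rcases le_total t T₀ with h1 | h1
    · exact (hlip₀ t ht h1).weaken hDD₀
    · exact h.lipschitzWith_phaseFlow_of_decay hT₀1 h1 (by positivity)
        (fun s hs _ => hfin s hs) (hlip₀ T₀ (by linarith) le_rfl)
  have hD1 : 1 ≤ D := hD₀1.trans hDD₀
  obtain ⟨C₁, hC₁, hC₁E⟩ := h.exists_norm_fderiv_efield_le_of_le 1
  have hlogD : 0 ≤ Real.log D := Real.log_nonneg (by exact_mod_cast hD1)
  refine ⟨D, (C₁ + C * (1 + Real.log D)) * 2 ^ d, hD1, by positivity, hlip, fun t ht x => ?_⟩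
  have hCD : 0 ≤ C * (1 + Real.log D) := by positivity
  rw [le_div_iff₀ (by positivity)]
  rcases le_total t 1 with h1 | h1
  · have h2 : (1 + t) ^ d ≤ 2 ^ d := by gcongr; linarith
    calc _ ≤ C₁ * 2 ^ d := by
          gcongr
          exact hC₁E t ht h1 x
      _ ≤ _ := by gcongr; linarith
  · have h2 : (1 + t) ^ d ≤ (2 * t) ^ d := by gcongr; linarith
    have h3 := hC t h1 D hD1 (hlip t ht) x
    calc _ ≤ (C * (1 + Real.log D) / t ^ d) * (2 * t) ^ d := by gcongr
      _ = C * (1 + Real.log D) * 2 ^ d := by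
        have : t ≠ 0 := by linarith
        rw [mul_pow]; field_simp
      _ ≤ _ := by gcongr; linarith

end IsDispersing

end VlasovPoisson

end

/-! ### Sharp decay of the field and weighted bounds on the distribution function -/

noncomputable section

namespace VlasovPoisson

open scoped NNReal ENNReal

variable {d : ℕ}

/-- The sharp decay of the field and the propagated bounds on the distribution function in the
coordinates that follow free transport. -/
structure SharpBounds (α p K : ℝ) (f : ℝ → Sp d → Sp d → ℝ) : Prop where
  const_nonneg : 0 ≤ K
  efield_le : ∀ t, 0 ≤ t → ∀ x, ‖efield f t x‖ ≤ K / (1 + t) ^ (d - 1)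
  fderiv_efield_le : ∀ t, 0 ≤ t → ∀ x, ‖fderiv ℝ (efield f t) x‖ ≤ K / (1 + t) ^ d
  sheared_le : ∀ t, 0 ≤ t → ∀ z, sheared α f t z ≤ K * (1 + ‖z.1‖) ^ (-p)
  fderiv_sheared_le : ∀ t, 0 ≤ t → ∀ z, ‖fderiv ℝ (sheared α f t) z‖ ≤ K * (1 + ‖z.1‖) ^ (-p)

theorem div_pow_le_of_le_one_add {C s t : ℝ} (n : ℕ) (hC : 0 ≤ C) (hs : 0 < s)
    (hst : 1 + t ≤ 2 * s) (ht : 0 ≤ t) : C / s ^ n ≤ C * 2 ^ n / (1 + t) ^ n := by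
  rw [div_le_div_iff₀ (by positivity) (by positivity)]
  have : (1 + t) ^ n ≤ (2 * s) ^ n := by gcongr
  rw [mul_pow] at this
  calc C * (1 + t) ^ n ≤ C * (2 ^ n * s ^ n) := by gcongr
    _ = _ := by ring

theorem rpow_scaled_weight_le {p R y : ℝ} (hp : 0 ≤ p) (hR : 1 ≤ R) (hy : 0 ≤ y) :
    (1 + y / R) ^ (-p) ≤ R ^ p * (1 + y) ^ (-p) := by
  have hR0 : 0 < R := by linarith
  have h1 : R⁻¹ * (1 + y) ≤ 1 + y / R := by
    have : R⁻¹ ≤ 1 := inv_le_one_of_one_le₀ hR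
    rw [mul_add, mul_one, div_eq_inv_mul]; linarith
  calc (1 + y / R) ^ (-p) ≤ (R⁻¹ * (1 + y)) ^ (-p) :=
        Real.rpow_le_rpow_of_nonpos (by positivity) h1 (by linarith)
    _ = _ := by
        rw [Real.mul_rpow (by positivity) (by positivity), Real.inv_rpow hR0.le,
          Real.rpow_neg hR0.le, inv_inv]

namespace IsDispersing

variable {α p C₀ : ℝ} {f₀ : Sp d → Sp d → ℝ} {f : ℝ → Sp d → Sp d → ℝ}

/-- Once the displacement is bounded by a constant `R`, the power of `R` in `norm_efield_le` is
harmless. The local bounds take care of times before `1`, and the weights at scale `R` are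
comparable with those at scale `1`. -/
theorem exists_sharpBounds (h : IsDispersing α p C₀ f₀ f) {a : ℝ}
    (ha : ((d : ℝ) ^ 2 - d - 4) / ((d : ℝ) ^ 2 - 2 * d - 2) < a) (hE : HasFieldDecay f a) :
    ∃ K : ℝ, SharpBounds α p K f := by
  have hd := h.four_le
  have hα := h.alpha_nonneg
  have hC₀ := h.const_nonneg
  have hp0 : 0 ≤ p := by have := h.lt_p; have : (0 : ℝ) ≤ d := d.cast_nonneg; linarith
  obtain ⟨R, hR, hz⟩ := h.exists_displacement_le ha hE
  obtain ⟨D, C, hD1, hC, hlip, hDE⟩ := h.exists_regularity hR hz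
  obtain ⟨K₁, hK₁, hE₁⟩ := h.norm_efield_le
  obtain ⟨K₂, hK₂, hE₂⟩ := h.exists_bound 1
  set A := K₁ * R ^ ((d : ℝ) - 1 - 2 / d) with hA
  set G := C₀ * 2 ^ p * R ^ p with hG
  have hA0 : 0 ≤ A := by positivity
  have hG0 : 0 ≤ G := by positivity
  have hD0 : (1 : ℝ) ≤ D := by exact_mod_cast hD1
  have hR0 : 0 < R := by linarith
  have hcast : (((d - 1 : ℕ) : ℝ)) = (d : ℝ) - 1 := by
    rw [Nat.cast_sub (by omega)]; simp
  have hw : ∀ z : Sp d × Sp d, (1 + ‖z.1‖ / R) ^ (-p) ≤ R ^ p * (1 + ‖z.1‖) ^ (-p) := fun z =>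
    rpow_scaled_weight_le hp0 hR (norm_nonneg _)
  have hP : (0 : ℝ) < 2 ^ (d - 1) := by positivity
  have hGD : G ≤ D * G := le_mul_of_one_le_left hG0 hD0
  have hS : 0 ≤ (A + K₂) * 2 ^ (d - 1) := by
    have : 0 ≤ K₂ := by linarith
    positivity
  refine ⟨(A + K₂) * 2 ^ (d - 1) + C + D * G, by positivity, ?_, ?_, ?_, ?_⟩
  · intro t ht x
    have key : ‖efield f t x‖ ≤ (A + K₂) * 2 ^ (d - 1) / (1 + t) ^ (d - 1) := by
      rcases le_total t 1 with h1 | h1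
      · have h2 := (hE₂ t (by rwa [abs_of_nonneg ht])).2.1 x
        have h3 := div_pow_le_of_le_one_add (C := A + K₂) (s := 1) (t := t) (d - 1) (by linarith)
          one_pos (by linarith) ht
        rw [one_pow, div_one] at h3
        linarith
      · have h2 := hE₁ t R h1 hR (hz t ht) x
        have h3 : (t + α) ^ (1 - (d : ℝ)) ≤ (t ^ (d - 1))⁻¹ := by
          rw [← Real.rpow_natCast, hcast, ← Real.rpow_neg ht, neg_sub]
          exact Real.rpow_le_rpow_of_nonpos (by linarith) (by linarith) (by
            have : (4 : ℝ) ≤ d := by exact_mod_cast hd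
            linarith)
        have h4 := div_pow_le_of_le_one_add (C := A + K₂) (s := t) (t := t) (d - 1) (by linarith)
          (by linarith) (by linarith) ht
        refine h2.trans (le_trans ?_ h4)
        calc _ = A * (t + α) ^ (1 - (d : ℝ)) := by rw [hA]; ring
          _ ≤ (A + K₂) * (t ^ (d - 1))⁻¹ := by gcongr; linarith
          _ = _ := rfl
    refine key.trans ?_
    gcongr
    nlinarith
  · intro t ht x
    refine (hDE t ht x).trans ?_
    gcongr
    nlinarith
  · intro t ht z
    refine (h.sheared_le ht hR (hz t ht z)).trans ?_
    calc _ ≤ C₀ * 2 ^ p * (R ^ p * (1 + ‖z.1‖) ^ (-p)) := by gcongr; exact hw z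
      _ = G * (1 + ‖z.1‖) ^ (-p) := by rw [hG]; ring
      _ ≤ _ := by gcongr; linarith
  · intro t ht z
    refine (h.norm_fderiv_sheared_le ht hR (hlip t ht) (hz t ht z)).trans ?_
    calc _ ≤ D * (C₀ * 2 ^ p * (R ^ p * (1 + ‖z.1‖) ^ (-p))) := by gcongr; exact hw z
      _ = D * G * (1 + ‖z.1‖) ^ (-p) := by rw [hG]; ring
      _ ≤ _ := by gcongr; linarith

end IsDispersing

end VlasovPoisson

end

noncomputable section

namespace VlasovPoisson

open scoped NNReal ENNReal

variable {d : ℕ}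

/-! ### Limits of functions with integrable time derivative -/

/-- The derivative is required for positive times only; the case `s = 0` follows by letting `s`
decrease to zero. The factor `1/(n+1)` from the integration is discarded. -/
theorem norm_sub_le_of_deriv_decay {F : Type*} [NormedAddCommGroup F] [NormedSpace ℝ F]
    {u u' : ℝ → F} {L : ℝ} (n : ℕ) (hc : ContinuousOn u (Ici 0))
    (hu : ∀ s, 0 < s → HasDerivAt u (u' s) s)
    (hL : ∀ s, 0 < s → ‖u' s‖ ≤ L / (1 + s) ^ (n + 2)) {s t : ℝ} (hs : 0 ≤ s) (hst : s ≤ t) :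
    ‖u t - u s‖ ≤ L / (1 + s) ^ (n + 1) := by
  have hL0 : 0 ≤ L := by
    have := (norm_nonneg _).trans (hL 1 one_pos)
    by_contra hneg
    exact absurd this (not_le.2 (div_neg_of_neg_of_pos (not_le.1 hneg) (by positivity)))
  have key : ∀ s, 0 < s → s ≤ t → ‖u t - u s‖ ≤ L / (1 + s) ^ (n + 1) := by
    intro s hs hst
    have hB : ∀ r ∈ Icc s t, HasDerivAt
        (fun r => L / (n + 1) * (((1 + s) ^ (n + 1))⁻¹ - ((1 + r) ^ (n + 1))⁻¹))
        (L / (1 + r) ^ (n + 2)) r := fun r hr => by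
      have hr0 : 1 + r ≠ 0 := by linarith [hr.1]
      have h1 := (((((hasDerivAt_id r).const_add 1).pow (n + 1)).inv
        (pow_ne_zero _ hr0)).const_sub ((1 + s) ^ (n + 1))⁻¹).const_mul (L / (n + 1))
      refine h1.congr_deriv ?_
      simp only [id, Pi.pow_apply, Nat.add_sub_cancel]
      have : (n : ℝ) + 1 ≠ 0 := by positivity
      push_cast
      field_simp
      ring
    have h2 := image_norm_le_of_norm_deriv_right_le_deriv_boundary' (f := fun r => u r - u s)
      (f' := u') (a := s) (b := t)
      (fun r hr => ((hu r (by linarith [hr.1])).sub_const _).continuousAt.continuousWithinAt)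
      (fun r hr => ((hu r (by linarith [hr.1])).sub_const _).hasDerivWithinAt)
      (B := fun r => L / (n + 1) * (((1 + s) ^ (n + 1))⁻¹ - ((1 + r) ^ (n + 1))⁻¹))
      (B' := fun r => L / (1 + r) ^ (n + 2)) (by simp)
      (fun r hr => (hB r hr).continuousAt.continuousWithinAt)
      (fun r hr => (hB r (Ico_subset_Icc_self hr)).hasDerivWithinAt)
      (fun r hr => hL r (by linarith [hr.1])) (right_mem_Icc.2 hst)
    refine h2.trans ?_
    have h3 : 0 ≤ ((1 + t) ^ (n + 1))⁻¹ := by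
      have : 0 ≤ 1 + t := by linarith
      positivity
    have h4 : L / (n + 1) ≤ L := div_le_self hL0 (by simp)
    calc _ ≤ L / (n + 1) * ((1 + s) ^ (n + 1))⁻¹ := by gcongr; linarith
      _ ≤ L * ((1 + s) ^ (n + 1))⁻¹ := by gcongr
  rcases hs.eq_or_lt with rfl | hs'
  · rcases hst.eq_or_lt with rfl | ht
    · simpa using hL0
    · have h1 : Tendsto (fun s => ‖u t - u s‖) (𝓝[>] 0) (𝓝 ‖u t - u 0‖) :=
        (((hc 0 self_mem_Ici).mono Ioi_subset_Ici_self).tendsto.const_sub _).norm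
      have h2 : Tendsto (fun s : ℝ => L / (1 + s) ^ (n + 1)) (𝓝[>] 0)
          (𝓝 (L / (1 + 0) ^ (n + 1))) := by
        refine Tendsto.mono_left (ContinuousAt.tendsto (x := (0 : ℝ)) ?_) nhdsWithin_le_nhds
        exact continuousAt_const.div (by fun_prop) (by norm_num)
      refine le_of_tendsto_of_tendsto h1 h2 ?_
      filter_upwards [Ioo_mem_nhdsGT ht] with s hs
      exact key s hs.1 hs.2.le
  · exact key s hs' hst

/-- The Cauchy bound gives a uniform, hence continuous, limit. Integrability does not follow from
uniform convergence on an infinite measure space; it comes from conservation of mass and Fatou,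
which yields only an inequality for the limiting mass. -/
theorem exists_uniform_limit {Z : Type*} [TopologicalSpace Z] [MeasureSpace Z] [BorelSpace Z]
    {u : ℝ → Z → ℝ} {L K m : ℝ} (n : ℕ) (hc : ∀ t, 0 ≤ t → Continuous (u t))
    (h0 : ∀ t, 0 ≤ t → ∀ z, 0 ≤ u t z) (hK : ∀ t, 0 ≤ t → ∀ z, u t z ≤ K)
    (hi : ∀ t, 0 ≤ t → Integrable (u t)) (hm : ∀ t, 0 ≤ t → ∫ z, u t z = m)
    (hL : ∀ s t, 0 ≤ s → s ≤ t → ∀ z, |u t z - u s z| ≤ L / (1 + s) ^ (n + 1)) :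
    ∃ w : Z → ℝ, Continuous w ∧ (∀ z, 0 ≤ w z ∧ w z ≤ K) ∧ Integrable w ∧ ∫ z, |w z| ≤ m ∧
      TendstoUniformly u w atTop ∧ ∀ t, 0 ≤ t → ∀ z, |u t z - w z| ≤ L / (1 + t) ^ (n + 1) := by
  have hlim0 : Tendsto (fun t : ℝ => L / (1 + t) ^ (n + 1)) atTop (𝓝 0) :=
    tendsto_const_nhds.div_atTop ((tendsto_pow_atTop (by omega)).comp
      (tendsto_atTop_add_const_left _ _ tendsto_id))
  have hlim : ∀ z, ∃ w, Tendsto (fun t => u t z) atTop (𝓝 w) := fun z => by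
    refine cauchySeq_tendsto_of_complete (Metric.cauchySeq_iff'.2 fun ε hε => ?_)
    obtain ⟨N, hN⟩ := ((hlim0.eventually (gt_mem_nhds hε)).and (eventually_ge_atTop 0)).exists
    exact ⟨N, fun t ht => (hL N t hN.2 ht z).trans_lt hN.1⟩
  choose w hw using hlim
  have hbound : ∀ t, 0 ≤ t → ∀ z, |u t z - w z| ≤ L / (1 + t) ^ (n + 1) := fun t ht z => by
    rw [abs_sub_comm]
    refine le_of_tendsto ((hw z).sub_const (u t z)).abs ?_
    filter_upwards [eventually_ge_atTop t] with s hs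
    exact hL t s ht hs z
  have hunif : TendstoUniformly u w atTop := by
    refine Metric.tendstoUniformly_iff.2 fun ε hε => ?_
    filter_upwards [hlim0.eventually (gt_mem_nhds hε), eventually_ge_atTop 0] with t h1 h2 z
    rw [dist_comm]
    exact (hbound t h2 z).trans_lt h1
  have hw0 : ∀ z, 0 ≤ w z := fun z => ge_of_tendsto (hw z)
    ((eventually_ge_atTop 0).mono fun t ht => h0 t ht z)
  have hcw : Continuous w :=
    hunif.continuous ((eventually_ge_atTop 0).mono fun t ht => hc t ht).frequently
  have hfatou : ∫⁻ z, ENNReal.ofReal (w z) ≤ ENNReal.ofReal m := by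
    have h1 := lintegral_liminf_le (μ := (volume : Measure Z)) (u := (atTop : Filter ℕ))
      (f := fun (k : ℕ) z => ENNReal.ofReal (u k z))
      fun k => (hc k k.cast_nonneg).measurable.ennreal_ofReal
    have h2 : ∀ z, liminf (fun k : ℕ => ENNReal.ofReal (u k z)) atTop = ENNReal.ofReal (w z) :=
      fun z => (ENNReal.tendsto_ofReal ((hw z).comp tendsto_natCast_atTop_atTop)).liminf_eq
    have h3 : ∀ k : ℕ, ∫⁻ z, ENNReal.ofReal (u k z) = ENNReal.ofReal m := fun k => by
      rw [← ofReal_integral_eq_lintegral_ofReal (hi k k.cast_nonneg)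
        (Eventually.of_forall (h0 k k.cast_nonneg)), hm k k.cast_nonneg]
    simpa only [h2, h3, liminf_const] using h1
  have hiw : Integrable w := by
    refine ⟨hcw.aestronglyMeasurable, ?_⟩
    rw [hasFiniteIntegral_iff_ofReal (Eventually.of_forall hw0)]
    exact hfatou.trans_lt ENNReal.ofReal_lt_top
  refine ⟨w, hcw, fun z => ⟨hw0 z, le_of_tendsto (hw z)
    ((eventually_ge_atTop 0).mono fun t ht => hK t ht z)⟩, hiw, ?_, hunif, hbound⟩
  have hm0 : 0 ≤ m := hm 0 le_rfl ▸ integral_nonneg (h0 0 le_rfl)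
  simp only [abs_of_nonneg (hw0 _)]
  rw [integral_eq_lintegral_of_nonneg_ae (Eventually.of_forall hw0) hcw.aestronglyMeasurable]
  exact ENNReal.toReal_le_of_le_ofReal hm0 hfatou

namespace IsDispersing

variable {α p C₀ K : ℝ} {f₀ : Sp d → Sp d → ℝ} {f : ℝ → Sp d → Sp d → ℝ}

/-! ### Scattering of the distribution function -/

theorem weight_le_one (h : IsDispersing α p C₀ f₀ f) (y : Sp d) : (1 + ‖y‖) ^ (-p) ≤ 1 :=
  Real.rpow_le_one_of_one_le_of_nonpos (by linarith [norm_nonneg y]) (by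
    have := h.lt_p
    have : (0 : ℝ) ≤ d := d.cast_nonneg
    linarith)

theorem time_le (h : IsDispersing α p C₀ f₀ f) {t : ℝ} (ht : 0 ≤ t) :
    t + α ≤ (1 + α) * (1 + t) := by
  have := h.alpha_nonneg; nlinarith

/-- The `y` component carries the factor `τ`, which costs one power of the decay of the field. -/
theorem norm_phaseField_le (h : IsDispersing α p C₀ f₀ f) (hK : SharpBounds α p K f) {t : ℝ}
    (ht : 0 ≤ t) (z : Sp d × Sp d) :
    ‖phaseField α (efield f) t z‖ ≤ (1 + α) * K / (1 + t) ^ (d - 2) := by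
  have hα := h.alpha_nonneg
  have hd := h.four_le
  have hK0 := hK.const_nonneg
  have h1 := hK.efield_le t ht (z.1 + (t + α) • z.2)
  set e := efield f t (z.1 + (t + α) • z.2)
  have h2 : (1 + α) * (1 + t) * ‖e‖ ≤ (1 + α) * K / (1 + t) ^ (d - 2) := by
    calc _ ≤ (1 + α) * (1 + t) * (K / (1 + t) ^ (d - 1)) := by gcongr
      _ = _ := by
        obtain ⟨k, rfl⟩ : ∃ k, d = k + 2 := ⟨d - 2, by omega⟩
        have : 1 + t ≠ 0 := by linarith
        rw [show k + 2 - 1 = k + 1 by omega, show k + 2 - 2 = k by omega, pow_succ]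
        field_simp
  refine le_trans (max_le ?_ ?_) h2
  · simp only [phaseField]
    rw [norm_neg, norm_smul, Real.norm_of_nonneg (by linarith : 0 ≤ t + α)]
    gcongr
    exact h.time_le ht
  · change ‖e‖ ≤ _
    exact le_mul_of_one_le_left (norm_nonneg _) (by nlinarith)

theorem norm_deriv_sheared_le (h : IsDispersing α p C₀ f₀ f) (hK : SharpBounds α p K f) {t : ℝ}
    (ht : 0 ≤ t) (z : Sp d × Sp d) :
    ‖-(fderiv ℝ (sheared α f t) z (phaseField α (efield f) t z))‖
      ≤ (1 + α) * K ^ 2 * (1 + ‖z.1‖) ^ (-p) / (1 + t) ^ (d - 2) := by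
  have hK0 := hK.const_nonneg
  rw [norm_neg]
  refine (ContinuousLinearMap.le_opNorm _ _).trans ?_
  calc _ ≤ (K * (1 + ‖z.1‖) ^ (-p)) * ((1 + α) * K / (1 + t) ^ (d - 2)) := by
        gcongr
        · exact hK.fderiv_sheared_le t ht z
        · exact h.norm_phaseField_le hK ht z
    _ = _ := by ring

theorem continuousOn_sheared_time (h : IsDispersing α p C₀ f₀ f) (z : Sp d × Sp d) :
    ContinuousOn (fun t => sheared α f t z) (Ici 0) :=
  (h.sol.continuousOn_sheared α).comp (f := fun t : ℝ => (t, z)) (by fun_prop)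
    fun t ht => ⟨ht, mem_univ _⟩

theorem abs_sheared_sub_time_le (h : IsDispersing α p C₀ f₀ f) (hK : SharpBounds α p K f)
    {s t : ℝ} (hs : 0 ≤ s) (hst : s ≤ t) (z : Sp d × Sp d) :
    |sheared α f t z - sheared α f s z| ≤ (1 + α) * K ^ 2 / (1 + s) ^ (d - 4 + 1) := by
  have hα := h.alpha_nonneg
  have hd := h.four_le
  -- The derivative decays with exponent `d - 2 = (d - 4) + 2`, hence the increment with exponent `d
  -- - 3`.
  refine norm_sub_le_of_deriv_decay (d - 4) (h.continuousOn_sheared_time z)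
    (fun r hr => h.sol.hasDerivAt_sheared α hr z) (fun r hr => ?_) hs hst
  refine (h.norm_deriv_sheared_le hK hr.le z).trans ?_
  rw [show d - 4 + 2 = d - 2 by omega]
  refine div_le_div_of_nonneg_right ?_ (by positivity)
  exact mul_le_of_le_one_right (by positivity) (h.weight_le_one _)

theorem exists_scattering_state (h : IsDispersing α p C₀ f₀ f) (hK : SharpBounds α p K f) :
    ∃ w : Sp d × Sp d → ℝ, Continuous w ∧ (∀ z, 0 ≤ w z ∧ w z ≤ K) ∧ Integrable w ∧
      TendstoUniformly (sheared α f) w atTop ∧ ∀ t, 0 ≤ t → ∀ z,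
        |sheared α f t z - w z| ≤ (1 + α) * K ^ 2 / (1 + t) ^ (d - 3) := by
  have hd := h.four_le
  obtain ⟨w, h1, h2, h3, -, h4, h5⟩ := exists_uniform_limit (d - 4) (K := K) (m := mass α f)
    (fun t ht => h.continuous_sheared ht) (fun t ht => h.sheared_nonneg ht)
    (fun t ht z => (hK.sheared_le t ht z).trans
      (mul_le_of_le_one_right hK.const_nonneg (h.weight_le_one _)))
    (fun t ht => h.integrable_sheared ht) (fun t ht => h.integral_sheared ht)
    (fun s t hs hst z => h.abs_sheared_sub_time_le hK hs hst z)
  rw [show d - 4 + 1 = d - 3 by omega] at h5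
  exact ⟨w, h1, h2, h3, h4, h5⟩

end IsDispersing

end VlasovPoisson

end

noncomputable section

namespace VlasovPoisson

open scoped NNReal ENNReal

variable {d : ℕ}

namespace IsDispersing

variable {α p C₀ K : ℝ} {f₀ : Sp d → Sp d → ℝ} {f : ℝ → Sp d → Sp d → ℝ}

/-! ### Convergence of the spatial average -/

theorem integrable_sheared_fst (h : IsDispersing α p C₀ f₀ f) (hK : SharpBounds α p K f) {t : ℝ}
    (ht : 0 ≤ t) (v : Sp d) : Integrable fun y => sheared α f t (y, v) := by
  refine (h.integrable_weight.const_mul K).mono'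
    ((h.continuous_sheared ht).comp (by fun_prop : Continuous fun y : Sp d => (y, v))
      ).aestronglyMeasurable (Eventually.of_forall fun y => ?_)
  rw [Real.norm_of_nonneg (h.sheared_nonneg ht _)]
  exact hK.sheared_le t ht (y, v)

theorem integrable_f_fst (h : IsDispersing α p C₀ f₀ f) (hK : SharpBounds α p K f) {t : ℝ}
    (ht : 0 ≤ t) (v : Sp d) : Integrable fun x => f t x v :=
  ((h.integrable_sheared_fst hK ht v).comp_sub_right ((t + α) • v)).congr
    (Eventually.of_forall fun x => (f_eq_sheared α t f x v).symm)

theorem spatialAverage_eq (α t : ℝ) (f : ℝ → Sp d → Sp d → ℝ) (v : Sp d) :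
    spatialAverage (f t) v = ∫ y, sheared α f t (y, v) := by
  rw [spatialAverage, ← integral_sub_right_eq_self (fun y => sheared α f t (y, v)) ((t + α) • v)]
  exact integral_congr_ae (Eventually.of_forall fun x => f_eq_sheared α t f x v)

theorem continuous_fderiv_efield (h : IsDispersing α p C₀ f₀ f) {t : ℝ} (ht : 0 ≤ t) :
    Continuous (fderiv ℝ (efield f t)) := by
  have e : efield f t = field (f t) := funext fun x => efield_of_nonneg f ht x
  rw [e, ← continuousOn_univ]
  exact h.sol.field_fderiv_continuousOn.comp (f := fun x : Sp d => (t, x)) (by fun_prop)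
    fun x _ => ⟨ht, mem_univ _⟩

theorem continuous_fderiv_sheared (h : IsDispersing α p C₀ f₀ f) {t : ℝ} (ht : 0 ≤ t) :
    Continuous (fderiv ℝ (sheared α f t)) :=
  (h.sol.contDiff_sheared α ht).continuous_fderiv (by simp)

theorem fderiv_sheared_slice (h : IsDispersing α p C₀ f₀ f) {t : ℝ} (ht : 0 ≤ t) (y v e : Sp d) :
    fderiv ℝ (fun y => sheared α f t (y, v)) y e = fderiv ℝ (sheared α f t) (y, v) (e, 0) := by
  have h1 : HasFDerivAt (fun y : Sp d => (y, v)) (ContinuousLinearMap.inl ℝ (Sp d) (Sp d)) y :=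
    hasFDerivAt_prodMk_left y v
  have h2 := ((h.sol.contDiff_sheared α ht).differentiable (by simp) (y, v)).hasFDerivAt.comp y h1
  have h3 : fderiv ℝ (fun y => sheared α f t (y, v)) y
      = (fderiv ℝ (sheared α f t) (y, v)).comp (ContinuousLinearMap.inl ℝ (Sp d) (Sp d)) :=
    h2.fderiv
  rw [h3]; rfl

theorem norm_single_one (i : Fin d) : ‖(EuclideanSpace.single i (1 : ℝ) : Sp d)‖ = 1 := by simp

theorem fderiv_efield_coord (h : IsDispersing α p C₀ f₀ f) {t : ℝ} (ht : 0 ≤ t) (u y : Sp d)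
    (i : Fin d) :
    HasFDerivAt (fun y => efield f t (y + u) i)
      ((EuclideanSpace.proj i : Sp d →L[ℝ] ℝ).comp (fderiv ℝ (efield f t) (y + u))) y := by
  have h1 : HasFDerivAt (fun y => efield f t (y + u)) (fderiv ℝ (efield f t) (y + u)) y :=
    (hasFDerivAt_comp_add_right u).2 (h.differentiable_efield ht (y + u)).hasFDerivAt
  exact (EuclideanSpace.proj i : Sp d →L[ℝ] ℝ).hasFDerivAt.comp y h1

/-- Integration by parts for the transport term. -/
theorem integral_efield_mul_fderiv (h : IsDispersing α p C₀ f₀ f) (hK : SharpBounds α p K f)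
    {t : ℝ} (ht : 0 ≤ t) (u v : Sp d) (i : Fin d) :
    Integrable (fun y => efield f t (y + u) i *
      fderiv ℝ (sheared α f t) (y, v) (EuclideanSpace.single i 1, 0)) ∧
    |∫ y, efield f t (y + u) i *
        fderiv ℝ (sheared α f t) (y, v) (EuclideanSpace.single i 1, 0)|
      ≤ K ^ 2 * weightIntegral d p / (1 + t) ^ d := by
  have hK0 := hK.const_nonneg
  set e : Sp d := EuclideanSpace.single i 1 with he
  have hen : ‖e‖ = 1 := norm_single_one i
  have hep : ‖((e, 0) : Sp d × Sp d)‖ = 1 := by simp [Prod.norm_def, hen]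
  have hEc : Continuous fun y => efield f t (y + u) i :=
    continuous_iff_continuousAt.2 fun y => (h.fderiv_efield_coord ht u y i).continuousAt
  have hcs : Continuous fun y => sheared α f t (y, v) :=
    (h.continuous_sheared ht).comp (by fun_prop)
  have hcd : Continuous fun y => fderiv ℝ (sheared α f t) (y, v) (e, 0) :=
    ((h.continuous_fderiv_sheared ht).comp
      (by fun_prop : Continuous fun y : Sp d => (y, v))).clm_apply continuous_const
  have hcE : Continuous fun y => fderiv ℝ (efield f t) (y + u) e i := by
    have h1 : Continuous fun y => fderiv ℝ (efield f t) (y + u) e :=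
      ((h.continuous_fderiv_efield ht).comp
        (by fun_prop : Continuous fun y : Sp d => y + u)).clm_apply continuous_const
    exact (EuclideanSpace.proj i : Sp d →L[ℝ] ℝ).continuous.comp h1
  have hE1 : ∀ y, fderiv ℝ (fun y => efield f t (y + u) i) y e
      = fderiv ℝ (efield f t) (y + u) e i := fun y => by
    rw [(h.fderiv_efield_coord ht u y i).fderiv]; rfl
  have hEle : ∀ y, |efield f t (y + u) i| ≤ K := fun y =>
    (PiLp.norm_apply_le (efield f t (y + u)) i).trans ((hK.efield_le t ht _).trans
      (div_le_self hK0 (one_le_pow₀ (by linarith))))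
  have hDEle : ∀ y, |fderiv ℝ (efield f t) (y + u) e i| ≤ K / (1 + t) ^ d := fun y => by
    refine (PiLp.norm_apply_le (fderiv ℝ (efield f t) (y + u) e) i).trans ?_
    refine (ContinuousLinearMap.le_opNorm _ _).trans ?_
    rw [hen, mul_one]
    exact hK.fderiv_efield_le t ht _
  have hsle : ∀ y, |sheared α f t (y, v)| ≤ K * (1 + ‖y‖) ^ (-p) := fun y => by
    rw [abs_of_nonneg (h.sheared_nonneg ht _)]
    exact hK.sheared_le t ht (y, v)
  have hdsle : ∀ y, |fderiv ℝ (sheared α f t) (y, v) (e, 0)| ≤ K * (1 + ‖y‖) ^ (-p) := fun y => by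
    rw [← Real.norm_eq_abs]
    refine (ContinuousLinearMap.le_opNorm _ _).trans ?_
    rw [hep, mul_one]
    exact hK.fderiv_sheared_le t ht (y, v)
  have hwi := h.integrable_weight.const_mul K
  have hi1 : Integrable fun y => efield f t (y + u) i * fderiv ℝ (sheared α f t) (y, v) (e, 0) := by
    refine (hwi.const_mul K).mono' (hEc.mul hcd).aestronglyMeasurable
      (Eventually.of_forall fun y => ?_)
    rw [norm_mul]
    exact mul_le_mul (hEle y) (hdsle y) (norm_nonneg _) hK0
  have hi2 : Integrable fun y => fderiv ℝ (efield f t) (y + u) e i * sheared α f t (y, v) := by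
    refine (hwi.const_mul (K / (1 + t) ^ d)).mono' (hcE.mul hcs).aestronglyMeasurable
      (Eventually.of_forall fun y => ?_)
    rw [norm_mul]
    exact mul_le_mul (hDEle y) (hsle y) (norm_nonneg _) (by positivity)
  have hi3 : Integrable fun y => efield f t (y + u) i * sheared α f t (y, v) := by
    refine (hwi.const_mul K).mono' (hEc.mul hcs).aestronglyMeasurable
      (Eventually.of_forall fun y => ?_)
    rw [norm_mul]
    exact mul_le_mul (hEle y) (hsle y) (norm_nonneg _) hK0
  refine ⟨hi1, ?_⟩
  have hparts := integral_mul_fderiv_eq_neg_fderiv_mul_of_integrable (μ := (volume : Measure (Sp d)))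
    (𝕜 := ℝ) (f := fun y => efield f t (y + u) i) (g := fun y => sheared α f t (y, v)) (v := e)
    (by simpa only [hE1] using hi2) (by simpa only [h.fderiv_sheared_slice ht] using hi1) hi3
    (fun y _ => (h.fderiv_efield_coord ht u y i).differentiableAt)
    (fun y _ => ((h.sol.contDiff_sheared α ht).differentiable (by simp)).comp
      (by fun_prop : Differentiable ℝ fun y : Sp d => (y, v)) y)
  simp only [hE1, h.fderiv_sheared_slice ht] at hparts
  rw [hparts, abs_neg, ← Real.norm_eq_abs]
  calc _ ≤ ∫ y : Sp d, K / (1 + t) ^ d * (K * (1 + ‖y‖) ^ (-p)) := by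
        refine norm_integral_le_of_norm_le (hwi.const_mul _) (Eventually.of_forall fun y => ?_)
        rw [norm_mul]
        exact mul_le_mul (hDEle y) (hsle y) (norm_nonneg _) (by positivity)
    _ = _ := by rw [integral_const_mul, integral_const_mul, weightIntegral]; ring

/-- The integrated derivative decays one power faster than the pointwise one. In `τ E · ∇_y g` the
derivative is moved onto `E`, giving `τ ∇E ≲ (1+t)^(1-d)`; the term `E · ∇_v g` lacks the factor `τ`
and has that rate already. -/
theorem abs_integral_deriv_sheared_le (h : IsDispersing α p C₀ f₀ f) (hK : SharpBounds α p K f)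
    {t : ℝ} (ht : 0 ≤ t) (v : Sp d) :
    |∫ y, -(fderiv ℝ (sheared α f t) (y, v) (phaseField α (efield f) t (y, v)))|
      ≤ (1 + α) * (d + 1) * K ^ 2 * weightIntegral d p / (1 + t) ^ (d - 1) := by
  have hα := h.alpha_nonneg
  have hd := h.four_le
  have hK0 := hK.const_nonneg
  have hI := weightIntegral_nonneg d p
  set τ := t + α with hτ
  have hτ0 : 0 ≤ τ := by linarith
  set u := τ • v with hu
  have hwi := h.integrable_weight.const_mul K
  have hEc : Continuous fun y => efield f t (y + u) :=
    (h.differentiable_efield ht).continuous.comp (by fun_prop)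
  have hc2 : Continuous fun y => fderiv ℝ (sheared α f t) (y, v) (0, efield f t (y + u)) :=
    ((h.continuous_fderiv_sheared ht).comp
      (by fun_prop : Continuous fun y : Sp d => (y, v))).clm_apply (by fun_prop)
  have hle2 : ∀ y, ‖fderiv ℝ (sheared α f t) (y, v) (0, efield f t (y + u))‖
      ≤ K / (1 + t) ^ (d - 1) * (K * (1 + ‖y‖) ^ (-p)) := fun y => by
    refine (ContinuousLinearMap.le_opNorm _ _).trans ?_
    rw [mul_comm]
    refine mul_le_mul ?_ (hK.fderiv_sheared_le t ht (y, v)) (norm_nonneg _) (by positivity)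
    simpa [Prod.norm_def] using hK.efield_le t ht (y + u)
  have hi2 : Integrable fun y => fderiv ℝ (sheared α f t) (y, v) (0, efield f t (y + u)) :=
    (hwi.const_mul _).mono' hc2.aestronglyMeasurable (Eventually.of_forall hle2)
  have hI2 : |∫ y, fderiv ℝ (sheared α f t) (y, v) (0, efield f t (y + u))|
      ≤ K ^ 2 * weightIntegral d p / (1 + t) ^ (d - 1) := by
    refine (norm_integral_le_of_norm_le (hwi.const_mul _)
      (Eventually.of_forall hle2)).trans (le_of_eq ?_)
    rw [integral_const_mul, integral_const_mul, weightIntegral]; ring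
  have hpart := fun i => h.integral_efield_mul_fderiv hK ht u v i
  -- Coordinates are separated so that each summand can be integrated by parts in its own direction.
  have hsum : ∀ y, -(fderiv ℝ (sheared α f t) (y, v) (phaseField α (efield f) t (y, v)))
      = τ * (∑ i, efield f t (y + u) i *
          fderiv ℝ (sheared α f t) (y, v) (EuclideanSpace.single i 1, 0))
        - fderiv ℝ (sheared α f t) (y, v) (0, efield f t (y + u)) := fun y => by
    set E := efield f t (y + u) with hE
    have e1 : E = ∑ i, E i • (EuclideanSpace.single i (1 : ℝ) : Sp d) := by
      have := (EuclideanSpace.basisFun (Fin d) ℝ).sum_repr E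
      simpa using this.symm
    have e2 : phaseField α (efield f) t (y, v)
        = -(τ • ∑ i, E i • ((EuclideanSpace.single i (1 : ℝ) : Sp d), (0 : Sp d))) + (0, E) := by
      have e3 : ∑ i, E i • ((EuclideanSpace.single i (1 : ℝ) : Sp d), (0 : Sp d)) = (E, 0) := by
        conv_rhs => rw [e1]
        ext1
        · simp [Prod.fst_sum]
        · simp [Prod.snd_sum]
      rw [e3]
      simp [phaseField, hE, hu, hτ]
    rw [e2, map_add, map_neg, map_smul, map_sum]
    simp only [map_smul, smul_eq_mul]
    ring
  simp only [hsum]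
  rw [integral_sub ((integrable_finsetSum _ fun i _ => (hpart i).1).const_mul τ) hi2,
    integral_const_mul, integral_finsetSum _ fun i _ => (hpart i).1]
  have h1 : |∑ i, ∫ y, efield f t (y + u) i *
      fderiv ℝ (sheared α f t) (y, v) (EuclideanSpace.single i 1, 0)|
      ≤ d * (K ^ 2 * weightIntegral d p / (1 + t) ^ d) := by
    refine (Finset.abs_sum_le_sum_abs _ _).trans ?_
    refine (Finset.sum_le_card_nsmul _ _ _ fun i _ => (hpart i).2).trans (le_of_eq ?_)
    simp
  have h2 : τ * (d * (K ^ 2 * weightIntegral d p / (1 + t) ^ d))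
      ≤ (1 + α) * d * K ^ 2 * weightIntegral d p / (1 + t) ^ (d - 1) := by
    calc _ ≤ ((1 + α) * (1 + t)) * (d * (K ^ 2 * weightIntegral d p / (1 + t) ^ d)) := by
          gcongr
          exact h.time_le ht
      _ = _ := by
        obtain ⟨k, hk⟩ : ∃ k, d = k + 1 := ⟨d - 1, by omega⟩
        have : 1 + t ≠ 0 := by linarith
        rw [show d - 1 = k by omega, show (1 + t) ^ d = (1 + t) ^ k * (1 + t) by
          rw [hk, pow_succ]]
        field_simp
  have h3 : K ^ 2 * weightIntegral d p / (1 + t) ^ (d - 1)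
      ≤ (1 + α) * (K ^ 2 * weightIntegral d p / (1 + t) ^ (d - 1)) :=
    le_mul_of_one_le_left (by positivity) (by linarith)
  refine (abs_sub _ _).trans ?_
  rw [abs_mul, abs_of_nonneg hτ0]
  calc _ ≤ τ * (d * (K ^ 2 * weightIntegral d p / (1 + t) ^ d))
        + K ^ 2 * weightIntegral d p / (1 + t) ^ (d - 1) := by gcongr
    _ ≤ (1 + α) * d * K ^ 2 * weightIntegral d p / (1 + t) ^ (d - 1)
        + (1 + α) * (K ^ 2 * weightIntegral d p / (1 + t) ^ (d - 1)) := by gcongr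
    _ = _ := by ring

theorem hasDerivAt_spatialAverage (h : IsDispersing α p C₀ f₀ f) (hK : SharpBounds α p K f)
    {t : ℝ} (ht : 0 < t) (v : Sp d) :
    HasDerivAt (fun t => spatialAverage (f t) v)
      (∫ y, -(fderiv ℝ (sheared α f t) (y, v) (phaseField α (efield f) t (y, v)))) t := by
  have hα := h.alpha_nonneg
  have hwi := h.integrable_weight.const_mul ((1 + α) * K ^ 2)
  have hEc : Continuous fun y : Sp d => phaseField α (efield f) t (y, v) := by
    have := (h.differentiable_efield ht.le).continuous
    unfold phaseField
    fun_prop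
  simp only [spatialAverage_eq α]
  refine (hasDerivAt_integral_of_dominated_loc_of_deriv_le (Ioi_mem_nhds ht)
    (F' := fun t y => -(fderiv ℝ (sheared α f t) (y, v) (phaseField α (efield f) t (y, v))))
    (bound := fun y : Sp d => (1 + α) * K ^ 2 * (1 + ‖y‖) ^ (-p)) ?_
    (h.integrable_sheared_fst hK ht.le v) ?_ ?_ hwi ?_).2
  · filter_upwards [Ioi_mem_nhds ht] with s hs
    exact (h.integrable_sheared_fst hK (le_of_lt hs) v).1
  · exact (((h.continuous_fderiv_sheared ht.le).comp
      (by fun_prop : Continuous fun y : Sp d => (y, v))).clm_apply hEc).neg.aestronglyMeasurable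
  · refine Eventually.of_forall fun y s hs => (h.norm_deriv_sheared_le hK (le_of_lt hs) _).trans ?_
    exact div_le_self (by positivity) (one_le_pow₀ (by linarith [mem_Ioi.1 hs]))
  · exact Eventually.of_forall fun y s hs => h.sol.hasDerivAt_sheared α hs (y, v)

theorem continuousOn_spatialAverage (h : IsDispersing α p C₀ f₀ f) (hK : SharpBounds α p K f)
    (v : Sp d) : ContinuousOn (fun t => spatialAverage (f t) v) (Ici 0) := by
  simp only [spatialAverage_eq α]
  refine continuousOn_of_dominated (bound := fun y : Sp d => K * (1 + ‖y‖) ^ (-p))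
    (fun t ht => (h.integrable_sheared_fst hK ht v).1)
    (fun t ht => Eventually.of_forall fun y => ?_) (h.integrable_weight.const_mul K)
    (Eventually.of_forall fun y => h.continuousOn_sheared_time (y, v))
  rw [Real.norm_of_nonneg (h.sheared_nonneg ht _)]
  exact hK.sheared_le t ht (y, v)

theorem continuous_spatialAverage (h : IsDispersing α p C₀ f₀ f) (hK : SharpBounds α p K f)
    {t : ℝ} (ht : 0 ≤ t) : Continuous (spatialAverage (f t)) := by
  have e : spatialAverage (f t) = fun v => ∫ y, sheared α f t (y, v) :=
    funext fun v => spatialAverage_eq α t f v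
  rw [e]
  refine continuous_of_dominated (bound := fun y : Sp d => K * (1 + ‖y‖) ^ (-p))
    (fun v => (h.integrable_sheared_fst hK ht v).1)
    (fun v => Eventually.of_forall fun y => ?_) (h.integrable_weight.const_mul K)
    (Eventually.of_forall fun y => (h.continuous_sheared ht).comp (by fun_prop))
  rw [Real.norm_of_nonneg (h.sheared_nonneg ht _)]
  exact hK.sheared_le t ht (y, v)

theorem exists_limit_spatialAverage (h : IsDispersing α p C₀ f₀ f) (hK : SharpBounds α p K f) :
    ∃ w : Sp d → ℝ, Continuous w ∧ (∀ v, 0 ≤ w v ∧ w v ≤ K * weightIntegral d p) ∧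
      Integrable w ∧ ∫ v, |w v| ≤ mass α f ∧
      TendstoUniformly (fun t => spatialAverage (f t)) w atTop ∧ ∀ t, 0 ≤ t → ∀ v,
        |spatialAverage (f t) v - w v|
          ≤ (1 + α) * (d + 1) * K ^ 2 * weightIntegral d p / (1 + t) ^ (d - 2) := by
  have hd := h.four_le
  have hi : ∀ t, 0 ≤ t → Integrable (spatialAverage (f t)) ∧
      ∫ v, spatialAverage (f t) v = mass α f := fun t ht => by
    have e : spatialAverage (f t) = fun v => ∫ y, sheared α f t (y, v) :=
      funext fun v => spatialAverage_eq α t f v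
    rw [e]
    refine ⟨(h.integrable_sheared ht).integral_prod_right, ?_⟩
    rw [← h.integral_sheared ht]
    exact (integral_prod_symm _ (h.integrable_sheared ht)).symm
  have := exists_uniform_limit (d - 3) (u := fun t => spatialAverage (f t))
    (K := K * weightIntegral d p) (m := mass α f)
    (L := (1 + α) * (d + 1) * K ^ 2 * weightIntegral d p)
    (fun t ht => h.continuous_spatialAverage hK ht)
    (fun t ht v => integral_nonneg fun x => h.f_nonneg ht x v)
    (fun t ht v => by
      rw [spatialAverage_eq α, weightIntegral, ← integral_const_mul]
      exact integral_mono (h.integrable_sheared_fst hK ht v) (h.integrable_weight.const_mul K)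
        fun y => hK.sheared_le t ht (y, v))
    (fun t ht => (hi t ht).1) (fun t ht => (hi t ht).2)
    (fun s t hs hst v => norm_sub_le_of_deriv_decay (d - 3) (h.continuousOn_spatialAverage hK v)
      (fun r hr => h.hasDerivAt_spatialAverage hK hr v)
      (fun r hr => by
        rw [show d - 3 + 2 = d - 1 by omega]
        exact h.abs_integral_deriv_sheared_le hK hr.le v) hs hst)
  rwa [show d - 3 + 1 = d - 2 by omega] at this

end IsDispersing

end VlasovPoisson

end

noncomputable section

namespace VlasovPoisson

open scoped NNReal ENNReal

variable {d : ℕ}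

/-! ### Self-similar profiles -/

theorem kernel_smul (hd : 1 ≤ d) {τ : ℝ} (hτ : 0 < τ) (z : Sp d) :
    kernel (τ • z) = (τ ^ (d - 1))⁻¹ • kernel z := by
  rw [kernel_eq, kernel_eq, norm_smul, Real.norm_of_nonneg hτ.le, smul_smul, smul_smul, mul_pow]
  congr 1
  obtain ⟨k, rfl⟩ : ∃ k, d = k + 1 := ⟨d - 1, by omega⟩
  rw [Nat.add_sub_cancel, pow_succ τ]
  rcases eq_or_ne ‖z‖ 0 with hz | hz
  · simp [hz]
  · have := sphereArea_pos (d := k + 1) (by omega)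
    field_simp

/-- The kernel is homogeneous of degree `1 - d`; this reduces the profile of the field to comparing
the fields of two densities in the variable `x/τ`. -/
theorem gradInvLaplacian_scale (hd : 1 ≤ d) {τ : ℝ} (hτ : 0 < τ) (ρ : Sp d → ℝ) (x : Sp d) :
    τ ^ (d - 1) • gradInvLaplacian ρ x
      = gradInvLaplacian (fun u => τ ^ d * ρ (τ • u)) (τ⁻¹ • x) := by
  have h1 := Measure.integral_comp_smul (volume : Measure (Sp d)) (fun y => ρ y • kernel (x - y)) τ
  rw [finrank_euclideanSpace_fin, abs_of_pos (by positivity)] at h1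
  have h2 : ∀ u : Sp d, ρ (τ • u) • kernel (x - τ • u)
      = (τ ^ (d - 1))⁻¹ • (ρ (τ • u) • kernel (τ⁻¹ • x - u)) := fun u => by
    have : x - τ • u = τ • (τ⁻¹ • x - u) := by
      rw [smul_sub, smul_smul, mul_inv_cancel₀ hτ.ne', one_smul]
    rw [this, kernel_smul hd hτ, smul_comm]
  simp only [h2] at h1
  rw [integral_smul] at h1
  have h3 : gradInvLaplacian ρ x
      = τ ^ d • (τ ^ (d - 1))⁻¹ • ∫ u, ρ (τ • u) • kernel (τ⁻¹ • x - u) := by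
    rw [h1, smul_smul, mul_inv_cancel₀ (by positivity), one_smul]; rfl
  rw [h3, smul_comm (τ ^ d), smul_smul, mul_inv_cancel₀ (by positivity), one_smul,
    ← integral_smul]
  refine integral_congr_ae (Eventually.of_forall fun u => ?_)
  simp only [smul_smul]

theorem norm_gradInvLaplacian_le (hd : 2 ≤ d) {φ : Sp d → ℝ} {A m r : ℝ} (hφ : Integrable φ)
    (hA : ∀ y, |φ y| ≤ A) (hm : ∫ y, |φ y| ≤ m) (hr : 0 < r) (x : Sp d) :
    ‖gradInvLaplacian φ x‖ ≤ A * r + (sphereArea d)⁻¹ * (m / r ^ (d - 1)) := by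
  have hκ := sphereArea_pos (d := d) (by omega)
  have h1 := integral_mul_radialKernel_le (d := d) (by omega) hφ hA hm hr x
  calc ‖gradInvLaplacian φ x‖ ≤ ∫ y, (sphereArea d)⁻¹ * (|φ y| * radialKernel (x - y)) := by
        refine norm_integral_le_of_norm_le (h1.1.const_mul _) (Eventually.of_forall fun y => ?_)
        rw [norm_smul, norm_kernel hd, Real.norm_eq_abs]
        exact le_of_eq (by ring)
    _ ≤ (sphereArea d)⁻¹ * (A * (sphereArea d * r) + m / r ^ (d - 1)) := by
        rw [integral_const_mul]
        exact mul_le_mul_of_nonneg_left h1.2 (inv_nonneg.2 hκ.le)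
    _ = _ := by field_simp

theorem gradInvLaplacian_sub (hd : 2 ≤ d) {φ ψ : Sp d → ℝ} {A B : ℝ} (hφ : Integrable φ)
    (hψ : Integrable ψ) (hA : ∀ y, |φ y| ≤ A) (hB : ∀ y, |ψ y| ≤ B) (x : Sp d) :
    gradInvLaplacian φ x - gradInvLaplacian ψ x = gradInvLaplacian (fun y => φ y - ψ y) x := by
  rw [gradInvLaplacian, gradInvLaplacian, ← integral_sub (integrable_smul_kernel hd hφ hA x)
    (integrable_smul_kernel hd hψ hB x), gradInvLaplacian]
  simp only [sub_smul]

namespace IsDispersing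

variable {α p C₀ K : ℝ} {f₀ : Sp d → Sp d → ℝ} {f : ℝ → Sp d → Sp d → ℝ}

theorem integrable_weight_one (h : IsDispersing α p C₀ f₀ f) :
    Integrable fun u : Sp d => (1 + ‖u‖) ^ (-(p - 1)) :=
  integrable_one_add_norm (by simp; linarith [h.lt_p])

theorem weight_mul_norm_le (p : ℝ) (y : Sp d) :
    (1 + ‖y‖) ^ (-p) * ‖y‖ ≤ (1 + ‖y‖) ^ (-(p - 1)) := by
  have h0 : 0 < 1 + ‖y‖ := by positivity
  have e : (1 + ‖y‖) ^ (-(p - 1)) = (1 + ‖y‖) ^ (-p) * (1 + ‖y‖) := by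
    rw [neg_sub, sub_eq_neg_add, Real.rpow_add h0, Real.rpow_one]
  rw [e]
  gcongr
  linarith

theorem abs_sheared_sub_le_of_sharpBounds (h : IsDispersing α p C₀ f₀ f)
    (hK : SharpBounds α p K f) {t : ℝ} (ht : 0 ≤ t) (y w w' : Sp d) :
    |sheared α f t (y, w) - sheared α f t (y, w')| ≤ K * (1 + ‖y‖) ^ (-p) * ‖w - w'‖ := by
  have hconv : Convex ℝ {z : Sp d × Sp d | z.1 = y} :=
    (convex_singleton y).linear_preimage (LinearMap.fst ℝ (Sp d) (Sp d))
  have := hconv.norm_image_sub_le_of_norm_fderiv_le (𝕜 := ℝ) (f := sheared α f t)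
    (C := K * (1 + ‖y‖) ^ (-p)) (x := (y, w')) (y := (y, w))
    (fun z _ => (h.sol.contDiff_sheared α ht).differentiable (by simp) z)
    (fun z hzy => by
      have h1 := hK.fderiv_sheared_le t ht z
      rwa [show z.1 = y from hzy] at h1) rfl rfl
  simpa [Prod.norm_def] using this

/-- Both sides integrate `g` over `y`, at velocities that differ by `y/τ`. The Lipschitz bound in
velocity leaves the weight `|y| (1 + |y|)^(-p)`, which is integrable because `p > d + 1`. -/
theorem abs_density_sub_spatialAverage_le (h : IsDispersing α p C₀ f₀ f)
    (hK : SharpBounds α p K f) {t : ℝ} (ht : 0 ≤ t) (hτ : 0 < t + α) (x : Sp d) :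
    |(t + α) ^ d * density (f t) x - spatialAverage (f t) ((t + α)⁻¹ • x)|
      ≤ K * weightIntegral d (p - 1) / (t + α) := by
  have hK0 := hK.const_nonneg
  set τ := t + α
  have hw := h.integrable_weight_one.const_mul (K / τ)
  rw [density_eq_integral f hτ, spatialAverage_eq α, ← integral_sub
    (h.integrable_sheared_slice ht hτ x) (h.integrable_sheared_fst hK ht _), ← Real.norm_eq_abs]
  refine (norm_integral_le_of_norm_le hw (Eventually.of_forall fun y => ?_)).trans
    (le_of_eq ?_)
  · rw [Real.norm_eq_abs]
    refine (h.abs_sheared_sub_le_of_sharpBounds hK ht _ _ _).trans ?_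
    rw [← smul_sub, sub_sub_cancel_left, norm_smul, norm_neg, Real.norm_of_nonneg (by positivity)]
    calc _ = K / τ * ((1 + ‖y‖) ^ (-p) * ‖y‖) := by ring
      _ ≤ _ := by gcongr; exact weight_mul_norm_le p y
  · rw [integral_const_mul, weightIntegral]; ring

/-- Writing `v = x/τ - y/τ` under the integral, the first term produces the density times `x/τ`, and
the second is `1/τ` times a bounded first moment in `y`. -/
theorem current_profile (h : IsDispersing α p C₀ f₀ f) (hK : SharpBounds α p K f) {t : ℝ}
    (ht : 0 ≤ t) (hτ : 0 < t + α) (x : Sp d) :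
    Integrable (fun v => f t x v • v) ∧
    ‖(t + α) ^ d • current (f t) x - ((t + α) ^ d * density (f t) x) • ((t + α)⁻¹ • x)‖
      ≤ K * weightIntegral d (p - 1) / (t + α) := by
  have hK0 := hK.const_nonneg
  set τ := t + α with hτdef
  have hw := h.integrable_weight_one.const_mul K
  have hg := h.integrable_sheared_slice ht hτ x
  have hgc : Continuous fun y => sheared α f t (y, τ⁻¹ • (x - y)) :=
    (h.continuous_sheared ht).comp (by fun_prop)
  have hgy : ∀ y, ‖sheared α f t (y, τ⁻¹ • (x - y)) • y‖ ≤ K * (1 + ‖y‖) ^ (-(p - 1)) :=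
    fun y => by
      rw [norm_smul, Real.norm_of_nonneg (h.sheared_nonneg ht _)]
      calc _ ≤ K * (1 + ‖y‖) ^ (-p) * ‖y‖ := by
            gcongr
            exact hK.sheared_le t ht (y, _)
        _ = K * ((1 + ‖y‖) ^ (-p) * ‖y‖) := by ring
        _ ≤ _ := by gcongr; exact weight_mul_norm_le p y
  have hgyi : Integrable fun y => sheared α f t (y, τ⁻¹ • (x - y)) • y :=
    hw.mono' (hgc.smul continuous_id).aestronglyMeasurable (Eventually.of_forall hgy)
  have e : ∀ y, f t x (τ⁻¹ • (x - y)) • (τ⁻¹ • (x - y))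
      = sheared α f t (y, τ⁻¹ • (x - y)) • (τ⁻¹ • x)
        - τ⁻¹ • (sheared α f t (y, τ⁻¹ • (x - y)) • y) := fun y => by
    rw [f_eq_sheared α t f, ← hτdef, smul_smul τ, mul_inv_cancel₀ hτ.ne', one_smul, sub_sub_cancel]
    module
  have hi1 : Integrable fun y => sheared α f t (y, τ⁻¹ • (x - y)) • (τ⁻¹ • x) :=
    hg.smul_const _
  have hi2 : Integrable fun y => τ⁻¹ • (sheared α f t (y, τ⁻¹ • (x - y)) • y) := hgyi.smul τ⁻¹
  refine ⟨(integrable_comp_inv_smul_sub_iff hτ x fun v => f t x v • v).1 ?_, ?_⟩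
  · simp only [e]
    exact hi1.sub hi2
  · have h1 : τ ^ d • current (f t) x = (τ ^ d * density (f t) x) • (τ⁻¹ • x)
        - τ⁻¹ • ∫ y, sheared α f t (y, τ⁻¹ • (x - y)) • y := by
      rw [current, ← integral_comp_inv_smul_sub hτ x fun v => f t x v • v]
      simp only [e]
      rw [integral_sub hi1 hi2, integral_smul_const, integral_smul, density_eq_integral f hτ]
    rw [h1, sub_sub_cancel_left, norm_neg, norm_smul, Real.norm_of_nonneg (by positivity)]
    have h2 := norm_integral_le_of_norm_le hw (Eventually.of_forall hgy)
    rw [integral_const_mul] at h2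
    calc _ ≤ τ⁻¹ * (K * weightIntegral d (p - 1)) := by gcongr; exact h2
      _ = _ := by ring

/-- The rescaled density and its limit differ by `O(1/τ)` in sup norm but only by `O(1)` in mass,
and the potential estimate interpolates between the two. -/
theorem norm_field_sub_profile_le (h : IsDispersing α p C₀ f₀ f) {t A B : ℝ} (ht : 0 ≤ t)
    (hτ : 0 < t + α) {w : Sp d → ℝ} (hw : Integrable w) (hB : ∀ v, |w v| ≤ B)
    (hm : ∫ v, |w v| ≤ mass α f)
    (hA : ∀ x, |(t + α) ^ d * density (f t) x - w ((t + α)⁻¹ • x)| ≤ A / (t + α)) (x : Sp d) :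
    ‖(t + α) ^ (d - 1) • field (f t) x - gradInvLaplacian w ((t + α)⁻¹ • x)‖
      ≤ (A + (sphereArea d)⁻¹ * (2 * mass α f)) * (t + α) ^ ((1 - (d : ℝ)) / d) := by
  have hd := h.four_le
  set τ := t + α
  have hd0 : (d : ℝ) ≠ 0 := by positivity
  have hA' : ∀ u, |τ ^ d * density (f t) (τ • u) - w u| ≤ A / τ := fun u => by
    have := hA (τ • u)
    rwa [smul_smul, inv_mul_cancel₀ hτ.ne', one_smul] at this
  have hρi : Integrable fun u => τ ^ d * density (f t) (τ • u) :=
    ((h.integrable_density ht).comp_smul hτ.ne').const_mul _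
  have hρm : ∫ u, |τ ^ d * density (f t) (τ • u)| = mass α f := by
    simp only [abs_mul, abs_of_pos (pow_pos hτ d)]
    rw [integral_const_mul, Measure.integral_comp_smul volume fun u => |density (f t) u|,
      h.integral_abs_density ht, finrank_euclideanSpace_fin, abs_of_pos (by positivity),
      smul_eq_mul, ← mul_assoc, mul_inv_cancel₀ (by positivity), one_mul]
  have hρB : ∀ u, |τ ^ d * density (f t) (τ • u)| ≤ A / τ + B := fun u => by
    have := abs_sub_abs_le_abs_sub (τ ^ d * density (f t) (τ • u)) (w u)
    linarith [hA' u, hB u]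
  rw [field, gradInvLaplacian_scale (by omega) hτ,
    gradInvLaplacian_sub (by omega) hρi hw hρB hB]
  have hm2 : ∫ u, |τ ^ d * density (f t) (τ • u) - w u| ≤ 2 * mass α f := by
    calc _ ≤ ∫ u, (|τ ^ d * density (f t) (τ • u)| + |w u|) :=
          integral_mono (hρi.sub hw).abs (hρi.abs.add hw.abs) fun u => abs_sub _ _
      _ ≤ _ := by rw [integral_add hρi.abs hw.abs, hρm]; linarith
  -- The radius `τ^(1/d)` balances `r/τ` against `r^(1-d)`; both equal `τ^((1-d)/d)`.
  have hr : 0 < τ ^ (1 / (d : ℝ)) := by positivity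
  refine (norm_gradInvLaplacian_le (by omega) (hρi.sub hw) hA' hm2 hr _).trans (le_of_eq ?_)
  have e1 : τ⁻¹ * τ ^ (1 / (d : ℝ)) = τ ^ ((1 - (d : ℝ)) / d) := by
    rw [← Real.rpow_neg_one, ← Real.rpow_add hτ]
    congr 1; field_simp; ring
  have e2 : ((τ ^ (1 / (d : ℝ))) ^ (d - 1))⁻¹ = τ ^ ((1 - (d : ℝ)) / d) := by
    rw [← Real.rpow_natCast, ← Real.rpow_mul hτ.le, ← Real.rpow_neg hτ.le,
      Nat.cast_sub (by omega)]
    congr 1; push_cast; field_simp; ring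
  calc _ = A * (τ⁻¹ * τ ^ (1 / (d : ℝ)))
        + (sphereArea d)⁻¹ * (2 * mass α f) * ((τ ^ (1 / (d : ℝ))) ^ (d - 1))⁻¹ := by ring
    _ = _ := by rw [e1, e2]; ring

end IsDispersing

end VlasovPoisson

end

noncomputable section

namespace VlasovPoisson

open scoped NNReal ENNReal

variable {d : ℕ}

/-! ### Bounds on the data -/

theorem exists_ae_norm_le {V F : Type*} [MeasureSpace V] [NormedAddCommGroup F] {G : V → F}
    (hG : MemLp G ⊤ volume) : ∃ M : ℝ, 0 ≤ M ∧ ∀ᵐ z, ‖G z‖ ≤ M := by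
  refine ⟨(eLpNorm G ⊤ volume).toReal, ENNReal.toReal_nonneg, ?_⟩
  filter_upwards [ae_le_eLpNormEssSup (f := G) (μ := (volume : Measure V))] with z hz
  rw [← eLpNorm_exponent_top] at hz
  have := ENNReal.toReal_mono hG.2.ne hz
  rwa [toReal_enorm] at this

theorem le_of_ae_le {V : Type*} [TopologicalSpace V] [MeasureSpace V]
    [(volume : Measure V).IsOpenPosMeasure] {φ : V → ℝ} (hφ : Continuous φ) {M : ℝ}
    (h : ∀ᵐ z, φ z ≤ M) (z : V) : φ z ≤ M := by
  have h1 : Dense {z | φ z ≤ M} := Measure.dense_of_ae h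
  have h2 : IsClosed {z | φ z ≤ M} := isClosed_le hφ continuous_const
  have h3 := h1.closure_eq
  rw [h2.closure_eq] at h3
  exact (h3 ▸ mem_univ z : z ∈ {z | φ z ≤ M})

/-- A `C¹` function in `W^{1,∞}` is bounded, together with its gradient. -/
theorem MemW1Infty.exists_bound {V : Type*} [NormedAddCommGroup V] [NormedSpace ℝ V]
    [MeasureSpace V] [BorelSpace V] [FiniteDimensional ℝ V]
    [(volume : Measure V).IsAddHaarMeasure] {H : V → ℝ} (hH : MemW1Infty H)
    (hc : ContDiff ℝ 1 H) : ∃ M : ℝ, 0 ≤ M ∧ (∀ z, |H z| ≤ M) ∧ ∀ z, ‖fderiv ℝ H z‖ ≤ M := by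
  obtain ⟨h1, G, hG, hint⟩ := hH
  obtain ⟨M₁, hM₁, hM₁H⟩ := exists_ae_norm_le h1
  obtain ⟨M₂, hM₂, hM₂G⟩ := exists_ae_norm_le hG
  refine ⟨max M₁ M₂, hM₁.trans (le_max_left _ _), fun z => ?_, fun z => ?_⟩
  · exact (le_of_ae_le hc.continuous.norm hM₁H z).trans (le_max_left _ _)
  · refine (ContinuousLinearMap.opNorm_le_bound _ hM₂ fun e => ?_).trans (le_max_right _ _)
    have hd : Continuous fun z => fderiv ℝ H z e :=
      (hc.continuous_fderiv (by simp)).clm_apply continuous_const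
    have hGe : MemLp (fun z => G z e) ⊤ volume :=
      (ContinuousLinearMap.apply ℝ ℝ e).comp_memLp' hG
    -- Testing against smooth compactly supported functions identifies the weak gradient with the
    -- classical one almost everywhere; by continuity its bound then holds at every point.
    have hae : ∀ᵐ z, fderiv ℝ H z e = G z e := by
      refine ae_eq_of_integral_contDiff_smul_eq hd.locallyIntegrable
        (hGe.locallyIntegrable le_top) fun φ hφ hφc => ?_
      have hφd : Continuous fun z => fderiv ℝ φ z e :=
        (hφ.continuous_fderiv (by simp)).clm_apply continuous_const
      have hparts := integral_mul_fderiv_eq_neg_fderiv_mul_of_integrable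
        (μ := (volume : Measure V)) (𝕜 := ℝ) (f := H) (g := φ) (v := e)
        ((hd.mul hφ.continuous).integrable_of_hasCompactSupport hφc.mul_left)
        ((hc.continuous.mul hφd).integrable_of_hasCompactSupport
          ((hφc.fderiv_apply (𝕜 := ℝ) e).mul_left))
        ((hc.continuous.mul hφ.continuous).integrable_of_hasCompactSupport hφc.mul_left)
        (fun z _ => hc.differentiable (by simp) z) (fun z _ => hφ.differentiable (by simp) z)
      have h2 := hint φ hφ hφc e
      rw [hparts, neg_inj] at h2
      simpa only [smul_eq_mul, mul_comm] using h2
    refine le_of_ae_le hd.norm ?_ z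
    filter_upwards [hae, hM₂G] with z hz hGz
    rw [hz]
    exact (ContinuousLinearMap.le_opNorm _ _).trans (by gcongr)

theorem bracket_rpow (u : Sp d) (q : ℝ) : bracket u ^ q = (1 + ‖u‖ ^ 2) ^ (q / 2) := by
  rw [bracket, Real.sqrt_eq_rpow, ← Real.rpow_mul (by positivity)]
  congr 1; ring

theorem one_add_sq_rpow_le {p : ℝ} (hp : 0 ≤ p) (u : Sp d) :
    (1 + ‖u‖ ^ 2) ^ (-p / 2) ≤ 2 ^ p * (1 + ‖u‖) ^ (-p) := by
  have h0 := norm_nonneg u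
  have h1 : ((1 + ‖u‖) / 2) ^ 2 ≤ 1 + ‖u‖ ^ 2 := by nlinarith [sq_nonneg (‖u‖ - 1)]
  calc (1 + ‖u‖ ^ 2) ^ (-p / 2) ≤ (((1 + ‖u‖) / 2) ^ 2) ^ (-p / 2) :=
        Real.rpow_le_rpow_of_nonpos (by positivity) h1 (by linarith)
    _ = ((1 + ‖u‖) / 2) ^ (-p) := by
        rw [← Real.rpow_natCast, ← Real.rpow_mul (by positivity)]
        congr 1; push_cast; ring
    _ = _ := by
        rw [Real.div_rpow (by positivity) (by norm_num), Real.rpow_neg (by norm_num : (0:ℝ) ≤ 2),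
          div_inv_eq_mul, mul_comm]

theorem hasFDerivAt_one_add_sq_rpow (q : ℝ) (u : Sp d) :
    HasFDerivAt (fun u : Sp d => (1 + ‖u‖ ^ 2) ^ q)
      ((q * (1 + ‖u‖ ^ 2) ^ (q - 1)) • ((2 : ℝ) • innerSL ℝ u)) u := by
  have h1 : HasFDerivAt (fun u : Sp d => 1 + ‖u‖ ^ 2) ((2 : ℝ) • innerSL ℝ u) u := by
    have := ((hasStrictFDerivAt_norm_sq u).hasFDerivAt).const_add 1
    exact this.congr_fderiv (by ext v; simp)
  exact h1.rpow_const (Or.inl (by positivity))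

theorem norm_deriv_weight_le {p : ℝ} (hp : 0 ≤ p) (u : Sp d) :
    ‖(-p / 2 * (1 + ‖u‖ ^ 2) ^ (-p / 2 - 1)) • ((2 : ℝ) • innerSL ℝ u)‖
      ≤ p * (1 + ‖u‖ ^ 2) ^ (-p / 2) := by
  have h0 : 0 < 1 + ‖u‖ ^ 2 := by positivity
  rw [norm_smul, norm_smul, innerSL_apply_norm, Real.norm_eq_abs, Real.norm_eq_abs, abs_mul,
    abs_of_nonneg (Real.rpow_nonneg h0.le _), Real.rpow_sub_one h0.ne']
  have h1 : |-p / 2| = p / 2 := by rw [neg_div, abs_neg, abs_of_nonneg (by linarith)]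
  rw [h1, abs_of_pos two_pos]
  have h2 : ‖u‖ / (1 + ‖u‖ ^ 2) ≤ 1 := by
    rw [div_le_one h0]; nlinarith [sq_nonneg (‖u‖ - 1)]
  calc _ = p * (1 + ‖u‖ ^ 2) ^ (-p / 2) * (‖u‖ / (1 + ‖u‖ ^ 2)) := by ring
    _ ≤ p * (1 + ‖u‖ ^ 2) ^ (-p / 2) * 1 := by gcongr
    _ = _ := mul_one _

/-- Undoes the shear at time `0` and divides out the weight, turning the `W^{1,∞}` hypothesis into
pointwise decay of the datum and of its gradient. The moment of order `n` enters through `|y|² ≤ 1 +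
|y|^n`. -/
theorem exists_isDispersing (hd : 4 ≤ d) {α : ℝ} (hα : 0 ≤ α) {f₀ : Sp d → Sp d → ℝ}
    {f : ℝ → Sp d → Sp d → ℝ} (hf₀_nonneg : ∀ x v, 0 ≤ f₀ x v)
    (hf₀_int : Integrable (fun z : Sp d × Sp d => f₀ z.1 z.2)) (hf : IsClassicalSolution f₀ f)
    {n : ℝ} (hn : 2 ≤ n)
    (hmoment : Integrable (fun z : Sp d × Sp d => ‖z.1 - α • z.2‖ ^ n * f₀ z.1 z.2))
    {p : ℝ} (hp : (d : ℝ) + 1 < p)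
    (hweight : MemW1Infty (fun z : Sp d × Sp d => bracket (z.1 - α • z.2) ^ p * f₀ z.1 z.2)) :
    ∃ C₀ : ℝ, IsDispersing α p C₀ f₀ f := by
  have hp0 : 0 ≤ p := by have : (0 : ℝ) ≤ d := d.cast_nonneg
                         linarith
  have hf0 : f 0 = f₀ := by ext x v; exact hf.initial x v
  have hcd : ContDiff ℝ 1 fun z : Sp d × Sp d => f₀ z.1 z.2 := by
    have := hf.contDiff_slice le_rfl
    rwa [hf0] at this
  have hg : ∀ z : Sp d × Sp d, sheared α f 0 z = f₀ (z.1 + α • z.2) z.2 := fun z => by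
    rw [sheared, hf0, zero_add]
  have hsq : ContDiff ℝ 1 fun z : Sp d × Sp d => 1 + ‖z.1 - α • z.2‖ ^ 2 :=
    contDiff_const.add ((contDiff_fst.sub (contDiff_snd.const_smul α)).norm_sq ℝ)
  have hHc : ContDiff ℝ 1 fun z : Sp d × Sp d => bracket (z.1 - α • z.2) ^ p * f₀ z.1 z.2 := by
    simp only [bracket_rpow]
    exact (hsq.rpow_const_of_ne fun z => by positivity).mul hcd
  have : (volume : Measure (Sp d × Sp d)).IsAddHaarMeasure :=
    inferInstanceAs ((volume : Measure (Sp d)).prod volume).IsAddHaarMeasure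
  obtain ⟨M, hM0, hM, hM'⟩ := hweight.exists_bound hHc
  set H : Sp d × Sp d → ℝ := fun z => bracket (z.1 - α • z.2) ^ p * f₀ z.1 z.2 with hH
  set T : Sp d × Sp d →L[ℝ] Sp d × Sp d :=
    (ContinuousLinearMap.fst ℝ (Sp d) (Sp d) + α • ContinuousLinearMap.snd ℝ (Sp d) (Sp d)).prod
      (ContinuousLinearMap.snd ℝ (Sp d) (Sp d)) with hT
  -- The datum is the weight `(1 + |y|²)^(-p/2)` times the bounded function `H` read in the original
  -- coordinates; differentiating the weight costs only a constant factor.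
  have hgH : sheared α f 0 = fun z => (1 + ‖z.1‖ ^ 2) ^ (-p / 2) * H (T z) := by
    ext z
    have h0 : 0 < 1 + ‖z.1‖ ^ 2 := by positivity
    have : H (T z) = (1 + ‖z.1‖ ^ 2) ^ (p / 2) * f₀ (z.1 + α • z.2) z.2 := by
      simp [hH, hT, bracket_rpow]
    rw [hg, this, ← mul_assoc, ← Real.rpow_add h0]
    simp [neg_div]
  have hb : ∀ z : Sp d × Sp d, HasFDerivAt (fun z : Sp d × Sp d => (1 + ‖z.1‖ ^ 2) ^ (-p / 2))
      (((-p / 2 * (1 + ‖z.1‖ ^ 2) ^ (-p / 2 - 1)) • ((2 : ℝ) • innerSL ℝ z.1)).comp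
        (ContinuousLinearMap.fst ℝ (Sp d) (Sp d))) z := fun z =>
    (hasFDerivAt_one_add_sq_rpow (-p / 2) z.1).comp z hasFDerivAt_fst
  have hHT : ∀ z, HasFDerivAt (fun z => H (T z)) ((fderiv ℝ H (T z)).comp T) z := fun z =>
    ((hHc.differentiable (by simp) (T z)).hasFDerivAt).comp z T.hasFDerivAt
  have hg0 : ∀ z, 0 ≤ sheared α f 0 z := fun z => by rw [hg]; exact hf₀_nonneg _ _
  have hgi : Integrable (sheared α f 0) := by
    have := (IsDispersing.integrable_shear_iff (ψ := fun z : Sp d × Sp d => f₀ z.1 z.2) α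
      hf₀_int.1).2 hf₀_int
    exact this.congr (Eventually.of_forall fun z => (hg z).symm)
  have hgm : Integrable fun z : Sp d × Sp d => ‖z.1‖ ^ n * sheared α f 0 z := by
    have := (IsDispersing.integrable_shear_iff (ψ := fun z : Sp d × Sp d =>
      ‖z.1 - α • z.2‖ ^ n * f₀ z.1 z.2) α hmoment.1).2 hmoment
    refine this.congr (Eventually.of_forall fun z => ?_)
    simp only [add_sub_cancel_right, hg]
  refine ⟨2 ^ p * (M * ‖T‖ + M * p + M), hd, hα, hp, by positivity, hf, hg0, hgi,
    fun z => ?_, fun z => ?_, ?_⟩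
  · have h1 := one_add_sq_rpow_le hp0 z.1
    have h2 : 0 ≤ (1 + ‖z.1‖) ^ (-p) := by positivity
    have h3 : 0 ≤ M * ‖T‖ + M * p := by positivity
    calc _ = (1 + ‖z.1‖ ^ 2) ^ (-p / 2) * H (T z) := congrFun hgH z
      _ ≤ (1 + ‖z.1‖ ^ 2) ^ (-p / 2) * M := by
          gcongr
          exact (le_abs_self _).trans (hM _)
      _ ≤ (2 ^ p * (1 + ‖z.1‖) ^ (-p)) * (M * ‖T‖ + M * p + M) := by
          gcongr
          linarith
      _ = _ := by ring
  · have h1 := one_add_sq_rpow_le hp0 z.1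
    have hfst : ‖ContinuousLinearMap.fst ℝ (Sp d) (Sp d)‖ ≤ 1 :=
      ContinuousLinearMap.norm_fst_le ..
    have h2 : HasFDerivAt (fun z : Sp d × Sp d => (1 + ‖z.1‖ ^ 2) ^ (-p / 2) * H (T z)) _ z :=
      (hb z).mul (hHT z)
    rw [hgH, h2.fderiv]
    have hw0 : 0 ≤ (1 + ‖z.1‖ ^ 2) ^ (-p / 2) := by positivity
    calc _ ≤ (1 + ‖z.1‖ ^ 2) ^ (-p / 2) * (M * ‖T‖)
          + M * (p * (1 + ‖z.1‖ ^ 2) ^ (-p / 2) * 1) := by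
          refine (norm_add_le _ _).trans (add_le_add ?_ ?_)
          · rw [norm_smul, Real.norm_of_nonneg hw0]
            gcongr
            exact (ContinuousLinearMap.opNorm_comp_le _ _).trans (by gcongr; exact hM' _)
          · rw [norm_smul, Real.norm_eq_abs]
            gcongr
            · exact hM _
            · exact (ContinuousLinearMap.opNorm_comp_le _ _).trans
                (mul_le_mul (norm_deriv_weight_le hp0 _) hfst (norm_nonneg _) (by positivity))
      _ = (1 + ‖z.1‖ ^ 2) ^ (-p / 2) * (M * ‖T‖ + M * p) := by ring
      _ ≤ (2 ^ p * (1 + ‖z.1‖) ^ (-p)) * (M * ‖T‖ + M * p + M) :=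
          mul_le_mul h1 (by linarith) (by positivity) (by positivity)
      _ = _ := by ring
  · have hc : Continuous fun z : Sp d × Sp d => sheared α f 0 z * ‖z.1‖ ^ 2 :=
      (hf.contDiff_sheared α le_rfl).continuous.mul (by fun_prop)
    refine (hgi.add hgm).mono' hc.aestronglyMeasurable (Eventually.of_forall fun z => ?_)
    rw [Real.norm_of_nonneg (mul_nonneg (hg0 z) (sq_nonneg _))]
    have h1 : ‖z.1‖ ^ 2 ≤ 1 + ‖z.1‖ ^ n := by
      rcases le_total ‖z.1‖ 1 with h | h
      · have : ‖z.1‖ ^ 2 ≤ 1 := pow_le_one₀ (norm_nonneg _) h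
        have : 0 ≤ ‖z.1‖ ^ n := by positivity
        linarith
      · have : ‖z.1‖ ^ (2 : ℝ) ≤ ‖z.1‖ ^ n := Real.rpow_le_rpow_of_exponent_le h hn
        rw [Real.rpow_two] at this
        linarith
    calc _ ≤ sheared α f 0 z * (1 + ‖z.1‖ ^ n) := by gcongr; exact hg0 z
      _ = _ := by simp only [Pi.add_apply]; ring

theorem hasFieldDecay_of_le {α a : ℝ} (hα : 0 ≤ α) (ha : 0 ≤ a) {f : ℝ → Sp d → Sp d → ℝ}
    (hfield : ∃ C : ℝ, ∀ t : ℝ, 0 ≤ t → 0 < t + α → ∀ x : Sp d,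
      ‖field (f t) x‖ ≤ C * (t + α) ^ (-a)) : HasFieldDecay f a := by
  obtain ⟨C, hC⟩ := hfield
  refine ⟨|C|, abs_nonneg C, fun t ht x => ?_⟩
  have ht0 : 0 < t := by linarith
  rw [efield_of_nonneg f ht0.le]
  refine (hC t ht0.le (by linarith) x).trans ?_
  have : 0 ≤ (t + α) ^ (-a) := Real.rpow_nonneg (by linarith) _
  calc _ ≤ |C| * (t + α) ^ (-a) := by gcongr; exact le_abs_self C
    _ ≤ _ := mul_le_mul_of_nonneg_left
      (Real.rpow_le_rpow_of_nonpos ht0 (by linarith) (by linarith)) (abs_nonneg C)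

/-- Passes from rates in `1 + t` to rates in `t + α`, by `t + α ≤ (1 + α)(1 + t)`; this also covers
small `t + α`. -/
theorem div_one_add_pow_le_rpow {α K t q : ℝ} (hα : 0 ≤ α) (hK : 0 ≤ K) (ht : 0 ≤ t)
    (hτ : 0 < t + α) {n : ℕ} (hq : q = -(n : ℝ)) :
    K / (1 + t) ^ n ≤ K * (1 + α) ^ n * (t + α) ^ q := by
  rw [hq, Real.rpow_neg hτ.le, Real.rpow_natCast, ← div_eq_mul_inv,
    div_le_div_iff₀ (by positivity) (by positivity), mul_assoc, ← mul_pow]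
  gcongr
  nlinarith

end VlasovPoisson

end

/-! ### Assembly of the asymptotic statements -/

theorem mainTheorem2 (d : ℕ) (hd : 4 ≤ d) (α : ℝ) (hα : 0 ≤ α)
    (f₀ : VlasovPoisson.Sp d → VlasovPoisson.Sp d → ℝ)
    (f : ℝ → VlasovPoisson.Sp d → VlasovPoisson.Sp d → ℝ)
    (hf₀_nonneg : ∀ x v, 0 ≤ f₀ x v)
    (hf₀_int : Integrable (fun z : VlasovPoisson.Sp d × VlasovPoisson.Sp d => f₀ z.1 z.2))
    (hf : VlasovPoisson.IsClassicalSolution f₀ f)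
    -- the moment of order `n` is initially finite, for some `n > d (d - 1)`
    (n : ℝ) (hn : (d : ℝ) * ((d : ℝ) - 1) < n)
    (hmoment : Integrable (fun z : VlasovPoisson.Sp d × VlasovPoisson.Sp d =>
      ‖z.1 - α • z.2‖ ^ n * f₀ z.1 z.2))
    -- the decay assumption on the electric field
    (a : ℝ) (ha : ((d : ℝ) ^ 2 - d - 4) / ((d : ℝ) ^ 2 - 2 * d - 2) < a)
    (hfield : ∃ C : ℝ, ∀ t : ℝ, 0 ≤ t → 0 < t + α → ∀ x : VlasovPoisson.Sp d,
      ‖VlasovPoisson.field (f t) x‖ ≤ C * (t + α) ^ (-a))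
    -- the weighted regularity of the initial datum
    (p : ℝ) (hp : (d : ℝ) + 1 < p)
    (hweight : VlasovPoisson.MemW1Infty
      (fun z : VlasovPoisson.Sp d × VlasovPoisson.Sp d =>
        VlasovPoisson.bracket (z.1 - α • z.2) ^ p * f₀ z.1 z.2)) :
    -- (a) and (b)
    (∃ Finf : VlasovPoisson.Sp d → ℝ,
      Continuous Finf ∧ MemLp Finf 1 volume ∧ MemLp Finf ⊤ volume ∧
      -- (a) convergence of the spatial average
      (∀ t : ℝ, 0 ≤ t → ∀ v : VlasovPoisson.Sp d, Integrable (fun x => f t x v)) ∧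
      TendstoUniformly (fun t => VlasovPoisson.spatialAverage (f t)) Finf atTop ∧
      (∃ C : ℝ, ∀ t : ℝ, 0 ≤ t → 0 < t + α → ∀ v : VlasovPoisson.Sp d,
        |VlasovPoisson.spatialAverage (f t) v - Finf v| ≤ C * (t + α) ^ (2 - (d : ℝ))) ∧
      -- (b) the limiting field is well defined
      (∀ x : VlasovPoisson.Sp d,
        Integrable (fun y => Finf y • VlasovPoisson.kernel (x - y))) ∧
      -- (b) self-similar profile of the electric field
      (∃ C : ℝ, ∀ t : ℝ, 0 ≤ t → 0 < t + α → ∀ x : VlasovPoisson.Sp d,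
        ‖(t + α) ^ ((d : ℝ) - 1) • VlasovPoisson.field (f t) x
          - VlasovPoisson.gradInvLaplacian Finf ((t + α)⁻¹ • x)‖
          ≤ C * (t + α) ^ ((1 - (d : ℝ)) / d)) ∧
      -- (b) self-similar profile of the charge density
      (∃ C : ℝ, ∀ t : ℝ, 0 ≤ t → 0 < t + α → ∀ x : VlasovPoisson.Sp d,
        |(t + α) ^ (d : ℝ) * VlasovPoisson.density (f t) x - Finf ((t + α)⁻¹ • x)|
          ≤ C * (t + α) ^ (-1 : ℝ)) ∧
      -- (b) self-similar profile of the current density, on regions of linear growth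
      (∀ t : ℝ, 0 ≤ t → 0 < t + α → ∀ x : VlasovPoisson.Sp d,
        Integrable (fun v => f t x v • v)) ∧
      (∀ K : ℝ, ∃ C : ℝ, ∀ t : ℝ, 0 ≤ t → 0 < t + α → ∀ x : VlasovPoisson.Sp d,
        ‖x‖ ≤ K * (t + α) →
        ‖(t + α) ^ (d : ℝ) • VlasovPoisson.current (f t) x
          - Finf ((t + α)⁻¹ • x) • ((t + α)⁻¹ • x)‖
          ≤ C * (t + α) ^ (-1 : ℝ))) ∧
    -- (c) scattering along free-transport trajectories
    (∃ finf : VlasovPoisson.Sp d → VlasovPoisson.Sp d → ℝ,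
      Continuous (fun z : VlasovPoisson.Sp d × VlasovPoisson.Sp d => finf z.1 z.2) ∧
      MemLp (fun z : VlasovPoisson.Sp d × VlasovPoisson.Sp d => finf z.1 z.2) 1 volume ∧
      MemLp (fun z : VlasovPoisson.Sp d × VlasovPoisson.Sp d => finf z.1 z.2) ⊤ volume ∧
      TendstoUniformly
        (fun (t : ℝ) (z : VlasovPoisson.Sp d × VlasovPoisson.Sp d) =>
          f t (z.1 + (t + α) • z.2) z.2)
        (fun z => finf z.1 z.2) atTop ∧
      (∃ C : ℝ, ∀ t : ℝ, 0 ≤ t → 0 < t + α → ∀ x v : VlasovPoisson.Sp d,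
        |f t (x + (t + α) • v) v - finf x v| ≤ C * (t + α) ^ (3 - (d : ℝ)))) := by
  have hD : (4 : ℝ) ≤ d := by exact_mod_cast hd
  obtain ⟨C₀, h⟩ := VlasovPoisson.exists_isDispersing hd hα hf₀_nonneg hf₀_int hf
    (by nlinarith : 2 ≤ n) hmoment hp hweight
  have ha0 : 0 ≤ a := by
    refine le_trans (div_nonneg ?_ ?_) ha.le <;> nlinarith
  obtain ⟨K, hK⟩ := h.exists_sharpBounds ha (VlasovPoisson.hasFieldDecay_of_le hα ha0 hfield)
  have hK0 := hK.const_nonneg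
  have hI := VlasovPoisson.IsDispersing.weightIntegral_nonneg d p
  have hI' := VlasovPoisson.IsDispersing.weightIntegral_nonneg d (p - 1)
  constructor
  · obtain ⟨w, hwc, hw, hwi, hwm, hunif, hrate⟩ := h.exists_limit_spatialAverage hK
    set B := K * VlasovPoisson.IsDispersing.weightIntegral d p
    set L := (1 + α) * (d + 1) * K ^ 2 * VlasovPoisson.IsDispersing.weightIntegral d p with hL
    have hL0 : 0 ≤ L := by positivity
    have hB : ∀ v, |w v| ≤ B := fun v => abs_le.2 ⟨by linarith [(hw v).1, (hw v).2], (hw v).2⟩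
    -- The density is compared with the spatial average at `x/τ`, and that with its limit. The
    -- second error is `(1+t)^(2-d)`, at least as small as `1/(1+t)`, so the first one sets the
    -- rate.
    have hρ : ∀ t : ℝ, 0 ≤ t → 0 < t + α → ∀ x,
        |(t + α) ^ d * VlasovPoisson.density (f t) x - w ((t + α)⁻¹ • x)|
          ≤ (K * VlasovPoisson.IsDispersing.weightIntegral d (p - 1) + L * (1 + α)) / (t + α) := by
      intro t ht hτ x
      have h1 := h.abs_density_sub_spatialAverage_le hK ht hτ x
      have h2 := hrate t ht ((t + α)⁻¹ • x)
      have h3 : L / (1 + t) ^ (d - 2) ≤ L * (1 + α) / (t + α) := by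
        calc L / (1 + t) ^ (d - 2) ≤ L / (1 + t) ^ 1 := by
              gcongr
              · linarith
              · omega
          _ ≤ L * (1 + α) ^ 1 * (t + α) ^ (-1 : ℝ) :=
              VlasovPoisson.div_one_add_pow_le_rpow hα hL0 ht hτ (by simp)
          _ = _ := by rw [pow_one, Real.rpow_neg_one]; rfl
      rw [add_div]
      exact (abs_sub_le _ _ _).trans (add_le_add h1 (h2.trans h3))
    refine ⟨w, hwc, memLp_one_iff_integrable.2 hwi,
      memLp_top_of_bound hwc.aestronglyMeasurable B (Eventually.of_forall hB),
      fun t ht v => h.integrable_f_fst hK ht v, hunif,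
      ⟨L * (1 + α) ^ (d - 2), fun t ht hτ v => (hrate t ht v).trans
        (VlasovPoisson.div_one_add_pow_le_rpow hα hL0 ht hτ (by
          rw [Nat.cast_sub (by omega)]; push_cast; ring))⟩,
      fun x => VlasovPoisson.integrable_smul_kernel (by omega) hwi hB x, ?_, ?_,
      fun t ht hτ x => (h.current_profile hK ht hτ x).1, fun k => ?_⟩
    · refine ⟨K * VlasovPoisson.IsDispersing.weightIntegral d (p - 1) + L * (1 + α)
        + (VlasovPoisson.sphereArea d)⁻¹ * (2 * VlasovPoisson.IsDispersing.mass α f),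
        fun t ht hτ x => ?_⟩
      have := h.norm_field_sub_profile_le ht hτ hwi hB hwm (hρ t ht hτ) x
      rwa [← Real.rpow_natCast, Nat.cast_sub (by omega), Nat.cast_one] at this
    · refine ⟨K * VlasovPoisson.IsDispersing.weightIntegral d (p - 1) + L * (1 + α),
        fun t ht hτ x => ?_⟩
      rw [Real.rpow_natCast, Real.rpow_neg_one]
      exact hρ t ht hτ x
    · refine ⟨K * VlasovPoisson.IsDispersing.weightIntegral d (p - 1)
        + (K * VlasovPoisson.IsDispersing.weightIntegral d (p - 1) + L * (1 + α)) * |k|,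
        fun t ht hτ x hx => ?_⟩
      have h1 := (h.current_profile hK ht hτ x).2
      have h2 := hρ t ht hτ x
      have h3 : ‖(t + α)⁻¹ • x‖ ≤ |k| := by
        rw [norm_smul, Real.norm_of_nonneg (by positivity), inv_mul_le_iff₀ hτ, mul_comm]
        exact hx.trans (by gcongr; exact le_abs_self k)
      rw [Real.rpow_natCast, Real.rpow_neg_one]
      set j := (t + α) ^ d • VlasovPoisson.current (f t) x
      set r := (t + α) ^ d * VlasovPoisson.density (f t) x
      set y := (t + α)⁻¹ • x
      -- The error of the density gets multiplied by `|x|/τ`; this is why the region is restricted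
      -- to `|x| ≤ k τ`.
      calc ‖j - w y • y‖ = ‖(j - r • y) + (r - w y) • y‖ := by congr 1; module
        _ ≤ K * VlasovPoisson.IsDispersing.weightIntegral d (p - 1) / (t + α)
            + (K * VlasovPoisson.IsDispersing.weightIntegral d (p - 1) + L * (1 + α)) / (t + α) * |k| := by
          refine (norm_add_le _ _).trans (add_le_add h1 ?_)
          rw [norm_smul]
          exact mul_le_mul h2 h3 (norm_nonneg _) (by positivity)
        _ = _ := by ring
  · obtain ⟨w, hwc, hw, hwi, hunif, hrate⟩ := h.exists_scattering_state hK
    refine ⟨fun x v => w (x, v), hwc, memLp_one_iff_integrable.2 hwi,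
      memLp_top_of_bound hwc.aestronglyMeasurable K (Eventually.of_forall fun z => ?_), hunif,
      ⟨(1 + α) * K ^ 2 * (1 + α) ^ (d - 3), fun t ht hτ x v => (hrate t ht (x, v)).trans
        (VlasovPoisson.div_one_add_pow_le_rpow hα (by positivity) ht hτ (by
          rw [Nat.cast_sub (by omega)]; push_cast; ring))⟩⟩
    rw [Real.norm_of_nonneg (hw z).1]
    exact (hw z).2
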